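/- **Setting.** A *quad mesh* is a finite closed oriented surface complex of quadrilaterals glued along sides, in which every vertex has valence at least $3$ and every edge has two different end vertices. A *knot multiset* $K$ is a finite multiset in $(0,1)$ with multiplicities at most $2$; a cubic spline with knots $K$ is piecewise cubic and $C^{3-m}$ at an $m$-fold knot, and a bicubic spline patch with knots $K$ is a tensor-product spline $[0,1]^2\to\mathbb R^3$ with knots $K$ in both directions. A spline surface over a mesh has one such patch per quad. At a vertex of valence $n$ let $p^1,\dots,p^n$ be the patches in cyclic order, parameterized so that the vertex is $(0,0)$ and $p^k(u,0)=p^{k-1}(0,u)$ on the common edge. The *unbiased $G^1$ constraints* are $$\partial_2p^k(u,0)+\partial_1p^{k-1}(0,u)=\alpha^k(u)\,\partial_1p^k(u,0),\qquad u\in[0,1],$$ with scalar functions $\alpha^k$, one per directed edge, satisfying $\alpha^k(0)=2\cos(2\pi/n)$; the function of the reversed edge is $u\mapsto-\alpha^k(1-u)$. *Admissible vertex data* for $\alpha$ are, at every vertex, a position and values $t^k=\partial_1p^k$, $a^k=\partial_1^2p^k$, $b^k=\partial_1\partial_2p^k$ at $(0,0)$ with $t^k,t^{k+1}$ linearly independent,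 $t^{k+1}+t^{k-1}=2\cos(2\pi/n)\,t^k$ and $b^k+b^{k-1}=2\cos(2\pi/n)\,a^k+(\alpha^k)'(0)\,t^k$. Given $K$, a mesh, and functions $\alpha$ fixed for that mesh before any geometric data are given, the *construction succeeds* if (a) every choice of positions and tangents with the above properties extends to admissible data; (b) for all admissible data there is a spline surface with knots $K$ that satisfies the unbiased $G^1$ constraints with $\alpha$ and has these data at the vertices; (c) no straight segments are forced: for all admissible data and every directed edge, the data at all vertices other than the start of the edge can be changed, keeping them admissible, so that some surface as in (b) has a boundary curve along this edge that does not begin with a straight segment; moreover, for some admissible data some surface as in (b) is regular ($\partial_1\times\partial_2\neq0$) at all edge knots (the points of the patch boundaries with parameters $(t,0),(1,t),(t,1),(0,t)$, $t\in K$) and has no straight segment on any boundary curve. **Theorem (the lower bound is sharp).** Let $K_0=\{\tfrac13,\tfrac13,\tfrac23,\tfrac23\}$ (exactly two internal knots, both double). 1. The $3\times3$ arrangements of $C^1$-connected bicubic Bézier patches on $[0,1]^2$ are exactly the bicubic spline patches with knots $K_0$. 2. There are functions $\alpha_{m,n}:[0,1]\to\mathbb R$ ($m,n\ge3$), polynomial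 of degree at most $1$ on $[0,\frac13]$ and on $[\frac23,1]$ and of degree at most $2$ on $[\frac13,\frac23]$, of degree exactly $2$ there if $m\ne n$, such that on every quad mesh the construction with knots $K_0$ succeeds with $\alpha=\alpha_{m,n}$ on each directed edge from a vertex of valence $m$ to a vertex of valence $n$. 3. This is the fewest knots possible: if $K$ is a knot multiset such that on every quad mesh the construction with knots $K$ succeeds for some $\alpha$, then $K$ has at least four elements, counted with multiplicity, and if it has exactly four then $K=\{\sigma,\sigma,\tau,\tau\}$ with $\sigma<\tau$, i.e. two internal double knots. -/

import Mathlib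

open Polynomial

noncomputable section

namespace SharpKnots

/-- Euclidean three-space, in which the surfaces live. -/
abbrev E3 := EuclideanSpace ℝ (Fin 3)

/-! ### Closed oriented quad meshes -/

/-- Unit squares glued along their sides. The dart `(q, i)` is the `i`-th side of the quad `q`,
traversed counterclockwise from corner `i` to corner `i + 1`. The involution `opp` sends a dart to
the same edge, traversed in the opposite direction as a side of the quad across that edge. -/
structure QuadGluing where
  Quad : Type
  [finite_quad : Finite Quad]
  opp : Equiv.Perm (Quad × Fin 4)
  opp_opp : ∀ d, opp (opp d) = d

namespace QuadGluing

/-- Directed edges (half-edges). -/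
abbrev Dart (M : QuadGluing) : Type := M.Quad × Fin 4

/-- The next dart, counterclockwise, with the same initial vertex: the other edge of the quad
at that corner, directed away from the corner. -/
def rot (M : QuadGluing) : Equiv.Perm M.Dart :=
  ((Equiv.refl M.Quad).prodCongr (Equiv.subRight (1 : Fin 4))).trans M.opp

/-- Vertices are the cycles of `rot`; this says that `d` and `e` start at the same vertex. -/
def SameVertex (M : QuadGluing) (d e : M.Dart) : Prop := M.rot.SameCycle d e

/-- The valence of the initial vertex of a dart: the length of its cycle under `rot`. -/
def valence (M : QuadGluing) (d : M.Dart) : ℕ := Function.minimalPeriod M.rot d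

end QuadGluing

/-- A closed oriented quad mesh: every vertex has valence at least three and every edge
has two different end vertices. -/
structure QuadMesh extends QuadGluing where
  three_le_valence : ∀ d, 3 ≤ toQuadGluing.valence d
  loopless : ∀ d, ¬ toQuadGluing.SameVertex d (opp d)

/-! ### Bicubic tensor-product splines -/

/-- A knot multiset for `C¹` cubic splines on `[0, 1]`: internal knots, each at most two-fold. -/
def IsKnotMultiset (K : Multiset ℝ) : Prop :=
  ∀ t ∈ K, 0 < t ∧ t < 1 ∧ K.count t ≤ 2

/-- Cubic splines with knots `K`: polynomial of degree at most three between knots and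
`3 - m` times continuously differentiable at an `m`-fold knot. (The first and the last polynomial
piece are extended beyond `[0, 1]`, so that one-sided derivatives at `0` and `1` are derivatives.) -/
structure IsCubicSpline (K : Multiset ℝ) (f : ℝ → ℝ) : Prop where
  piecewise : ∀ a b : ℝ, a < b → (∀ t ∈ K, t ∉ Set.Ioo a b) →
    ∃ p : ℝ[X], p.natDegree ≤ 3 ∧ ∀ x ∈ Set.Icc a b, f x = p.eval x
  smooth : ∀ t ∈ K, ContDiffAt ℝ ((3 - K.count t : ℕ)) f t

/-- Bicubic tensor-product spline patches in space, with knots `K` in both directions. -/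
def IsBicubicSpline (K : Multiset ℝ) (p : ℝ → ℝ → E3) : Prop :=
  p ∈ Submodule.span ℝ {r : ℝ → ℝ → E3 | ∃ (f g : ℝ → ℝ) (x : E3),
    IsCubicSpline K f ∧ IsCubicSpline K g ∧ r = fun u v => (f u * g v) • x}

/-- A bicubic patch in Bernstein–Bézier form with control points `b`. -/
def bezierPatch (b : Fin 4 → Fin 4 → E3) (u v : ℝ) : E3 :=
  ∑ i : Fin 4, ∑ j : Fin 4,
    ((bernsteinPolynomial ℝ 3 i).eval u * (bernsteinPolynomial ℝ 3 j).eval v) • b i j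

/-- A `3 × 3` arrangement of `C¹`-connected bicubic Bézier patches covering the unit square. -/
structure IsC1BezierArray (p : ℝ → ℝ → E3) : Prop where
  pieces : ∃ b : Fin 3 → Fin 3 → Fin 4 → Fin 4 → E3, ∀ i j : Fin 3,
    ∀ u ∈ Set.Icc (0 : ℝ) 1, ∀ v ∈ Set.Icc (0 : ℝ) 1,
      p (((i : ℝ) + u) / 3) (((j : ℝ) + v) / 3) = bezierPatch (b i j) u v
  smooth : ContDiffOn ℝ 1 (fun z : ℝ × ℝ => p z.1 z.2)
    (Set.Icc (0 : ℝ) 1 ×ˢ Set.Icc (0 : ℝ) 1)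

/-- Exactly two internal knots, both double. -/
def twoDoubleKnots : Multiset ℝ := {1 / 3, 1 / 3, 2 / 3, 2 / 3}

/-! ### Surfaces with one patch per quad -/

/-- Derivative with respect to the first argument. -/
def d1 (p : ℝ → ℝ → E3) : ℝ → ℝ → E3 := fun u v => deriv (fun x => p x v) u

/-- Derivative with respect to the second argument. -/
def d2 (p : ℝ → ℝ → E3) : ℝ → ℝ → E3 := fun u v => deriv (fun y => p u y) v

/-- The unit square rotated so that corner `i` becomes the origin and side `i` the first axis. -/
def cornerChart : Fin 4 → ℝ → ℝ → ℝ × ℝ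
  | 0, u, v => (u, v)
  | 1, u, v => (1 - v, u)
  | 2, u, v => (1 - u, 1 - v)
  | 3, u, v => (v, 1 - u)

/-- The patch of the quad to the left of `d`, in the coordinates in which the initial vertex of `d`
has parameter `(0, 0)` and `d` itself is `u ↦ (u, 0)`. -/
def localPatch {M : QuadGluing} (S : M.Quad → ℝ → ℝ → E3) (d : M.Dart) : ℝ → ℝ → E3 :=
  fun u v => S d.1 (cornerChart d.2 u v).1 (cornerChart d.2 u v).2

/-- The boundary curve along the edge `d`. -/
def edgeCurve {M : QuadGluing} (S : M.Quad → ℝ → ℝ → E3) (d : M.Dart) : ℝ → E3 :=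
  fun u => localPatch S d u 0

/-- The patches join continuously and satisfy the unbiased `G¹` constraints with the
scalar functions `α`. If `localPatch S d` is the `k`-th patch at the vertex, then
`localPatch S (M.rot.symm d)` is the `(k - 1)`-st. -/
structure IsUnbiasedG1 {M : QuadGluing} (α : M.Dart → ℝ → ℝ) (S : M.Quad → ℝ → ℝ → E3) :
    Prop where
  join : ∀ d, ∀ u ∈ Set.Icc (0 : ℝ) 1,
    localPatch S d u 0 = localPatch S (M.rot.symm d) 0 u
  tangent : ∀ d, ∀ u ∈ Set.Icc (0 : ℝ) 1,
    d2 (localPatch S d) u 0 + d1 (localPatch S (M.rot.symm d)) 0 u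
      = α d u • d1 (localPatch S d) u 0

/-- A smooth surface with one bicubic spline per quad, all with knots `K`. -/
structure IsSplineSurface {M : QuadGluing} (K : Multiset ℝ) (α : M.Dart → ℝ → ℝ)
    (S : M.Quad → ℝ → ℝ → E3) : Prop where
  spline : ∀ q, IsBicubicSpline K (S q)
  g1 : IsUnbiasedG1 α S

/-- Regularity at the edge knots of every patch. -/
def RegularAtEdgeKnots {M : QuadGluing} (K : Multiset ℝ) (S : M.Quad → ℝ → ℝ → E3) : Prop :=
  ∀ q, ∀ t ∈ K, ∀ z ∈ ({(t, 0), (1, t), (t, 1), (0, t)} : Set (ℝ × ℝ)),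
    LinearIndependent ℝ ![d1 (S q) z.1 z.2, d2 (S q) z.1 z.2]

/-! ### Second-order Taylor data at the vertices -/

/-- Second-order expansions at the vertices. In the coordinates of `localPatch S d` the four fields
at `d` are the values at `(0, 0)` of `p`, `∂₁p`, `∂₁²p` and `∂₁∂₂p`; the remaining derivatives
`∂₂p` and `∂₂²p` are the values of `tangent` and `second` at `M.rot d`. -/
structure VertexData (M : QuadGluing) where
  pos : M.Dart → E3
  tangent : M.Dart → E3
  second : M.Dart → E3
  mixed : M.Dart → E3

/-- `2 cos (2π / n)` for the initial vertex of `d`, of valence `n`. -/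
def unbiasedValue (M : QuadGluing) (d : M.Dart) : ℝ :=
  2 * Real.cos (2 * Real.pi / M.valence d)

/-- First-order part of the constraints at the vertices: a common position, tangents that are
regular and satisfy the unbiased `G¹` constraint at `u = 0`. -/
structure IsUnbiasedFrame (M : QuadGluing) (pos tangent : M.Dart → E3) : Prop where
  pos_rot : ∀ d, pos (M.rot d) = pos d
  regular : ∀ d, LinearIndependent ℝ ![tangent d, tangent (M.rot d)]
  tangent_rot : ∀ d,
    tangent (M.rot d) + tangent (M.rot.symm d) = unbiasedValue M d • tangent d

/-- The data satisfy, at every vertex, the `G¹` constraint and its first derivative at `u = 0`. -/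
structure IsAdmissible {M : QuadGluing} (α : M.Dart → ℝ → ℝ) (X : VertexData M) : Prop where
  frame : IsUnbiasedFrame M X.pos X.tangent
  mixed_rot : ∀ d, X.mixed d + X.mixed (M.rot.symm d)
    = unbiasedValue M d • X.second d
      + derivWithin (α d) (Set.Icc 0 1) 0 • X.tangent d

/-- The surface has the prescribed expansions at the vertices. -/
def Interpolates {M : QuadGluing} (S : M.Quad → ℝ → ℝ → E3) (X : VertexData M) : Prop :=
  ∀ d, localPatch S d 0 0 = X.pos d ∧
    d1 (localPatch S d) 0 0 = X.tangent d ∧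
    d1 (d1 (localPatch S d)) 0 0 = X.second d ∧
    d1 (d2 (localPatch S d)) 0 0 = X.mixed d

/-- The two sets of data agree at the initial vertex of `d`. -/
def AgreeAt {M : QuadGluing} (X Y : VertexData M) (d : M.Dart) : Prop :=
  ∀ e, M.SameVertex d e → X.pos e = Y.pos e ∧ X.tangent e = Y.tangent e ∧
    X.second e = Y.second e ∧ X.mixed e = Y.mixed e

/-! ### Constructions -/

/-- The scalar functions of the unbiased `G¹` constraints: the value at a vertex is the symmetric
one, and the functions of an edge seen from its two ends correspond. -/
structure IsUnbiasedReparam {M : QuadGluing} (α : M.Dart → ℝ → ℝ) : Prop where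
  at_vertex : ∀ d, α d 0 = unbiasedValue M d
  at_opp : ∀ d, ∀ u ∈ Set.Icc (0 : ℝ) 1, α (M.opp d) u = - α d (1 - u)
  differentiable : ∀ d, DifferentiableWithinAt ℝ (α d) (Set.Icc 0 1) 0

/-- On the mesh `M`, with the functions `α` (fixed before any geometric data are given), bicubic
splines with knots `K` admit a vertex-localized unbiased `G¹` construction without forced straight
boundary segments. -/
structure Succeeds (K : Multiset ℝ) (M : QuadGluing) (α : M.Dart → ℝ → ℝ) : Prop where
  unbiased : IsUnbiasedReparam α
  /-- the constraints at the vertices can be solved, for every choice of first-order data -/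
  solvable : ∀ pos tangent : M.Dart → E3, IsUnbiasedFrame M pos tangent →
    ∃ second mixed : M.Dart → E3, IsAdmissible α ⟨pos, tangent, second, mixed⟩
  /-- the second-order expansions at the vertices can be prescribed independently -/
  realizes : ∀ X : VertexData M, IsAdmissible α X →
    ∃ S : M.Quad → ℝ → ℝ → E3, IsSplineSurface K α S ∧ Interpolates S X
  /-- no expansion at a vertex forces a boundary curve to leave that vertex
  along a straight segment -/
  not_forced_straight : ∀ X : VertexData M, IsAdmissible α X → ∀ d : M.Dart,
    ∃ (Y : VertexData M) (S : M.Quad → ℝ → ℝ → E3),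
      IsAdmissible α Y ∧ AgreeAt X Y d ∧ IsSplineSurface K α S ∧ Interpolates S Y ∧
      ∀ b : ℝ, 0 < b → b ≤ 1 → ¬ Collinear ℝ (edgeCurve S d '' Set.Icc 0 b)
  /-- there are surfaces that are regular at all edge knots and have no straight segment on any
  boundary curve -/
  not_always_straight : ∃ (X : VertexData M) (S : M.Quad → ℝ → ℝ → E3),
    IsAdmissible α X ∧ IsSplineSurface K α S ∧ Interpolates S X ∧ RegularAtEdgeKnots K S ∧
    ∀ (d : M.Dart) (a b : ℝ), 0 ≤ a → a < b → b ≤ 1 →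
      ¬ Collinear ℝ (edgeCurve S d '' Set.Icc a b)

/-- The knots `K` are sufficient for a construction on every quad mesh. -/
def Suffices (K : Multiset ℝ) : Prop :=
  ∀ M : QuadMesh, ∃ α : M.Dart → ℝ → ℝ, Succeeds K M.toQuadGluing α

/-- `f` is given by polynomials `p₀, p₁, p₂` on the three segments of `[0, 1]`. -/
def HasSegments (f : ℝ → ℝ) (p₀ p₁ p₂ : ℝ[X]) : Prop :=
  (∀ u ∈ Set.Icc (0 : ℝ) (1 / 3), f u = p₀.eval u) ∧
  (∀ u ∈ Set.Icc (1 / 3 : ℝ) (2 / 3), f u = p₁.eval u) ∧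
  (∀ u ∈ Set.Icc (2 / 3 : ℝ) 1, f u = p₂.eval u)

end SharpKnots

end

open SharpKnots

/-! Along an edge, each coordinate `f` of the boundary curve and the same coordinate `w` of the sum
of the two cross-boundary derivatives are piecewise cubic and at least `C¹`, and the constraint
reads `w = α f'`. Both directions of the theorem are studies of this one relation.

Sufficiency. A `C¹` cubic spline on thirds is a Hermite interpolant (`herm`), so its values and
slopes at the four nodes are free. Once the second-order jets of `f` at both ends are prescribed,
only the two inner slopes remain, and they must make `α f'` again a `C¹` cubic spline. For equal
valences `α` is linear and the `C²` spline does it (`Ends.evenSlopes`). Otherwise `α` is quadratic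
on the middle segment, and three things are arranged: `f` is quadratic there, so the product stays
cubic; `α` vanishes at one inner knot and is `C¹` there, so a break of `f''` at that knot is
harmless; at the other inner knot the jump of `α'` is compensated by a jump of `f''` proportional to
`f'`. These are two linear equations for the two slopes, solvable for all end data
(`Ends.rampSlopes`, `Ends.product_eq`). The sum `w` is then split evenly between the two patches, up
to an odd term `turn` at the inner knots that provides regularity. Edges between a vertex of valence
four and one of another valence are oriented away from the former, so `α'(0) = 0` there and the
vertex constraint stays solvable.

Necessity. `EdgeSituation` extracts from a successful construction that the two end jets of `f` are
independent, that some regular curve contains no straight segment, and that some `f` with vanishing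
second-order jet at an end is not zero near that end. The last point forces `f = d u³` with `d ≠ 0`
on the first segment, hence `α` is affine there (`affine_first`). At a single knot `f` and `w` are
`C²`. If the affine function does not vanish at the knot, it continues across and no `f` can break
there (`affine_step_ne`); if it vanishes, it still continues, for otherwise all curves would be
straight beyond the knot (`affine_step_zero`).

Now let `α(0) = 0` and `α(1) ≠ 0`. Without double knots either `α = 0` effectively, or every `f` is
a single cubic, which has too few parameters for two independent jets (`false_of_no_double`). With
exactly one double knot and at most four knots in all, `α` has to change sign at a knot beyond the
double one, which gives `α'(0) α(1) < 0` (`slope_mul_neg_of_one_double`). At a vertex of valence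
four, opposite edges have the same `α'(0)` (`slope_eq_of_valence_four`). In the mesh `sixQuads` two
such opposite edges lead to vertices of valence three and five, where `α(1)` has opposite signs: a
contradiction. So two double knots are needed. -/

noncomputable section

namespace SharpKnots

/-! ### Cubic splines: closure properties -/

/-- A cubic on a set, in Taylor form at `x`. -/
def IsTaylorCubic (f : ℝ → ℝ) (x : ℝ) (s : Set ℝ) (a b c d : ℝ) : Prop :=
  ∀ u ∈ s, f u = a + b * (u - x) + c * (u - x) ^ 2 + d * (u - x) ^ 3

theorem exists_coeffs_of_natDegree_le_three {p : ℝ[X]} (hp : p.natDegree ≤ 3) (x : ℝ) :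
    ∃ a b c d : ℝ, ∀ u, p.eval u = a + b * (u - x) + c * (u - x) ^ 2 + d * (u - x) ^ 3 := by
  refine ⟨(taylor x p).coeff 0, (taylor x p).coeff 1, (taylor x p).coeff 2,
    (taylor x p).coeff 3, fun u => ?_⟩
  have h := taylor_eval_sub x p u
  rw [← h, eval_eq_sum_range' (n := 4) (by rw [natDegree_taylor]; omega)]
  simp [Finset.sum_range_succ]

theorem exists_poly_of_coeffs (x a b c d : ℝ) :
    ∃ p : ℝ[X], p.natDegree ≤ 3 ∧
      ∀ u, p.eval u = a + b * (u - x) + c * (u - x) ^ 2 + d * (u - x) ^ 3 := by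
  refine ⟨C a + C b * (X - C x) + C c * (X - C x) ^ 2 + C d * (X - C x) ^ 3, ?_, fun u => ?_⟩
  · compute_degree
  · simp

theorem IsCubicSpline.taylor {K : Multiset ℝ} {f : ℝ → ℝ} (hf : IsCubicSpline K f) {y z : ℝ}
    (hyz : y < z) (hK : ∀ t ∈ K, t ∉ Set.Ioo y z) (x : ℝ) :
    ∃ a b c d, IsTaylorCubic f x (Set.Icc y z) a b c d := by
  obtain ⟨p, hp, hfp⟩ := hf.piecewise y z hyz hK
  obtain ⟨a, b, c, d, h⟩ := exists_coeffs_of_natDegree_le_three hp x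
  exact ⟨a, b, c, d, fun u hu => by rw [hfp u hu, h u]⟩

theorem IsCubicSpline.zero (K : Multiset ℝ) : IsCubicSpline K (fun _ => 0) :=
  ⟨fun _ _ _ _ => ⟨0, by simp, by simp⟩, fun _ _ => contDiffAt_const⟩

theorem IsCubicSpline.add {K : Multiset ℝ} {f g : ℝ → ℝ} (hf : IsCubicSpline K f)
    (hg : IsCubicSpline K g) : IsCubicSpline K (fun u => f u + g u) := by
  refine ⟨fun a b hab h => ?_, fun t ht => (hf.smooth t ht).add (hg.smooth t ht)⟩
  obtain ⟨p, hp, h1⟩ := hf.piecewise a b hab h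
  obtain ⟨q, hq, h2⟩ := hg.piecewise a b hab h
  exact ⟨p + q, (natDegree_add_le _ _).trans (max_le hp hq), fun x hx => by
    rw [h1 x hx, h2 x hx, eval_add]⟩

theorem IsCubicSpline.const_mul {K : Multiset ℝ} {f : ℝ → ℝ} (hf : IsCubicSpline K f) (r : ℝ) :
    IsCubicSpline K (fun u => r * f u) := by
  refine ⟨fun a b hab h => ?_, fun t ht => contDiffAt_const.mul (hf.smooth t ht)⟩
  obtain ⟨p, hp, h1⟩ := hf.piecewise a b hab h
  exact ⟨C r * p, (natDegree_C_mul_le _ _).trans hp, fun x hx => by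
    rw [h1 x hx, eval_mul, eval_C]⟩

theorem IsCubicSpline.reflect {K : Multiset ℝ} {f : ℝ → ℝ} (hf : IsCubicSpline K f) :
    IsCubicSpline (K.map fun t => 1 - t) (fun u => f (1 - u)) := by
  have hinj : Function.Injective (fun t : ℝ => 1 - t) := fun a b h => by simpa using h
  refine ⟨fun a b hab h => ?_, fun t ht => ?_⟩
  · obtain ⟨p, hp, h1⟩ := hf.piecewise (1 - b) (1 - a) (by linarith) (fun t ht hm => by
      refine h (1 - t) (Multiset.mem_map_of_mem _ ht) ⟨?_, ?_⟩
      · linarith [hm.2]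
      · linarith [hm.1])
    refine ⟨p.comp (1 - X), ?_, fun x hx => ?_⟩
    · refine natDegree_comp_le.trans ?_
      have : (1 - X : ℝ[X]).natDegree ≤ 1 := by compute_degree
      nlinarith
    · rw [h1 (1 - x) ⟨by linarith [hx.2], by linarith [hx.1]⟩]
      simp
  · obtain ⟨s, hs, rfl⟩ := Multiset.mem_map.1 ht
    have hc : (K.map fun t => 1 - t).count (1 - s) = K.count s :=
      Multiset.count_map_eq_count' _ _ hinj s
    rw [hc]
    have h2 := hf.smooth s hs
    have h3 : ContDiffAt ℝ ((3 - K.count s : ℕ)) (fun u : ℝ => 1 - u) (1 - s) := by fun_prop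
    have h4 : ContDiffAt ℝ ((3 - K.count s : ℕ)) f ((fun u : ℝ => 1 - u) (1 - s)) := by
      simpa using h2
    exact h4.comp (1 - s) h3

theorem mem_twoDoubleKnots {t : ℝ} : t ∈ twoDoubleKnots ↔ t = 1 / 3 ∨ t = 2 / 3 := by
  simp [twoDoubleKnots]

theorem count_twoDoubleKnots {t : ℝ} (ht : t ∈ twoDoubleKnots) : twoDoubleKnots.count t = 2 := by
  rcases mem_twoDoubleKnots.1 ht with rfl | rfl <;>
    norm_num [twoDoubleKnots, Multiset.count_cons, Multiset.count_singleton]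

/-- The knots are symmetric about `1 / 2`; hence the contributions of all four sides of a quad,
written in rotated coordinates, are splines with the same knots. -/
theorem IsCubicSpline.reflect_twoDoubleKnots {f : ℝ → ℝ} (hf : IsCubicSpline twoDoubleKnots f) :
    IsCubicSpline twoDoubleKnots (fun u => f (1 - u)) := by
  have h : (twoDoubleKnots.map fun t => 1 - t) = twoDoubleKnots := by
    simp only [twoDoubleKnots, Multiset.insert_eq_cons, Multiset.map_cons,
      Multiset.map_singleton]
    norm_num
    rw [Multiset.cons_swap (2 / 3) (1 / 3), Multiset.cons_swap (2 / 3) (1 / 3)]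
    ext t
    simp only [Multiset.count_cons, Multiset.count_singleton]
    ring
  simpa only [h] using hf.reflect

/-! ### Piecewise functions on thirds -/

section Glue

variable {E : Type*}

/-- The function given by `p`, `q`, `r` on the three segments. -/
def glue (p q r : ℝ → E) (u : ℝ) : E :=
  if u ≤ 1 / 3 then p u else if u ≤ 2 / 3 then q u else r u

theorem glue_left {p q r : ℝ → E} {u : ℝ} (h : u ≤ 1 / 3) : glue p q r u = p u := if_pos h

theorem glue_mid {p q r : ℝ → E} (h : p (1 / 3) = q (1 / 3)) {u : ℝ} (h1 : 1 / 3 ≤ u)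
    (h2 : u ≤ 2 / 3) : glue p q r u = q u := by
  rcases h1.eq_or_lt with rfl | h1
  · rw [glue_left le_rfl, h]
  · rw [glue, if_neg (not_le.2 h1), if_pos h2]

theorem glue_right {p q r : ℝ → E} (h : q (2 / 3) = r (2 / 3)) {u : ℝ} (h1 : 2 / 3 ≤ u) :
    glue p q r u = r u := by
  rcases h1.eq_or_lt with rfl | h1
  · rw [glue, if_neg (by norm_num), if_pos le_rfl, h]
  · rw [glue, if_neg (by linarith), if_neg (not_le.2 h1)]

theorem continuous_glue [TopologicalSpace E] {p q r : ℝ → E} (hp : Continuous p) (hq : Continuous q)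
    (hr : Continuous r) (h1 : p (1 / 3) = q (1 / 3)) (h2 : q (2 / 3) = r (2 / 3)) :
    Continuous (glue p q r) := by
  unfold glue
  refine Continuous.if_le hp (Continuous.if_le hq hr continuous_id continuous_const ?_)
    continuous_id continuous_const ?_
  · rintro x rfl; exact h2
  · rintro x rfl; rw [if_pos (by norm_num)]; exact h1

variable [NormedAddCommGroup E] [NormedSpace ℝ E]

theorem hasDerivAt_of_two_sided {f p q : ℝ → E} {x a b : ℝ} {v : E} (ha : a < x) (hb : x < b)
    (hp : ∀ u ∈ Set.Icc a x, f u = p u) (hq : ∀ u ∈ Set.Icc x b, f u = q u)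
    (hpd : HasDerivAt p v x) (hqd : HasDerivAt q v x) : HasDerivAt f v x := by
  have h1 : HasDerivWithinAt f v (Set.Icc a x) x :=
    hpd.hasDerivWithinAt.congr hp (hp x ⟨ha.le, le_rfl⟩)
  have h2 : HasDerivWithinAt f v (Set.Icc x b) x :=
    hqd.hasDerivWithinAt.congr hq (hq x ⟨le_rfl, hb.le⟩)
  have h3 := h1.union h2
  rw [Set.Icc_union_Icc_eq_Icc ha.le hb.le] at h3
  exact h3.hasDerivAt (Icc_mem_nhds ha hb)

theorem hasDerivAt_glue {p q r p' q' r' : ℝ → E} (hp : ∀ u, HasDerivAt p (p' u) u)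
    (hq : ∀ u, HasDerivAt q (q' u) u) (hr : ∀ u, HasDerivAt r (r' u) u)
    (h1 : p (1 / 3) = q (1 / 3)) (h2 : q (2 / 3) = r (2 / 3))
    (h1' : p' (1 / 3) = q' (1 / 3)) (h2' : q' (2 / 3) = r' (2 / 3)) (u : ℝ) :
    HasDerivAt (glue p q r) (glue p' q' r' u) u := by
  rcases lt_trichotomy u (1 / 3) with h | rfl | h
  · rw [glue_left h.le]
    exact hasDerivAt_of_two_sided (a := u - 1) (b := 1 / 3) (by linarith) h
      (fun x hx => glue_left (by linarith [hx.2])) (fun x hx => glue_left hx.2) (hp u) (hp u)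
  · rw [glue_left le_rfl]
    exact hasDerivAt_of_two_sided (a := 0) (b := 2 / 3) (by norm_num) (by norm_num)
      (fun x hx => glue_left hx.2) (fun x hx => glue_mid h1 hx.1 hx.2) (hp _) (h1' ▸ hq _)
  · rcases lt_trichotomy u (2 / 3) with h3 | rfl | h3
    · rw [glue_mid h1' h.le h3.le]
      exact hasDerivAt_of_two_sided (a := 1 / 3) (b := 2 / 3) h h3
        (fun x hx => glue_mid h1 hx.1 (by linarith [hx.2]))
        (fun x hx => glue_mid h1 (by linarith [hx.1]) hx.2) (hq u) (hq u)
    · rw [glue_mid h1' h.le le_rfl]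
      exact hasDerivAt_of_two_sided (a := 1 / 3) (b := 1) h (by norm_num)
        (fun x hx => glue_mid h1 hx.1 hx.2)
        (fun x hx => glue_right h2 hx.1) (hq _) (h2' ▸ hr _)
    · rw [glue_right h2' h3.le]
      exact hasDerivAt_of_two_sided (a := 2 / 3) (b := u + 1) h3 (by linarith)
        (fun x hx => glue_right h2 hx.1)
        (fun x hx => glue_right h2 (by linarith [hx.1])) (hr u) (hr u)

/-! ### Hermite interpolation -/

/-- The cubic on `[a, a + 1/3]` with end values `y₀`, `y₁` and end derivatives `m₀`, `m₁`. -/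
def piece (a : ℝ) (y₀ m₀ y₁ m₁ : E) (u : ℝ) : E :=
  (1 - 27 * (u - a) ^ 2 + 54 * (u - a) ^ 3) • y₀
    + ((u - a) - 6 * (u - a) ^ 2 + 9 * (u - a) ^ 3) • m₀
    + (27 * (u - a) ^ 2 - 54 * (u - a) ^ 3) • y₁
    + (9 * (u - a) ^ 3 - 3 * (u - a) ^ 2) • m₁

/-- The derivative of `piece`. -/
def pieceDeriv (a : ℝ) (y₀ m₀ y₁ m₁ : E) (u : ℝ) : E :=
  (-54 * (u - a) + 162 * (u - a) ^ 2) • y₀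
    + (1 - 12 * (u - a) + 27 * (u - a) ^ 2) • m₀
    + (54 * (u - a) - 162 * (u - a) ^ 2) • y₁
    + (27 * (u - a) ^ 2 - 6 * (u - a)) • m₁

/-- The second derivative of `piece`. -/
def pieceDeriv₂ (a : ℝ) (y₀ m₀ y₁ m₁ : E) (u : ℝ) : E :=
  (-54 + 324 * (u - a)) • y₀ + (-12 + 54 * (u - a)) • m₀
    + (54 - 324 * (u - a)) • y₁ + (54 * (u - a) - 6) • m₁

theorem hasDerivAt_piece (a : ℝ) (y₀ m₀ y₁ m₁ : E) (u : ℝ) :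
    HasDerivAt (piece a y₀ m₀ y₁ m₁) (pieceDeriv a y₀ m₀ y₁ m₁ u) u := by
  have h : HasDerivAt (fun u : ℝ => u - a) 1 u := (hasDerivAt_id u).sub_const a
  have h2 := h.pow 2
  have h3 := h.pow 3
  have e0 : HasDerivAt (fun u : ℝ => 1 - 27 * (u - a) ^ 2 + 54 * (u - a) ^ 3)
      (-54 * (u - a) + 162 * (u - a) ^ 2) u := by
    refine HasDerivAt.congr_deriv (((h2.const_mul 27).const_sub 1).add (h3.const_mul 54)) ?_
    push_cast; ring
  have e1 : HasDerivAt (fun u : ℝ => (u - a) - 6 * (u - a) ^ 2 + 9 * (u - a) ^ 3)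
      (1 - 12 * (u - a) + 27 * (u - a) ^ 2) u := by
    refine HasDerivAt.congr_deriv ((h.sub (h2.const_mul 6)).add (h3.const_mul 9)) ?_
    push_cast; ring
  have e2 : HasDerivAt (fun u : ℝ => 27 * (u - a) ^ 2 - 54 * (u - a) ^ 3)
      (54 * (u - a) - 162 * (u - a) ^ 2) u := by
    refine HasDerivAt.congr_deriv ((h2.const_mul 27).sub (h3.const_mul 54)) ?_
    push_cast; ring
  have e3 : HasDerivAt (fun u : ℝ => 9 * (u - a) ^ 3 - 3 * (u - a) ^ 2)
      (27 * (u - a) ^ 2 - 6 * (u - a)) u := by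
    refine HasDerivAt.congr_deriv ((h3.const_mul 9).sub (h2.const_mul 3)) ?_
    push_cast; ring
  exact (((e0.smul_const y₀).add (e1.smul_const m₀)).add (e2.smul_const y₁)).add
    (e3.smul_const m₁)

theorem hasDerivAt_pieceDeriv (a : ℝ) (y₀ m₀ y₁ m₁ : E) (u : ℝ) :
    HasDerivAt (pieceDeriv a y₀ m₀ y₁ m₁) (pieceDeriv₂ a y₀ m₀ y₁ m₁ u) u := by
  have h : HasDerivAt (fun u : ℝ => u - a) 1 u := (hasDerivAt_id u).sub_const a
  have h2 := h.pow 2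
  have e0 : HasDerivAt (fun u : ℝ => -54 * (u - a) + 162 * (u - a) ^ 2)
      (-54 + 324 * (u - a)) u := by
    refine HasDerivAt.congr_deriv ((h.const_mul (-54)).add (h2.const_mul 162)) ?_
    push_cast; ring
  have e1 : HasDerivAt (fun u : ℝ => 1 - 12 * (u - a) + 27 * (u - a) ^ 2)
      (-12 + 54 * (u - a)) u := by
    refine HasDerivAt.congr_deriv (((h.const_mul 12).const_sub 1).add (h2.const_mul 27)) ?_
    push_cast; ring
  have e2 : HasDerivAt (fun u : ℝ => 54 * (u - a) - 162 * (u - a) ^ 2)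
      (54 - 324 * (u - a)) u := by
    refine HasDerivAt.congr_deriv ((h.const_mul 54).sub (h2.const_mul 162)) ?_
    push_cast; ring
  have e3 : HasDerivAt (fun u : ℝ => 27 * (u - a) ^ 2 - 6 * (u - a))
      (54 * (u - a) - 6) u := by
    refine HasDerivAt.congr_deriv ((h2.const_mul 27).sub (h.const_mul 6)) ?_
    push_cast; ring
  exact (((e0.smul_const y₀).add (e1.smul_const m₀)).add (e2.smul_const y₁)).add
    (e3.smul_const m₁)

theorem piece_start (a : ℝ) (y₀ m₀ y₁ m₁ : E) : piece a y₀ m₀ y₁ m₁ a = y₀ := by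
  simp [piece]

theorem piece_end (a : ℝ) (y₀ m₀ y₁ m₁ : E) : piece a y₀ m₀ y₁ m₁ (a + 1 / 3) = y₁ := by
  simp only [piece]; norm_num

theorem pieceDeriv_start (a : ℝ) (y₀ m₀ y₁ m₁ : E) : pieceDeriv a y₀ m₀ y₁ m₁ a = m₀ := by
  simp [pieceDeriv]

theorem pieceDeriv_end (a : ℝ) (y₀ m₀ y₁ m₁ : E) :
    pieceDeriv a y₀ m₀ y₁ m₁ (a + 1 / 3) = m₁ := by
  simp only [pieceDeriv]; norm_num

/-- The `C¹` cubic spline with values `y j` and derivatives `m j` at `j / 3`. -/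
def herm (y m : Fin 4 → E) : ℝ → E :=
  glue (piece 0 (y 0) (m 0) (y 1) (m 1)) (piece (1 / 3) (y 1) (m 1) (y 2) (m 2))
    (piece (2 / 3) (y 2) (m 2) (y 3) (m 3))

/-- The derivative of `herm`. -/
def hermDeriv (y m : Fin 4 → E) : ℝ → E :=
  glue (pieceDeriv 0 (y 0) (m 0) (y 1) (m 1)) (pieceDeriv (1 / 3) (y 1) (m 1) (y 2) (m 2))
    (pieceDeriv (2 / 3) (y 2) (m 2) (y 3) (m 3))

theorem piece_glue₁ (y₀ m₀ y₁ m₁ y₂ m₂ : E) :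
    piece 0 y₀ m₀ y₁ m₁ (1 / 3) = piece (1 / 3) y₁ m₁ y₂ m₂ (1 / 3) := by
  have := piece_end 0 y₀ m₀ y₁ m₁
  rw [zero_add] at this
  rw [this, piece_start]

theorem piece_glue₂ (y₀ m₀ y₁ m₁ y₂ m₂ : E) :
    piece (1 / 3) y₀ m₀ y₁ m₁ (2 / 3) = piece (2 / 3) y₁ m₁ y₂ m₂ (2 / 3) := by
  have := piece_end (1 / 3) y₀ m₀ y₁ m₁
  rw [show (1 / 3 : ℝ) + 1 / 3 = 2 / 3 by norm_num] at this
  rw [this, piece_start]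

theorem pieceDeriv_glue₁ (y₀ m₀ y₁ m₁ y₂ m₂ : E) :
    pieceDeriv 0 y₀ m₀ y₁ m₁ (1 / 3) = pieceDeriv (1 / 3) y₁ m₁ y₂ m₂ (1 / 3) := by
  have := pieceDeriv_end 0 y₀ m₀ y₁ m₁
  rw [zero_add] at this
  rw [this, pieceDeriv_start]

theorem pieceDeriv_glue₂ (y₀ m₀ y₁ m₁ y₂ m₂ : E) :
    pieceDeriv (1 / 3) y₀ m₀ y₁ m₁ (2 / 3) = pieceDeriv (2 / 3) y₁ m₁ y₂ m₂ (2 / 3) := by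
  have := pieceDeriv_end (1 / 3) y₀ m₀ y₁ m₁
  rw [show (1 / 3 : ℝ) + 1 / 3 = 2 / 3 by norm_num] at this
  rw [this, pieceDeriv_start]

theorem herm_left (y m : Fin 4 → E) {u : ℝ} (h : u ≤ 1 / 3) :
    herm y m u = piece 0 (y 0) (m 0) (y 1) (m 1) u := glue_left h

theorem herm_mid (y m : Fin 4 → E) {u : ℝ} (h : 1 / 3 ≤ u) (h' : u ≤ 2 / 3) :
    herm y m u = piece (1 / 3) (y 1) (m 1) (y 2) (m 2) u :=
  glue_mid (piece_glue₁ _ _ _ _ _ _) h h'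

theorem herm_right (y m : Fin 4 → E) {u : ℝ} (h : 2 / 3 ≤ u) :
    herm y m u = piece (2 / 3) (y 2) (m 2) (y 3) (m 3) u :=
  glue_right (piece_glue₂ _ _ _ _ _ _) h

theorem hermDeriv_left (y m : Fin 4 → E) {u : ℝ} (h : u ≤ 1 / 3) :
    hermDeriv y m u = pieceDeriv 0 (y 0) (m 0) (y 1) (m 1) u := glue_left h

theorem hermDeriv_mid (y m : Fin 4 → E) {u : ℝ} (h : 1 / 3 ≤ u) (h' : u ≤ 2 / 3) :
    hermDeriv y m u = pieceDeriv (1 / 3) (y 1) (m 1) (y 2) (m 2) u :=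
  glue_mid (pieceDeriv_glue₁ _ _ _ _ _ _) h h'

theorem hermDeriv_right (y m : Fin 4 → E) {u : ℝ} (h : 2 / 3 ≤ u) :
    hermDeriv y m u = pieceDeriv (2 / 3) (y 2) (m 2) (y 3) (m 3) u :=
  glue_right (pieceDeriv_glue₂ _ _ _ _ _ _) h

theorem hasDerivAt_herm (y m : Fin 4 → E) (u : ℝ) : HasDerivAt (herm y m) (hermDeriv y m u) u :=
  hasDerivAt_glue (hasDerivAt_piece _ _ _ _ _) (hasDerivAt_piece _ _ _ _ _)
    (hasDerivAt_piece _ _ _ _ _) (piece_glue₁ _ _ _ _ _ _) (piece_glue₂ _ _ _ _ _ _)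
    (pieceDeriv_glue₁ _ _ _ _ _ _) (pieceDeriv_glue₂ _ _ _ _ _ _) u

theorem deriv_herm (y m : Fin 4 → E) : deriv (herm y m) = hermDeriv y m :=
  funext fun u => (hasDerivAt_herm y m u).deriv

theorem continuous_hermDeriv (y m : Fin 4 → E) : Continuous (hermDeriv y m) := by
  refine continuous_glue ?_ ?_ ?_ (pieceDeriv_glue₁ _ _ _ _ _ _) (pieceDeriv_glue₂ _ _ _ _ _ _)
  all_goals
    unfold pieceDeriv
    fun_prop

theorem herm_zero (y m : Fin 4 → E) : herm y m 0 = y 0 := by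
  rw [herm_left _ _ (by norm_num), piece_start]

theorem hermDeriv_zero (y m : Fin 4 → E) : hermDeriv y m 0 = m 0 := by
  rw [hermDeriv_left _ _ (by norm_num), pieceDeriv_start]

theorem herm_one (y m : Fin 4 → E) : herm y m 1 = y 3 := by
  have := piece_end (2 / 3) (y 2) (m 2) (y 3) (m 3)
  rw [herm_right _ _ (by norm_num)]
  rwa [show (2 / 3 : ℝ) + 1 / 3 = 1 by norm_num] at this

theorem hermDeriv_one (y m : Fin 4 → E) : hermDeriv y m 1 = m 3 := by
  have := pieceDeriv_end (2 / 3) (y 2) (m 2) (y 3) (m 3)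
  rw [hermDeriv_right _ _ (by norm_num)]
  rwa [show (2 / 3 : ℝ) + 1 / 3 = 1 by norm_num] at this

theorem hermDeriv_third (y m : Fin 4 → E) : hermDeriv y m (1 / 3) = m 1 := by
  rw [hermDeriv_mid _ _ le_rfl (by norm_num), pieceDeriv_start]

theorem hermDeriv_two_thirds (y m : Fin 4 → E) : hermDeriv y m (2 / 3) = m 2 := by
  rw [hermDeriv_right _ _ le_rfl, pieceDeriv_start]

/-- This can be solved for `y 1`: a prescribed second derivative at the end fixes the value at the
inner node and leaves the inner slope `m 1` free. `Ends.valueNodes` is built this way. -/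
theorem hasDerivAt_hermDeriv_zero (y m : Fin 4 → E) :
    HasDerivAt (hermDeriv y m)
      ((54 : ℝ) • (y 1 - y 0) - (12 : ℝ) • m 0 - (6 : ℝ) • m 1) 0 := by
  have h := hasDerivAt_pieceDeriv 0 (y 0) (m 0) (y 1) (m 1) 0
  have h2 := hasDerivAt_of_two_sided (f := hermDeriv y m) (x := 0) (a := -1) (b := 1 / 3)
    (by norm_num) (by norm_num) (fun u hu => hermDeriv_left y m (by linarith [hu.2]))
    (fun u hu => hermDeriv_left y m hu.2) h h
  convert h2 using 1
  simp only [pieceDeriv₂]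
  module

theorem piece_add (a : ℝ) (y₀ m₀ y₁ m₁ y₀' m₀' y₁' m₁' : E) (u : ℝ) :
    piece a (y₀ + y₀') (m₀ + m₀') (y₁ + y₁') (m₁ + m₁') u
      = piece a y₀ m₀ y₁ m₁ u + piece a y₀' m₀' y₁' m₁' u := by
  simp only [piece]; module

theorem herm_add (y m y' m' : Fin 4 → E) (u : ℝ) :
    herm (y + y') (m + m') u = herm y m u + herm y' m' u := by
  simp only [herm, glue]
  split_ifs <;> exact piece_add _ _ _ _ _ _ _ _ _ _

theorem herm_reflect (y m : Fin 4 → E) (u : ℝ) :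
    herm y m (1 - u) = herm (fun j => y j.rev) (fun j => - m j.rev) u := by
  have r0 : Fin.rev (0 : Fin 4) = 3 := rfl
  have r1 : Fin.rev (1 : Fin 4) = 2 := rfl
  have r2 : Fin.rev (2 : Fin 4) = 1 := rfl
  have r3 : Fin.rev (3 : Fin 4) = 0 := rfl
  rcases le_total u (1 / 3) with h | h
  · rw [herm_right _ _ (by linarith), herm_left _ _ h, r0, r1]
    simp only [piece]; module
  · rcases le_total u (2 / 3) with h' | h'
    · rw [herm_mid _ _ (by linarith) (by linarith), herm_mid _ _ h h', r1, r2]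
      simp only [piece]; module
    · rw [herm_left _ _ (by linarith), herm_right _ _ h', r3, r2]
      simp only [piece]; module

/-- The Hermite basis: value one at the node `j`. -/
def hermValue (j : Fin 4) : ℝ → ℝ := herm (Pi.single j 1) 0

/-- The Hermite basis: derivative one at the node `j`. -/
def hermSlope (j : Fin 4) : ℝ → ℝ := herm 0 (Pi.single j 1)

/-- Separates scalar basis functions from vector data, which turns Hermite interpolants into
tensor-product form. -/
theorem herm_eq_sum (y m : Fin 4 → E) (u : ℝ) :
    herm y m u = ∑ j, (hermValue j u • y j + hermSlope j u • m j) := by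
  simp only [hermValue, hermSlope, Fin.sum_univ_four]
  rcases le_total u (1 / 3) with h | h
  · simp only [herm_left _ _ h, piece, Pi.single_apply, Pi.zero_apply]
    simp
    module
  · rcases le_total u (2 / 3) with h' | h'
    · simp only [herm_mid _ _ h h', piece, Pi.single_apply, Pi.zero_apply]
      simp
      module
    · simp only [herm_right _ _ h', piece, Pi.single_apply, Pi.zero_apply]
      simp
      module

end Glue

theorem piece_poly (a y₀ m₀ y₁ m₁ : ℝ) :
    ∃ p : ℝ[X], p.natDegree ≤ 3 ∧ ∀ u, piece a y₀ m₀ y₁ m₁ u = p.eval u := by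
  obtain ⟨p, hp, h⟩ := exists_poly_of_coeffs a y₀ m₀ (-27 * y₀ - 6 * m₀ + 27 * y₁ - 3 * m₁)
    (54 * y₀ + 9 * m₀ - 54 * y₁ + 9 * m₁)
  refine ⟨p, hp, fun u => ?_⟩
  rw [h]
  simp only [piece, smul_eq_mul]
  ring

theorem contDiff_herm {E : Type*} [NormedAddCommGroup E] [NormedSpace ℝ E] (y m : Fin 4 → E) :
    ContDiff ℝ 1 (herm y m) := by
  rw [contDiff_one_iff_deriv, deriv_herm]
  exact ⟨fun u => (hasDerivAt_herm y m u).differentiableAt, continuous_hermDeriv y m⟩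

theorem isCubicSpline_herm (y m : Fin 4 → ℝ) : IsCubicSpline twoDoubleKnots (herm y m) := by
  refine ⟨fun a b hab h => ?_, fun t ht => ?_⟩
  · have h1 := h (1 / 3) (mem_twoDoubleKnots.2 (Or.inl rfl))
    have h2 := h (2 / 3) (mem_twoDoubleKnots.2 (Or.inr rfl))
    simp only [Set.mem_Ioo, not_and, not_lt] at h1 h2
    rcases le_or_gt b (1 / 3) with hb | hb
    · obtain ⟨p, hp, e⟩ := piece_poly 0 (y 0) (m 0) (y 1) (m 1)
      exact ⟨p, hp, fun x hx => by rw [herm_left _ _ (by linarith [hx.2]), e]⟩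
    have ha : 1 / 3 ≤ a := by
      by_contra hc
      linarith [h1 (by linarith)]
    rcases le_or_gt b (2 / 3) with hb' | hb'
    · obtain ⟨p, hp, e⟩ := piece_poly (1 / 3) (y 1) (m 1) (y 2) (m 2)
      exact ⟨p, hp, fun x hx => by
        rw [herm_mid _ _ (by linarith [hx.1]) (by linarith [hx.2]), e]⟩
    have ha' : 2 / 3 ≤ a := by
      by_contra hc
      linarith [h2 (by linarith)]
    obtain ⟨p, hp, e⟩ := piece_poly (2 / 3) (y 2) (m 2) (y 3) (m 3)
    exact ⟨p, hp, fun x hx => by rw [herm_right _ _ (by linarith [hx.1]), e]⟩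
  · rw [count_twoDoubleKnots ht]
    exact_mod_cast (contDiff_herm y m).contDiffAt

/-! ### `C¹` Bézier arrays are bicubic splines with two double knots -/

section Nodes

variable {E : Type*} [NormedAddCommGroup E] [NormedSpace ℝ E]

/-- `g` is a cubic on each of the three segments of `[0, 1]`. -/
def IsCubicOnThirds (g : ℝ → E) : Prop :=
  ∀ i : Fin 3, ∃ a b c d : E, ∀ s ∈ Set.Icc (0 : ℝ) 1,
    g (((i : ℝ) + s) / 3) = a + s • b + s ^ 2 • c + s ^ 3 • d

/-- The derivatives at the nodes `0, 1/3, 2/3, 1` of a function that is cubic on the two outer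
segments, in terms of its values. -/
def nodeSlope (g : ℝ → E) : Fin 4 → E :=
  ![(3 / 2 : ℝ) • ((-11 : ℝ) • g 0 + (18 : ℝ) • g (1 / 9) + (-9 : ℝ) • g (2 / 9)
      + (2 : ℝ) • g (1 / 3)),
    (3 / 2 : ℝ) • ((11 : ℝ) • g (1 / 3) + (-18 : ℝ) • g (2 / 9) + (9 : ℝ) • g (1 / 9)
      + (-2 : ℝ) • g 0),
    (3 / 2 : ℝ) • ((-11 : ℝ) • g (2 / 3) + (18 : ℝ) • g (7 / 9) + (-9 : ℝ) • g (8 / 9)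
      + (2 : ℝ) • g 1),
    (3 / 2 : ℝ) • ((11 : ℝ) • g 1 + (-18 : ℝ) • g (8 / 9) + (9 : ℝ) • g (7 / 9)
      + (-2 : ℝ) • g (2 / 3))]

theorem hasDerivAt_cubic (a b c d : E) (k x : ℝ) :
    HasDerivAt (fun x : ℝ => a + (3 * x - k) • b + (3 * x - k) ^ 2 • c + (3 * x - k) ^ 3 • d)
      ((3 : ℝ) • b + (6 * (3 * x - k)) • c + (9 * (3 * x - k) ^ 2) • d) x := by
  have h : HasDerivAt (fun x : ℝ => 3 * x - k) 3 x :=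
    (((hasDerivAt_id x).const_mul 3).sub_const k).congr_deriv (by ring)
  have h2 : HasDerivAt (fun x : ℝ => (3 * x - k) ^ 2) (6 * (3 * x - k)) x :=
    (h.pow 2).congr_deriv (by push_cast; ring)
  have h3 : HasDerivAt (fun x : ℝ => (3 * x - k) ^ 3) (9 * (3 * x - k) ^ 2) x :=
    (h.pow 3).congr_deriv (by push_cast; ring)
  exact (((h.smul_const b).const_add a).add (h2.smul_const c)).add (h3.smul_const d)

/-- Four equally spaced values determine the cubic on an outer segment and hence its end slopes;
differentiability at the inner knots hands these slopes on to the middle segment. -/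
theorem IsCubicOnThirds.eq_herm {g : ℝ → E} (hg : IsCubicOnThirds g)
    (h1 : DifferentiableAt ℝ g (1 / 3)) (h2 : DifferentiableAt ℝ g (2 / 3)) {u : ℝ}
    (hu : u ∈ Set.Icc (0 : ℝ) 1) :
    g u = herm (fun j : Fin 4 => g ((j : ℝ) / 3)) (nodeSlope g) u := by
  obtain ⟨a₀, b₀, c₀, d₀, e₀⟩ := hg 0
  obtain ⟨a₁, b₁, c₁, d₁, e₁⟩ := hg 1
  obtain ⟨a₂, b₂, c₂, d₂, e₂⟩ := hg 2
  have f₀ : ∀ x ∈ Set.Icc (0 : ℝ) (1 / 3),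
      g x = a₀ + (3 * x - 0) • b₀ + (3 * x - 0) ^ 2 • c₀ + (3 * x - 0) ^ 3 • d₀ := fun x hx => by
    have := e₀ (3 * x - 0) ⟨by linarith [hx.1], by linarith [hx.2]⟩
    rw [← this]; congr 1; simp
  have f₁ : ∀ x ∈ Set.Icc (1 / 3 : ℝ) (2 / 3),
      g x = a₁ + (3 * x - 1) • b₁ + (3 * x - 1) ^ 2 • c₁ + (3 * x - 1) ^ 3 • d₁ := fun x hx => by
    have := e₁ (3 * x - 1) ⟨by linarith [hx.1], by linarith [hx.2]⟩
    rw [← this]; congr 1; simp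
  have f₂ : ∀ x ∈ Set.Icc (2 / 3 : ℝ) 1,
      g x = a₂ + (3 * x - 2) • b₂ + (3 * x - 2) ^ 2 • c₂ + (3 * x - 2) ^ 3 • d₂ := fun x hx => by
    have := e₂ (3 * x - 2) ⟨by linarith [hx.1], by linarith [hx.2]⟩
    rw [← this]; congr 1; simp
  have slope : ∀ {x l r k : ℝ} {a b c d : E}, DifferentiableAt ℝ g x → l < r →
      x ∈ Set.Icc l r → (∀ x ∈ Set.Icc l r, g x = a + (3 * x - k) • b + (3 * x - k) ^ 2 • c
        + (3 * x - k) ^ 3 • d) →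
      deriv g x = (3 : ℝ) • b + (6 * (3 * x - k)) • c + (9 * (3 * x - k) ^ 2) • d := by
    intro x l r k a b c d hd hlr hx hgx
    exact (uniqueDiffOn_Icc hlr x hx).eq_deriv _ hd.hasDerivAt.hasDerivWithinAt
      ((hasDerivAt_cubic a b c d k x).hasDerivWithinAt.congr hgx (hgx x hx))
  have s1l := slope h1 (by norm_num) (by norm_num) f₀
  have s1r := slope h1 (by norm_num) (by norm_num) f₁
  have s2l := slope h2 (by norm_num) (by norm_num) f₁
  have s2r := slope h2 (by norm_num) (by norm_num) f₂
  have v0 := f₀ 0 (by norm_num)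
  have v1 := f₀ (1 / 9) (by norm_num)
  have v2 := f₀ (2 / 9) (by norm_num)
  have v3 := f₀ (1 / 3) (by norm_num)
  have v3' := f₁ (1 / 3) (by norm_num)
  have v4' := f₁ (2 / 3) (by norm_num)
  have v4 := f₂ (2 / 3) (by norm_num)
  have v5 := f₂ (7 / 9) (by norm_num)
  have v6 := f₂ (8 / 9) (by norm_num)
  have v7 := f₂ 1 (by norm_num)
  have n0 : nodeSlope g 0 = (3 : ℝ) • b₀ := by
    simp only [nodeSlope, Matrix.cons_val]
    rw [v0, v1, v2, v3]; module
  have n1 : nodeSlope g 1 = deriv g (1 / 3) := by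
    simp only [nodeSlope, Matrix.cons_val]
    rw [s1l, v0, v1, v2, v3]; module
  have n2 : nodeSlope g 2 = deriv g (2 / 3) := by
    simp only [nodeSlope, Matrix.cons_val]
    rw [s2r, v4, v5, v6, v7]; module
  have n3 : nodeSlope g 3 = (3 : ℝ) • b₂ + (6 : ℝ) • c₂ + (9 : ℝ) • d₂ := by
    simp only [nodeSlope, Matrix.cons_val]
    rw [v4, v5, v6, v7]; module
  have c0 : g (((0 : Fin 4) : ℝ) / 3) = g 0 := by norm_num
  have c1 : g (((1 : Fin 4) : ℝ) / 3) = g (1 / 3) := by norm_num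
  have c2 : g (((2 : Fin 4) : ℝ) / 3) = g (2 / 3) := by norm_num
  have c3 : g (((3 : Fin 4) : ℝ) / 3) = g 1 := by
    congr 1
    rw [show ((3 : Fin 4) : ℕ) = 3 from rfl]; norm_num
  rcases le_total u (1 / 3) with h | h
  · rw [herm_left _ _ h, n0, n1, s1l, c0, c1, v0, v3, f₀ u ⟨hu.1, h⟩]
    simp only [piece]; module
  · rcases le_total u (2 / 3) with h' | h'
    · rw [herm_mid _ _ h h', n1, n2, s1r, s2l, c1, c2, v3', v4', f₁ u ⟨h, h'⟩]
      simp only [piece]; module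
    · rw [herm_right _ _ h', n2, n3, s2r, c2, c3, v4, v7, f₂ u ⟨h', hu.2⟩]
      simp only [piece]; module

end Nodes

theorem smul_mem_bicubic {f g : ℝ → ℝ} (hf : IsCubicSpline twoDoubleKnots f)
    (hg : IsCubicSpline twoDoubleKnots g) (x : E3) :
    IsBicubicSpline twoDoubleKnots (fun u v => (f u * g v) • x) :=
  Submodule.subset_span ⟨f, g, x, hf, hg, rfl⟩

theorem IsBicubicSpline.add {K : Multiset ℝ} {p q : ℝ → ℝ → E3} (hp : IsBicubicSpline K p)
    (hq : IsBicubicSpline K q) : IsBicubicSpline K (fun u v => p u v + q u v) :=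
  Submodule.add_mem _ hp hq

theorem IsBicubicSpline.const_smul {K : Multiset ℝ} {p : ℝ → ℝ → E3} (hp : IsBicubicSpline K p)
    (r : ℝ) : IsBicubicSpline K (fun u v => r • p u v) :=
  Submodule.smul_mem _ r hp

theorem IsBicubicSpline.sum {K : Multiset ℝ} {ι : Type*} (s : Finset ι) {p : ι → ℝ → ℝ → E3}
    (hp : ∀ i ∈ s, IsBicubicSpline K (p i)) :
    IsBicubicSpline K (fun u v => ∑ i ∈ s, p i u v) := by
  have h := Submodule.sum_mem _ hp
  have e : (fun u v => ∑ i ∈ s, p i u v) = ∑ i ∈ s, p i := by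
    funext u v; simp [Finset.sum_apply]
  unfold IsBicubicSpline
  rw [e]
  exact h

theorem isCubicSpline_hermValue (j : Fin 4) : IsCubicSpline twoDoubleKnots (hermValue j) :=
  isCubicSpline_herm _ _

theorem isCubicSpline_hermSlope (j : Fin 4) : IsCubicSpline twoDoubleKnots (hermSlope j) :=
  isCubicSpline_herm _ _

theorem smul_herm_mem {f : ℝ → ℝ} (hf : IsCubicSpline twoDoubleKnots f) (y m : Fin 4 → E3) :
    IsBicubicSpline twoDoubleKnots (fun u v => f u • herm y m v) := by
  have h : IsBicubicSpline twoDoubleKnots (fun u v => ∑ j : Fin 4,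
      ((f u * hermValue j v) • y j + (f u * hermSlope j v) • m j)) :=
    IsBicubicSpline.sum _ fun j _ => (smul_mem_bicubic hf (isCubicSpline_hermValue j) _).add
      (smul_mem_bicubic hf (isCubicSpline_hermSlope j) _)
  convert h using 3 with u v
  rw [herm_eq_sum, Finset.smul_sum]
  simp only [smul_add, smul_smul]

theorem IsBicubicSpline.swap {K : Multiset ℝ} {p : ℝ → ℝ → E3} (hp : IsBicubicSpline K p) :
    IsBicubicSpline K (fun u v => p v u) := by
  unfold IsBicubicSpline at hp
  induction hp using Submodule.span_induction with
  | mem r hr =>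
    obtain ⟨f, g, x, hf, hg, rfl⟩ := hr
    exact Submodule.subset_span ⟨g, f, x, hg, hf, by funext u v; rw [mul_comm]⟩
  | zero => exact Submodule.zero_mem _
  | add p q _ _ hp hq => exact hp.add hq
  | smul r p _ hp => exact hp.const_smul r

theorem bezierPatch_coords (b : Fin 4 → Fin 4 → E3) (u v : ℝ) :
    bezierPatch b u v = ∑ i : Fin 4, ∑ j : Fin 4,
      ((![(1 - u) ^ 3, 3 * u * (1 - u) ^ 2, 3 * u ^ 2 * (1 - u), u ^ 3] i)
        * (![(1 - v) ^ 3, 3 * v * (1 - v) ^ 2, 3 * v ^ 2 * (1 - v), v ^ 3] j)) • b i j := by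
  have h : ∀ (i : Fin 4) (u : ℝ), (bernsteinPolynomial ℝ 3 i).eval u
      = ![(1 - u) ^ 3, 3 * u * (1 - u) ^ 2, 3 * u ^ 2 * (1 - u), u ^ 3] i := by
    intro i u
    fin_cases i <;> simp [bernsteinPolynomial, Nat.choose]
  simp only [bezierPatch, h]

theorem exists_cubic_of_bezier_left (b : Fin 4 → Fin 4 → E3) (v : ℝ) :
    ∃ x₀ x₁ x₂ x₃ : E3, ∀ u, bezierPatch b u v = x₀ + u • x₁ + u ^ 2 • x₂ + u ^ 3 • x₃ := by
  set c : Fin 4 → E3 := fun i => ∑ j : Fin 4,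
    (![(1 - v) ^ 3, 3 * v * (1 - v) ^ 2, 3 * v ^ 2 * (1 - v), v ^ 3] j) • b i j with hc
  refine ⟨c 0, (3 : ℝ) • (c 1 - c 0), (3 : ℝ) • (c 2 - (2 : ℝ) • c 1 + c 0),
    c 3 - (3 : ℝ) • c 2 + (3 : ℝ) • c 1 - c 0, fun u => ?_⟩
  have : bezierPatch b u v = ∑ i : Fin 4,
      (![(1 - u) ^ 3, 3 * u * (1 - u) ^ 2, 3 * u ^ 2 * (1 - u), u ^ 3] i) • c i := by
    rw [bezierPatch_coords]
    simp only [hc, Finset.smul_sum, smul_smul]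
  rw [this, Fin.sum_univ_four]
  simp only [Matrix.cons_val]
  module

theorem bezierPatch_swap (b : Fin 4 → Fin 4 → E3) (u v : ℝ) :
    bezierPatch b u v = bezierPatch (fun i j => b j i) v u := by
  simp only [bezierPatch]
  rw [Finset.sum_comm]
  simp only [mul_comm]

theorem exists_cubic_of_bezier_right (b : Fin 4 → Fin 4 → E3) (u : ℝ) :
    ∃ x₀ x₁ x₂ x₃ : E3, ∀ v, bezierPatch b u v = x₀ + v • x₁ + v ^ 2 • x₂ + v ^ 3 • x₃ := by
  obtain ⟨x₀, x₁, x₂, x₃, h⟩ := exists_cubic_of_bezier_left (fun i j => b j i) u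
  exact ⟨x₀, x₁, x₂, x₃, fun v => by rw [bezierPatch_swap, h]⟩

theorem exists_third {x : ℝ} (hx : x ∈ Set.Icc (0 : ℝ) 1) :
    ∃ i : Fin 3, ∃ s ∈ Set.Icc (0 : ℝ) 1, x = ((i : ℝ) + s) / 3 := by
  rcases le_total x (1 / 3) with h | h
  · exact ⟨0, 3 * x, ⟨by linarith [hx.1], by linarith⟩, by simp⟩
  rcases le_total x (2 / 3) with h' | h'
  · exact ⟨1, 3 * x - 1, ⟨by linarith, by linarith⟩, by simp⟩
  · exact ⟨2, 3 * x - 2, ⟨by linarith, by linarith [hx.2]⟩, by simp⟩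

/-- Interpolation in `u` with `nodeSlope` uses only finitely many slices `p x`, linearly. Replacing
each slice by its Hermite interpolant `Q x` in `v` therefore leaves a finite sum of products. This
is why `nodeSlope` is expressed by values and not by derivatives. -/
theorem isBicubicSpline_of_isC1BezierArray {p : ℝ → ℝ → E3} (hp : IsC1BezierArray p) :
    ∃ s : ℝ → ℝ → E3, IsBicubicSpline twoDoubleKnots s ∧
      ∀ u ∈ Set.Icc (0 : ℝ) 1, ∀ v ∈ Set.Icc (0 : ℝ) 1, p u v = s u v := by
  obtain ⟨⟨b, hb⟩, hs⟩ := hp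
  have hI : ∀ t ∈ Set.Ioo (0 : ℝ) 1, ∀ g : ℝ → E3, ContDiffOn ℝ 1 g (Set.Icc 0 1) →
      DifferentiableAt ℝ g t := fun t ht g hg =>
    ((hg.differentiableOn one_ne_zero) t ⟨ht.1.le, ht.2.le⟩).differentiableAt
      (Icc_mem_nhds ht.1 ht.2)
  have hu : ∀ v ∈ Set.Icc (0 : ℝ) 1, ∀ u ∈ Set.Icc (0 : ℝ) 1,
      p u v = herm (fun j : Fin 4 => p ((j : ℝ) / 3) v) (nodeSlope fun x => p x v) u := by
    intro v hv u hu
    have h : ContDiffOn ℝ 1 (fun x => p x v) (Set.Icc 0 1) :=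
      hs.comp (f := fun x : ℝ => (x, v)) (by fun_prop) fun x hx => ⟨hx, hv⟩
    obtain ⟨j, s, hsj, rfl⟩ := exists_third hv
    refine IsCubicOnThirds.eq_herm (g := fun x => p x _) (fun i => ?_)
      (hI _ (by norm_num) _ h) (hI _ (by norm_num) _ h) hu
    obtain ⟨x₀, x₁, x₂, x₃, hx⟩ := exists_cubic_of_bezier_left (b i j) s
    exact ⟨x₀, x₁, x₂, x₃, fun t ht => (hb i j t ht s hsj).trans (hx t)⟩
  have hv : ∀ u ∈ Set.Icc (0 : ℝ) 1, ∀ v ∈ Set.Icc (0 : ℝ) 1,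
      p u v = herm (fun j : Fin 4 => p u ((j : ℝ) / 3)) (nodeSlope (p u)) v := by
    intro u hu v hv
    have h : ContDiffOn ℝ 1 (p u) (Set.Icc 0 1) :=
      hs.comp (f := fun y : ℝ => (u, y)) (by fun_prop) fun x hx => ⟨hu, hx⟩
    obtain ⟨i, s, hsi, rfl⟩ := exists_third hu
    refine IsCubicOnThirds.eq_herm (g := p _) (fun j => ?_)
      (hI _ (by norm_num) _ h) (hI _ (by norm_num) _ h) hv
    obtain ⟨x₀, x₁, x₂, x₃, hx⟩ := exists_cubic_of_bezier_right (b i j) s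
    exact ⟨x₀, x₁, x₂, x₃, fun t ht => by rw [hb i j s hsi t ht, hx]⟩
  set Q : ℝ → ℝ → E3 :=
    fun x v => herm (fun j : Fin 4 => p x ((j : ℝ) / 3)) (nodeSlope (p x)) v with hQ
  refine ⟨fun u v => herm (fun j : Fin 4 => Q ((j : ℝ) / 3) v) (nodeSlope fun x => Q x v) u,
    ?_, fun u hu' v hv' => ?_⟩
  · have hmem : ∀ {f : ℝ → ℝ}, IsCubicSpline twoDoubleKnots f → ∀ x,
        IsBicubicSpline twoDoubleKnots (fun u v => f u • Q x v) :=
      fun hf x => smul_herm_mem hf _ _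
    have hcomb : ∀ {f : ℝ → ℝ}, IsCubicSpline twoDoubleKnots f → ∀ r r₀ r₁ r₂ r₃ x₀ x₁ x₂ x₃ : ℝ,
        IsBicubicSpline twoDoubleKnots (fun u v => f u •
          (r • (r₀ • Q x₀ v + r₁ • Q x₁ v + r₂ • Q x₂ v + r₃ • Q x₃ v))) := by
      intro f hf r r₀ r₁ r₂ r₃ x₀ x₁ x₂ x₃
      have h := ((((hmem hf x₀).const_smul r₀).add ((hmem hf x₁).const_smul r₁)).add
        ((hmem hf x₂).const_smul r₂)).add ((hmem hf x₃).const_smul r₃) |>.const_smul r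
      convert h using 3 with u v
      module
    have : IsBicubicSpline twoDoubleKnots (fun u v => ∑ j : Fin 4,
        (hermValue j u • Q ((j : ℝ) / 3) v
          + hermSlope j u • nodeSlope (fun x => Q x v) j)) := by
      refine IsBicubicSpline.sum _ fun j _ =>
        (hmem (isCubicSpline_hermValue j) _).add ?_
      have hj := isCubicSpline_hermSlope j
      fin_cases j <;> simp only [nodeSlope] <;> exact hcomb hj _ _ _ _ _ _ _ _ _
    convert this using 3 with u v
    exact herm_eq_sum _ _ u
  · have hQp : ∀ x ∈ Set.Icc (0 : ℝ) 1, Q x v = p x v := fun x hx => (hv x hx v hv').symm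
    rw [hu v hv' u hu']
    congr 1
    · funext j
      refine (hQp _ ⟨by positivity, ?_⟩).symm
      have : (j : ℝ) ≤ 3 := by exact_mod_cast Nat.le_of_lt_succ j.2
      linarith
    · simp only [nodeSlope]
      rw [hQp 0 (by norm_num), hQp (1 / 9) (by norm_num), hQp (2 / 9) (by norm_num),
        hQp (1 / 3) (by norm_num), hQp (2 / 3) (by norm_num), hQp (7 / 9) (by norm_num),
        hQp (8 / 9) (by norm_num), hQp 1 (by norm_num)]

theorem IsCubicSpline.contDiff_twoDoubleKnots {f : ℝ → ℝ} (hf : IsCubicSpline twoDoubleKnots f) :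
    ContDiff ℝ 1 f := by
  rw [contDiff_iff_contDiffAt]
  intro x
  by_cases hx : x ∈ twoDoubleKnots
  · have := hf.smooth x hx
    rw [count_twoDoubleKnots hx] at this
    exact_mod_cast this
  · rw [mem_twoDoubleKnots, not_or] at hx
    obtain ⟨y, z, hy, hz, hK⟩ : ∃ y z, y < x ∧ x < z ∧ ∀ t ∈ twoDoubleKnots, t ∉ Set.Ioo y z := by
      rcases lt_or_gt_of_ne hx.1 with h | h
      · refine ⟨x - 1, 1 / 3, by linarith, h, fun t ht hm => ?_⟩
        rcases mem_twoDoubleKnots.1 ht with rfl | rfl <;> linarith [hm.1, hm.2]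
      rcases lt_or_gt_of_ne hx.2 with h' | h'
      · refine ⟨1 / 3, 2 / 3, h, h', fun t ht hm => ?_⟩
        rcases mem_twoDoubleKnots.1 ht with rfl | rfl <;> linarith [hm.1, hm.2]
      · refine ⟨2 / 3, x + 1, h', by linarith, fun t ht hm => ?_⟩
        rcases mem_twoDoubleKnots.1 ht with rfl | rfl <;> linarith [hm.1, hm.2]
    obtain ⟨p, -, hp⟩ := hf.piecewise y z (hy.trans hz) hK
    have : f =ᶠ[nhds x] fun u => p.eval u :=
      Filter.eventually_of_mem (Icc_mem_nhds hy hz) hp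
    have hc : ContDiff ℝ 1 (fun u => p.eval u) := by simpa using p.contDiff_aeval (𝕜 := ℝ) 1
    exact hc.contDiffAt.congr_of_eventuallyEq this

theorem exists_bernstein_coeffs {f : ℝ → ℝ} (hf : IsCubicSpline twoDoubleKnots f) (i : Fin 3) :
    ∃ c : Fin 4 → ℝ, ∀ s ∈ Set.Icc (0 : ℝ) 1,
      f (((i : ℝ) + s) / 3) = ∑ k : Fin 4, c k * (bernsteinPolynomial ℝ 3 k).eval s := by
  obtain ⟨a, b, c, d, h⟩ := hf.taylor (y := (i : ℝ) / 3) (z := ((i : ℝ) + 1) / 3) (by linarith)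
    (fun t ht hm => by
      rcases mem_twoDoubleKnots.1 ht with rfl | rfl <;>
      · obtain ⟨h1, h2⟩ := hm
        fin_cases i <;> norm_num at h1 <;> norm_num at h2) ((i : ℝ) / 3)
  -- Conversion from powers of `s / 3` to the Bernstein basis of degree three.
  refine ⟨![a, a + b / 9, a + 2 * b / 9 + c / 27, a + b / 3 + c / 9 + d / 27], fun s hs => ?_⟩
  rw [h _ ⟨by linarith [hs.1], by linarith [hs.2]⟩, Fin.sum_univ_four]
  simp [bernsteinPolynomial, Nat.choose]
  ring

theorem isC1BezierArray_of_isBicubicSpline {s : ℝ → ℝ → E3}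
    (hs : IsBicubicSpline twoDoubleKnots s) :
    IsC1BezierArray s ∧ ContDiff ℝ 1 (fun z : ℝ × ℝ => s z.1 z.2) := by
  suffices h : (∃ b : Fin 3 → Fin 3 → Fin 4 → Fin 4 → E3, ∀ i j : Fin 3,
      ∀ u ∈ Set.Icc (0 : ℝ) 1, ∀ v ∈ Set.Icc (0 : ℝ) 1,
        s (((i : ℝ) + u) / 3) (((j : ℝ) + v) / 3) = bezierPatch (b i j) u v) ∧
      ContDiff ℝ 1 (fun z : ℝ × ℝ => s z.1 z.2) from
    ⟨⟨h.1, h.2.contDiffOn⟩, h.2⟩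
  unfold IsBicubicSpline at hs
  induction hs using Submodule.span_induction with
  | mem r hr =>
    obtain ⟨f, g, x, hf, hg, rfl⟩ := hr
    choose c hc using exists_bernstein_coeffs hf
    choose e he using exists_bernstein_coeffs hg
    refine ⟨⟨fun i j k l => (c i k * e j l) • x, fun i j u hu v hv => ?_⟩, ?_⟩
    · simp only [bezierPatch, hc i u hu, he j v hv, Finset.sum_mul_sum, Finset.sum_smul, smul_smul]
      refine Finset.sum_congr rfl fun k _ => Finset.sum_congr rfl fun l _ => ?_
      congr 1
      ring
    · have h1 := hf.contDiff_twoDoubleKnots.comp (contDiff_fst (𝕜 := ℝ) (E := ℝ) (F := ℝ))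
      have h2 := hg.contDiff_twoDoubleKnots.comp (contDiff_snd (𝕜 := ℝ) (E := ℝ) (F := ℝ))
      exact (h1.mul h2).smul contDiff_const
  | zero => exact ⟨⟨0, fun i j u _ v _ => by simp [bezierPatch]⟩, contDiff_const⟩
  | add p q _ _ hp hq =>
    obtain ⟨⟨b, hb⟩, h1⟩ := hp
    obtain ⟨⟨c, hc⟩, h2⟩ := hq
    refine ⟨⟨fun i j k l => b i j k l + c i j k l, fun i j u hu v hv => ?_⟩, h1.add h2⟩
    simp only [Pi.add_apply, hb i j u hu v hv, hc i j u hu v hv, bezierPatch, smul_add,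
      Finset.sum_add_distrib]
  | smul r p _ hp =>
    obtain ⟨⟨b, hb⟩, h1⟩ := hp
    refine ⟨⟨fun i j k l => r • b i j k l, fun i j u hu v hv => ?_⟩, h1.const_smul r⟩
    simp only [Pi.smul_apply, hb i j u hu v hv, bezierPatch, Finset.smul_sum]
    refine Finset.sum_congr rfl fun k _ => Finset.sum_congr rfl fun l _ => ?_
    rw [smul_comm]

theorem isC1BezierArray_iff (p : ℝ → ℝ → E3) : IsC1BezierArray p ↔
    ∃ s : ℝ → ℝ → E3, IsBicubicSpline twoDoubleKnots s ∧
      ∀ u ∈ Set.Icc (0 : ℝ) 1, ∀ v ∈ Set.Icc (0 : ℝ) 1, p u v = s u v := by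
  refine ⟨isBicubicSpline_of_isC1BezierArray, ?_⟩
  rintro ⟨s, hs, h⟩
  obtain ⟨⟨⟨b, hb⟩, -⟩, hd⟩ := isC1BezierArray_of_isBicubicSpline hs
  refine ⟨⟨b, fun i j u hu v hv => ?_⟩, hd.contDiffOn.congr fun z hz => h _ hz.1 _ hz.2⟩
  have hm : ∀ (i : Fin 3) (x : ℝ), x ∈ Set.Icc (0 : ℝ) 1 →
      ((i : ℝ) + x) / 3 ∈ Set.Icc (0 : ℝ) 1 := by
    intro i x hx
    have : (i : ℝ) ≤ 2 := by exact_mod_cast Nat.le_of_lt_succ i.2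
    have h0 : (0 : ℝ) ≤ i := by positivity
    exact ⟨by linarith [hx.1], by linarith [hx.2]⟩
  rw [h _ (hm i u hu) _ (hm j v hv), hb i j u hu v hv]

/-! ### The scalar functions of the construction -/

/-- `2 cos (2π / n)`. -/
def cosValue (n : ℕ) : ℝ := 2 * Real.cos (2 * Real.pi / n)

theorem cosValue_four : cosValue 4 = 0 := by
  have : 2 * Real.pi / (4 : ℕ) = Real.pi / 2 := by push_cast; ring
  rw [cosValue, this, Real.cos_pi_div_two, mul_zero]

theorem cosValue_ne_zero {n : ℕ} (hn : 3 ≤ n) (h4 : n ≠ 4) : cosValue n ≠ 0 := by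
  have hpi := Real.pi_pos
  rcases (show n = 3 ∨ 4 < n by omega) with rfl | h
  · have : 2 * Real.pi / (3 : ℕ) = Real.pi - Real.pi / 3 := by push_cast; ring
    rw [cosValue, this, Real.cos_pi_sub, Real.cos_pi_div_three]
    norm_num
  · have hn' : (4 : ℝ) < n := by exact_mod_cast h
    have h1 : 2 * Real.pi / n < Real.pi / 2 := by
      rw [div_lt_div_iff₀ (by linarith) (by norm_num)]
      nlinarith
    have h2 : 0 < 2 * Real.pi / n := by positivity
    exact (mul_pos two_pos (Real.cos_pos_of_mem_Ioo ⟨by linarith, h1⟩)).ne'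

/-- The value at `2 / 3` of the function along an edge with values `x`, `y` at the ends. -/
def rampValue (x y : ℝ) : ℝ := if y = x then x else y - x

/-- The ratio of the jump of the second derivative of the boundary curves at `2 / 3` to the
first derivative. -/
def rampJump (x y : ℝ) : ℝ := if y = x then 9 else 6

/-- With `β` the value at `2 / 3`, the one-sided derivatives of `ramp` there are `6 β + 3 x` and `3
(y - β)`. The equation says that their difference is `β` times the jump ratio of `f''` to `f'`,
which is exactly what keeps `α f'` of class `C¹`. -/
theorem ramp_jump_eq (x y : ℝ) : 3 * y - 3 * x = (9 - rampJump x y) * rampValue x y := by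
  unfold rampJump rampValue
  split_ifs with h
  · rw [h]; ring
  · ring

theorem rampJump_pos (x y : ℝ) : 0 < 12 + rampJump x y := by
  unfold rampJump
  split_ifs <;> norm_num

/-- The scalar function along an edge with values `x`, `y` at the ends: it vanishes at `1 / 3` and
is continuously differentiable there. -/
def ramp (x y : ℝ) : ℝ → ℝ :=
  glue (fun u => x - 3 * x * u)
    (fun u => 9 * (rampValue x y + x) * (u - 1 / 3) ^ 2 - 3 * x * (u - 1 / 3))
    (fun u => rampValue x y + 3 * (y - rampValue x y) * (u - 2 / 3))

theorem ramp_left (x y : ℝ) {u : ℝ} (h : u ≤ 1 / 3) : ramp x y u = x - 3 * x * u := glue_left h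

theorem ramp_mid (x y : ℝ) {u : ℝ} (h : 1 / 3 ≤ u) (h' : u ≤ 2 / 3) : ramp x y u
    = 9 * (rampValue x y + x) * (u - 1 / 3) ^ 2 - 3 * x * (u - 1 / 3) :=
  glue_mid (by ring) h h'

theorem ramp_right (x y : ℝ) {u : ℝ} (h : 2 / 3 ≤ u) :
    ramp x y u = rampValue x y + 3 * (y - rampValue x y) * (u - 2 / 3) :=
  glue_right (by ring) h

/-- The edges on which the linear zero of the scalar function is close to the initial vertex. -/
def Oriented (m n : ℕ) : Prop := n ≠ 4 ∧ (m = 4 ∨ m < n)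

theorem Oriented.not_symm {m n : ℕ} (h : Oriented m n) : ¬ Oriented n m := by
  unfold Oriented at *; omega

theorem oriented_or {m n : ℕ} (h : m ≠ n) : Oriented m n ∨ Oriented n m := by
  unfold Oriented; omega

theorem Oriented.ne {m n : ℕ} (h : Oriented m n) : m ≠ n := by
  unfold Oriented at *; omega

open Classical in
/-- The scalar function along an edge from a vertex of valence `m` to a vertex of valence `n`. -/
def edgeScalar (m n : ℕ) (u : ℝ) : ℝ :=
  if m = n then cosValue m * (1 - 2 * u)
  else if Oriented m n then ramp (cosValue m) (-cosValue n) u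
  else - ramp (cosValue n) (-cosValue m) (1 - u)

theorem edgeScalar_self (m : ℕ) (u : ℝ) : edgeScalar m m u = cosValue m * (1 - 2 * u) := if_pos rfl

theorem edgeScalar_oriented {m n : ℕ} (h : Oriented m n) (u : ℝ) :
    edgeScalar m n u = ramp (cosValue m) (-cosValue n) u := by
  rw [edgeScalar, if_neg h.ne, if_pos h]

theorem edgeScalar_oriented' {m n : ℕ} (h : Oriented n m) (u : ℝ) :
    edgeScalar m n u = - ramp (cosValue n) (-cosValue m) (1 - u) := by
  rw [edgeScalar, if_neg h.ne.symm, if_neg h.not_symm]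

theorem edgeScalar_reflect (m n : ℕ) (u : ℝ) : edgeScalar n m u = - edgeScalar m n (1 - u) := by
  by_cases h : m = n
  · subst h
    rw [edgeScalar_self, edgeScalar_self]; ring
  · rcases oriented_or h with h | h
    · rw [edgeScalar_oriented' h, edgeScalar_oriented h]
    · rw [edgeScalar_oriented' h, edgeScalar_oriented h, sub_sub_cancel, neg_neg]

theorem edgeScalar_left (m n : ℕ) {u : ℝ} (h : u ≤ 1 / 3) :
    edgeScalar m n u = cosValue m + 3 * (edgeScalar m n (1 / 3) - cosValue m) * u := by
  by_cases hmn : m = n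
  · subst hmn
    rw [edgeScalar_self, edgeScalar_self]; ring
  · rcases oriented_or hmn with h' | h'
    · rw [edgeScalar_oriented h', edgeScalar_oriented h', ramp_left _ _ h, ramp_left _ _ le_rfl]
      ring
    · rw [edgeScalar_oriented' h', edgeScalar_oriented' h', ramp_right _ _ (by linarith),
        ramp_right _ _ (by norm_num)]
      ring

theorem edgeScalar_right (m n : ℕ) {u : ℝ} (h : 2 / 3 ≤ u) : edgeScalar m n u
    = edgeScalar m n (2 / 3) + 3 * (-cosValue n - edgeScalar m n (2 / 3)) * (u - 2 / 3) := by
  rw [edgeScalar_reflect n m u, edgeScalar_reflect n m (2 / 3), edgeScalar_left n m (by linarith)]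
  norm_num
  ring

theorem edgeScalar_zero (m n : ℕ) : edgeScalar m n 0 = cosValue m := by
  rw [edgeScalar_left m n (by norm_num)]; ring

/-- The derivative at `0` of the scalar function. -/
def edgeScalarSlope (m n : ℕ) : ℝ := 3 * (edgeScalar m n (1 / 3) - cosValue m)

/-- Needed because the unbiased value is zero at valence four: a term `α'(0) t` could not be
absorbed into the second derivatives. It holds because edges to other valences are oriented away
from such a vertex, where the ramp starts with slope `-3 * 0`. -/
theorem edgeScalarSlope_four {n : ℕ} : edgeScalarSlope 4 n = 0 := by
  by_cases h : 4 = n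
  · subst h
    rw [edgeScalarSlope, edgeScalar_self, cosValue_four]; ring
  · have h' : Oriented 4 n := ⟨fun e => h e.symm, Or.inl rfl⟩
    rw [edgeScalarSlope, edgeScalar_oriented h', ramp_left _ _ le_rfl, cosValue_four]; ring

theorem hasDerivWithinAt_edgeScalar (m n : ℕ) :
    HasDerivWithinAt (edgeScalar m n) (edgeScalarSlope m n) (Set.Icc 0 1) 0 := by
  have h : HasDerivAt (fun u : ℝ => cosValue m + edgeScalarSlope m n * u)
      (edgeScalarSlope m n) 0 :=
    (((hasDerivAt_id (0 : ℝ)).const_mul (edgeScalarSlope m n)).const_add _).congr_deriv (by ring)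
  have h2 := h.congr_of_eventuallyEq (f₁ := edgeScalar m n)
    (Filter.eventually_of_mem (Iio_mem_nhds (show (0 : ℝ) < 1 / 3 by norm_num))
      fun u hu => edgeScalar_left m n (le_of_lt hu))
  exact h2.hasDerivWithinAt

theorem derivWithin_edgeScalar (m n : ℕ) :
    derivWithin (edgeScalar m n) (Set.Icc 0 1) 0 = edgeScalarSlope m n :=
  (hasDerivWithinAt_edgeScalar m n).derivWithin
    (uniqueDiffOn_Icc (zero_lt_one' ℝ) 0 (by norm_num))

/-- Up to the factor 9 this is the leading coefficient of the middle piece of `ramp`; it equals `y`,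
or `2 y` if `y = x`. It is the reason why `Oriented` excludes final valence four. -/
theorem rampValue_add_ne_zero {x y : ℝ} (hy : y ≠ 0) : rampValue x y + x ≠ 0 := by
  unfold rampValue
  split_ifs with h
  · subst h
    intro h; exact hy (by linarith)
  · simpa using hy

theorem edgeScalar_segments {m n : ℕ} (_ : 3 ≤ m) (_ : 3 ≤ n) :
    ∃ p₀ p₁ p₂ : ℝ[X], HasSegments (edgeScalar m n) p₀ p₁ p₂ ∧
      p₀.natDegree ≤ 1 ∧ p₁.natDegree ≤ 2 ∧ p₂.natDegree ≤ 1 ∧ (m ≠ n → p₁.natDegree = 2) := by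
  have mid : ∃ p₁ : ℝ[X], (∀ u ∈ Set.Icc (1 / 3 : ℝ) (2 / 3), edgeScalar m n u = p₁.eval u) ∧
      p₁.natDegree ≤ 2 ∧ (m ≠ n → p₁.natDegree = 2) := by
    by_cases h : m = n
    · subst h
      refine ⟨C (cosValue m) * (1 - 2 * X), fun u _ => ?_, ?_, fun h => absurd rfl h⟩
      · rw [edgeScalar_self]; simp
      · refine (natDegree_C_mul_le _ _).trans ?_
        rw [show (2 : ℝ[X]) = C 2 from rfl]
        compute_degree!
    · have key : ∀ {m n : ℕ}, 3 ≤ n → Oriented m n →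
          9 * (rampValue (cosValue m) (-cosValue n) + cosValue m) ≠ 0 := fun hn h =>
        mul_ne_zero (by norm_num) (rampValue_add_ne_zero (neg_ne_zero.2 (cosValue_ne_zero hn h.1)))
      rcases oriented_or h with h' | h'
      · set κ := 9 * (rampValue (cosValue m) (-cosValue n) + cosValue m) with hκ
        have hdeg : (C κ * (X - C (1 / 3)) ^ 2
            - C (3 * cosValue m) * (X - C (1 / 3)) : ℝ[X]).natDegree = 2 := by
          have := key ‹_› h'
          compute_degree!
        refine ⟨_, fun u hu => ?_, hdeg.le, fun _ => hdeg⟩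
        rw [edgeScalar_oriented h', ramp_mid _ _ hu.1 hu.2]
        simp [hκ]
      · set κ := 9 * (rampValue (cosValue n) (-cosValue m) + cosValue n) with hκ
        have hdeg : (C (-κ) * (X - C (2 / 3)) ^ 2
            - C (3 * cosValue n) * (X - C (2 / 3)) : ℝ[X]).natDegree = 2 := by
          have := key ‹_› h'
          compute_degree!
        refine ⟨_, fun u hu => ?_, hdeg.le, fun _ => hdeg⟩
        rw [edgeScalar_oriented' h', ramp_mid _ _ (by linarith [hu.2]) (by linarith [hu.1])]
        simp [hκ]
        ring
  obtain ⟨p₁, h1, h2, h3⟩ := mid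
  refine ⟨C (cosValue m) + C (3 * (edgeScalar m n (1 / 3) - cosValue m)) * X, p₁,
    C (edgeScalar m n (2 / 3)) + C (3 * (-cosValue n - edgeScalar m n (2 / 3))) * (X - C (2 / 3)),
    ⟨fun u hu => ?_, h1, fun u hu => ?_⟩, ?_, h2, ?_, h3⟩
  · rw [edgeScalar_left m n hu.2]; simp
  · rw [edgeScalar_right m n hu.1]; simp
  · compute_degree
  · compute_degree

/-! ### Boundary curves -/

/-- Value, first and second derivative of a curve at `0` and at `1`. -/
structure Ends where
  (y₀ m₀ a₀ y₁ m₁ a₁ : E3)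

namespace Ends

/-- The end data of the reversed curve. -/
def rev (J : Ends) : Ends := ⟨J.y₁, -J.m₁, J.a₁, J.y₀, -J.m₀, J.a₀⟩

theorem rev_rev (J : Ends) : J.rev.rev = J := by
  cases J; simp [rev]

/-- A combination of the end data that determines the sum of the derivatives at the two knots. -/
def load (J : Ends) : E3 :=
  (54 : ℝ) • (J.y₁ - J.y₀) + (J.a₁ - J.a₀) - (12 : ℝ) • (J.m₀ + J.m₁)

theorem load_rev (J : Ends) : J.rev.load = - J.load := by
  simp only [load, rev]; module

/-- The derivatives at `1 / 3` and `2 / 3` of the boundary curve for a symmetric edge. -/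
def evenSlopes (J : Ends) : E3 × E3 :=
  ((1 / 36 : ℝ) • (J.load + (2 : ℝ) • J.a₀ + (12 : ℝ) • J.m₀ + J.a₁ - (6 : ℝ) • J.m₁),
    (1 / 36 : ℝ) • (J.load - (2 : ℝ) • J.a₁ + (12 : ℝ) • J.m₁ - J.a₀ - (6 : ℝ) • J.m₀))

/-- The derivatives at `1 / 3` and `2 / 3` of the boundary curve for an oriented edge. -/
def rampSlopes (μ : ℝ) (J : Ends) : E3 × E3 :=
  ((1 / 15 : ℝ) • J.load
      - (12 + μ)⁻¹ • ((1 / 5 : ℝ) • J.load + (6 : ℝ) • J.m₁ - J.a₁),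
    (12 + μ)⁻¹ • ((1 / 5 : ℝ) • J.load + (6 : ℝ) • J.m₁ - J.a₁))

open Classical in
/-- The derivatives at `1 / 3` and `2 / 3` of the boundary curve along an edge. -/
def slopes (m n : ℕ) (J : Ends) : E3 × E3 :=
  if m = n then J.evenSlopes
  else if Oriented m n then J.rampSlopes (rampJump (cosValue m) (-cosValue n))
  else (-(J.rev.rampSlopes (rampJump (cosValue n) (-cosValue m))).2,
    -(J.rev.rampSlopes (rampJump (cosValue n) (-cosValue m))).1)

theorem slopes_self (m : ℕ) (J : Ends) : J.slopes m m = J.evenSlopes := if_pos rfl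

theorem slopes_oriented {m n : ℕ} (h : Oriented m n) (J : Ends) :
    J.slopes m n = J.rampSlopes (rampJump (cosValue m) (-cosValue n)) := by
  rw [slopes, if_neg h.ne, if_pos h]

theorem slopes_oriented' {m n : ℕ} (h : Oriented n m) (J : Ends) :
    J.slopes m n = (-(J.rev.rampSlopes (rampJump (cosValue n) (-cosValue m))).2,
      -(J.rev.rampSlopes (rampJump (cosValue n) (-cosValue m))).1) := by
  rw [slopes, if_neg h.ne.symm, if_neg h.not_symm]

/-- The two darts of an edge must produce the same curve. For unequal valences this is built into
the definition; for equal valences it is the symmetry of the `C²` spline. -/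
theorem slopes_rev (m n : ℕ) (J : Ends) :
    J.rev.slopes n m = (-(J.slopes m n).2, -(J.slopes m n).1) := by
  by_cases h : m = n
  · subst h
    rw [slopes_self, slopes_self]
    refine Prod.ext ?_ ?_ <;>
    · simp only [evenSlopes, load_rev]
      simp only [rev]
      module
  · rcases oriented_or h with h | h
    · rw [slopes_oriented h, slopes_oriented' h, rev_rev]
    · rw [slopes_oriented h, slopes_oriented' h, neg_neg, neg_neg]

/-- The derivatives of the boundary curve at the nodes. -/
def slopeNodes (m n : ℕ) (J : Ends) : Fin 4 → E3 :=
  ![J.m₀, (J.slopes m n).1, (J.slopes m n).2, J.m₁]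

/-- The values of the boundary curve at the nodes. -/
def valueNodes (m n : ℕ) (J : Ends) : Fin 4 → E3 :=
  ![J.y₀, J.y₀ + (1 / 54 : ℝ) • (J.a₀ + (12 : ℝ) • J.m₀ + (6 : ℝ) • (J.slopes m n).1),
    J.y₁ + (1 / 54 : ℝ) • (J.a₁ - (12 : ℝ) • J.m₁ - (6 : ℝ) • (J.slopes m n).2), J.y₁]

/-- The derivatives at the nodes of the product of the scalar function with the derivative of the
boundary curve. -/
def productNodes (m n : ℕ) (J : Ends) : Fin 4 → E3 :=
  ![cosValue m • J.a₀ + edgeScalarSlope m n • J.m₀,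
    edgeScalarSlope m n • (J.slopes m n).1
      + edgeScalar m n (1 / 3) • (-J.a₀ - (6 : ℝ) • J.m₀ + (6 : ℝ) • (J.slopes m n).1),
    edgeScalarSlope n m • (J.slopes m n).2
      + edgeScalar m n (2 / 3) • (-J.a₁ + (6 : ℝ) • J.m₁ - (6 : ℝ) • (J.slopes m n).2),
    edgeScalarSlope n m • J.m₁ - cosValue n • J.a₁]

theorem slopeNodes_rev (m n : ℕ) (J : Ends) (j : Fin 4) :
    J.rev.slopeNodes n m j = - J.slopeNodes m n j.rev := by
  have h := slopes_rev m n J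
  fin_cases j
  · rfl
  · exact congrArg Prod.fst h
  · exact congrArg Prod.snd h
  · rfl

theorem valueNodes_rev (m n : ℕ) (J : Ends) (j : Fin 4) :
    J.rev.valueNodes n m j = J.valueNodes m n j.rev := by
  have h := slopes_rev m n J
  fin_cases j
  · rfl
  · change J.y₁ + (1 / 54 : ℝ) • (J.a₁ + (12 : ℝ) • (-J.m₁) + (6 : ℝ) • (J.rev.slopes n m).1)
      = J.y₁ + (1 / 54 : ℝ) • (J.a₁ - (12 : ℝ) • J.m₁ - (6 : ℝ) • (J.slopes m n).2)
    rw [h]; module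
  · change J.y₀ + (1 / 54 : ℝ) • (J.a₀ - (12 : ℝ) • (-J.m₀) - (6 : ℝ) • (J.rev.slopes n m).2)
      = J.y₀ + (1 / 54 : ℝ) • (J.a₀ + (12 : ℝ) • J.m₀ + (6 : ℝ) • (J.slopes m n).1)
    rw [h]; module
  · rfl

theorem edgeScalar_two_thirds (m n : ℕ) : edgeScalar n m (2 / 3) = - edgeScalar m n (1 / 3) := by
  rw [edgeScalar_reflect m n]; norm_num

theorem productNodes_rev (m n : ℕ) (J : Ends) (j : Fin 4) :
    J.rev.productNodes n m j = - J.productNodes m n j.rev := by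
  have h := slopes_rev m n J
  have h1 := edgeScalar_two_thirds m n
  have h2 := edgeScalar_two_thirds n m
  fin_cases j
  · change cosValue n • J.a₁ + edgeScalarSlope n m • (-J.m₁)
      = -(edgeScalarSlope n m • J.m₁ - cosValue n • J.a₁)
    module
  · change edgeScalarSlope n m • (J.rev.slopes n m).1 + edgeScalar n m (1 / 3) •
        (-J.a₁ - (6 : ℝ) • (-J.m₁) + (6 : ℝ) • (J.rev.slopes n m).1)
      = -(edgeScalarSlope n m • (J.slopes m n).2
      + edgeScalar m n (2 / 3) • (-J.a₁ + (6 : ℝ) • J.m₁ - (6 : ℝ) • (J.slopes m n).2))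
    rw [h, h2]; module
  · change edgeScalarSlope m n • (J.rev.slopes n m).2 + edgeScalar n m (2 / 3) •
        (-J.a₀ + (6 : ℝ) • (-J.m₀) - (6 : ℝ) • (J.rev.slopes n m).2)
      = -(edgeScalarSlope m n • (J.slopes m n).1
      + edgeScalar m n (1 / 3) • (-J.a₀ - (6 : ℝ) • J.m₀ + (6 : ℝ) • (J.slopes m n).1))
    rw [h, h1]; module
  · change edgeScalarSlope m n • (-J.m₀) - cosValue m • J.a₀
      = -(cosValue m • J.a₀ + edgeScalarSlope m n • J.m₀)
    module

end Ends

/-! ### The scalar function times the derivative of the boundary curve, segment by segment. -/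

section Product

variable {E : Type*} [NormedAddCommGroup E] [NormedSpace ℝ E]

theorem product_left (x A : ℝ) (y₀ m₀ a₀ s : E) (u : ℝ) :
    (x + 3 * (A - x) * u) •
        pieceDeriv 0 y₀ m₀ (y₀ + (1 / 54 : ℝ) • (a₀ + (12 : ℝ) • m₀ + (6 : ℝ) • s)) s u
      = piece 0 (x • m₀) (x • a₀ + (3 * (A - x)) • m₀) (A • s)
        ((3 * (A - x)) • s + A • (-a₀ - (6 : ℝ) • m₀ + (6 : ℝ) • s)) u := by
  simp only [piece, pieceDeriv]
  module

theorem product_right (x A : ℝ) (y₁ m₁ a₁ s : E) (u : ℝ) :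
    (A + 3 * (x - A) * (u - 2 / 3)) • pieceDeriv (2 / 3)
        (y₁ + (1 / 54 : ℝ) • (a₁ - (12 : ℝ) • m₁ - (6 : ℝ) • s)) s y₁ m₁ u
      = piece (2 / 3) (A • s) ((3 * (x - A)) • s + A • (-a₁ + (6 : ℝ) • m₁ - (6 : ℝ) • s))
        (x • m₁) ((3 * (x - A)) • m₁ + x • a₁) u := by
  simp only [piece, pieceDeriv]
  module

/-- `hy` and `hQ` say that `P` and `Q` are the second derivatives of the middle cubic at its ends.
Applied with the second derivatives of the outer pieces, they express that the curve is `C²` at both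
knots. -/
theorem product_mid_even (x : ℝ) (y₁ y₂ s₁ s₂ P Q : E)
    (hy : y₂ = y₁ + (1 / 54 : ℝ) • (P + (12 : ℝ) • s₁ + (6 : ℝ) • s₂))
    (hQ : Q = -P - (6 : ℝ) • s₁ + (6 : ℝ) • s₂) (u : ℝ) :
    (x * (1 - 2 * u)) • pieceDeriv (1 / 3) y₁ s₁ y₂ s₂ u
      = piece (1 / 3) ((x / 3) • s₁) ((-2 * x) • s₁ + (x / 3) • P)
        ((-x / 3) • s₂) ((-2 * x) • s₂ + (-x / 3) • Q) u := by
  subst hy hQ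
  simp only [piece, pieceDeriv]
  module

/-- `hy` is the trapezoidal rule, that is, the middle piece is quadratic, its derivative linear and
the product cubic. Its second derivative is `3 (s₂ - s₁)`, so `hQ` prescribes the jump `μ s₂` to the
second derivative `Q` of the last piece, and `hβ` makes this jump cancel the one of the scalar
function's derivative. -/
theorem product_mid_ramp (x y β μ : ℝ) (y₁ y₂ s₁ s₂ Q : E) (hβ : 3 * y - 3 * x = (9 - μ) * β)
    (hy : y₂ = y₁ + (1 / 6 : ℝ) • (s₁ + s₂))
    (hQ : Q = (3 + μ) • s₂ - (3 : ℝ) • s₁) (u : ℝ) :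
    (9 * (β + x) * (u - 1 / 3) ^ 2 - 3 * x * (u - 1 / 3)) • pieceDeriv (1 / 3) y₁ s₁ y₂ s₂ u
      = piece (1 / 3) 0 ((-3 * x) • s₁) (β • s₂) ((3 * (y - β)) • s₂ + β • Q) u := by
  obtain rfl : y = x + (9 - μ) * β / 3 := by linarith
  subst hy hQ
  simp only [piece, pieceDeriv]
  module

end Product

namespace Ends

theorem product_mid_self (m : ℕ) (J : Ends) {u : ℝ} :
    edgeScalar m m u • pieceDeriv (1 / 3) (J.valueNodes m m 1) (J.slopeNodes m m 1)
        (J.valueNodes m m 2) (J.slopeNodes m m 2) u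
      = piece (1 / 3) (edgeScalar m m (1 / 3) • J.slopeNodes m m 1) (J.productNodes m m 1)
        (edgeScalar m m (2 / 3) • J.slopeNodes m m 2) (J.productNodes m m 2) u := by
  have h := product_mid_even (cosValue m) (J.valueNodes m m 1) (J.valueNodes m m 2)
    (J.slopes m m).1 (J.slopes m m).2
    (-J.a₀ - (6 : ℝ) • J.m₀ + (6 : ℝ) • (J.slopes m m).1)
    (-J.a₁ + (6 : ℝ) • J.m₁ - (6 : ℝ) • (J.slopes m m).2) (by
      simp only [valueNodes, slopes_self, evenSlopes, load, Matrix.cons_val]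
      module) (by
      simp only [slopes_self, evenSlopes, load]
      module) u
  have e1 : edgeScalar m m (1 / 3) = cosValue m / 3 := by rw [edgeScalar_self]; ring
  have e2 : edgeScalar m m (2 / 3) = -cosValue m / 3 := by rw [edgeScalar_self]; ring
  have e3 : edgeScalarSlope m m = -2 * cosValue m := by rw [edgeScalarSlope, e1]; ring
  rw [edgeScalar_self]
  refine Eq.trans rfl (h.trans ?_)
  simp only [slopeNodes, productNodes, Matrix.cons_val, e1, e2, e3]

/-- This undoes the solution of the linear system in `rampSlopes`: slopes with sum `load / 15` mean
that the middle piece is quadratic, and the formula for the second slope encodes the jump of the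
second derivative at `2 / 3`. -/
theorem product_mid_oriented {m n : ℕ} (hmn : Oriented m n) (J : Ends) {u : ℝ}
    (h1 : 1 / 3 ≤ u) (h2 : u ≤ 2 / 3) :
    edgeScalar m n u • pieceDeriv (1 / 3) (J.valueNodes m n 1) (J.slopeNodes m n 1)
        (J.valueNodes m n 2) (J.slopeNodes m n 2) u
      = piece (1 / 3) (edgeScalar m n (1 / 3) • J.slopeNodes m n 1) (J.productNodes m n 1)
        (edgeScalar m n (2 / 3) • J.slopeNodes m n 2) (J.productNodes m n 2) u := by
  set x := cosValue m
  set y := -cosValue n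
  have hμ := (rampJump_pos x y).ne'
  have hs : (12 + rampJump x y) • (J.slopes m n).2
      = (1 / 5 : ℝ) • J.load + (6 : ℝ) • J.m₁ - J.a₁ := by
    rw [slopes_oriented hmn, rampSlopes, smul_smul, mul_inv_cancel₀ hμ, one_smul]
  have hs1 : (J.slopes m n).1 = (1 / 15 : ℝ) • J.load - (J.slopes m n).2 := by
    rw [slopes_oriented hmn, rampSlopes]
  have ha : J.a₁ = (1 / 5 : ℝ) • J.load + (6 : ℝ) • J.m₁
      - (12 + rampJump x y) • (J.slopes m n).2 := by
    rw [hs]; abel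
  have hQ : -J.a₁ + (6 : ℝ) • J.m₁ - (6 : ℝ) • (J.slopes m n).2
      = (3 + rampJump x y) • (J.slopes m n).2 - (3 : ℝ) • (J.slopes m n).1 := by
    rw [ha, hs1]; module
  have h := product_mid_ramp x y (rampValue x y) (rampJump x y) (J.valueNodes m n 1)
    (J.valueNodes m n 2) (J.slopes m n).1 (J.slopes m n).2 _ (ramp_jump_eq x y) (by
      simp only [valueNodes, Matrix.cons_val, hs1, load]
      module) hQ u
  have e1 : edgeScalar m n (1 / 3) = 0 := by
    rw [edgeScalar_oriented hmn, ramp_left _ _ le_rfl]; ring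
  have e2 : edgeScalar m n (2 / 3) = rampValue x y := by
    rw [edgeScalar_oriented hmn, ramp_right _ _ le_rfl]; ring
  have e3 : edgeScalarSlope m n = -3 * x := by rw [edgeScalarSlope, e1]; ring
  have e4 : edgeScalarSlope n m = 3 * (y - rampValue x y) := by
    have := edgeScalar_two_thirds n m
    rw [edgeScalarSlope, show edgeScalar n m (1 / 3) = - rampValue x y by linarith]
    simp only [y]; ring
  rw [edgeScalar_oriented hmn, ramp_mid _ _ h1 h2]
  refine Eq.trans rfl (h.trans ?_)
  simp only [slopeNodes, productNodes, Matrix.cons_val, e1, e2, e3, e4, zero_smul, add_zero]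

theorem product_aux {m n : ℕ} (J : Ends)
    (hmid : ∀ u, 1 / 3 ≤ u → u ≤ 2 / 3 →
      edgeScalar m n u • pieceDeriv (1 / 3) (J.valueNodes m n 1) (J.slopeNodes m n 1)
        (J.valueNodes m n 2) (J.slopeNodes m n 2) u
      = piece (1 / 3) (edgeScalar m n (1 / 3) • J.slopeNodes m n 1) (J.productNodes m n 1)
        (edgeScalar m n (2 / 3) • J.slopeNodes m n 2) (J.productNodes m n 2) u) (u : ℝ) :
    edgeScalar m n u • hermDeriv (J.valueNodes m n) (J.slopeNodes m n) u
      = herm (fun j : Fin 4 => edgeScalar m n ((j : ℝ) / 3) • J.slopeNodes m n j)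
        (J.productNodes m n) u := by
  have c0 : ((0 : Fin 4) : ℝ) / 3 = 0 := by norm_num
  have c1 : ((1 : Fin 4) : ℝ) / 3 = 1 / 3 := by norm_num
  have c2 : ((2 : Fin 4) : ℝ) / 3 = 2 / 3 := by norm_num
  have c3 : ((3 : Fin 4) : ℝ) / 3 = 1 := by
    rw [show ((3 : Fin 4) : ℕ) = 3 from rfl]; norm_num
  have hone : edgeScalar m n 1 = - cosValue n := by
    rw [edgeScalar_reflect n m, sub_self, edgeScalar_zero]
  rcases le_total u (1 / 3) with h | h
  · rw [hermDeriv_left _ _ h, herm_left _ _ h, c0, c1, edgeScalar_left m n h, edgeScalar_zero]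
    exact product_left _ _ _ _ _ _ _
  · rcases le_total u (2 / 3) with h' | h'
    · rw [hermDeriv_mid _ _ h h', herm_mid _ _ h h', c1, c2]
      exact hmid u h h'
    · rw [hermDeriv_right _ _ h', herm_right _ _ h', c2, c3, edgeScalar_right m n h', hone]
      have e : edgeScalarSlope n m = 3 * (-cosValue n - edgeScalar m n (2 / 3)) := by
        rw [edgeScalar_two_thirds n m, edgeScalarSlope]; ring
      have := product_right (-cosValue n) (edgeScalar m n (2 / 3)) J.y₁ J.m₁ J.a₁
        (J.slopes m n).2 u
      simp only [slopeNodes, valueNodes, productNodes, Matrix.cons_val, e]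
      rw [this]
      congr 1
      module

theorem hermDeriv_reflect {E : Type*} [NormedAddCommGroup E] [NormedSpace ℝ E]
    (y m : Fin 4 → E) (u : ℝ) :
    hermDeriv (fun j => y j.rev) (fun j => - m j.rev) u = - hermDeriv y m (1 - u) := by
  have h := HasDerivAt.comp_const_sub 1 u (hasDerivAt_herm y m (1 - u))
  have e : (fun x : ℝ => herm y m (1 - x)) = herm (fun j => y j.rev) (fun j => - m j.rev) := by
    funext x; exact herm_reflect y m x
  rw [e] at h
  exact (hasDerivAt_herm _ _ u).unique h

theorem product_eq (m n : ℕ) (J : Ends) (u : ℝ) :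
    edgeScalar m n u • hermDeriv (J.valueNodes m n) (J.slopeNodes m n) u
      = herm (fun j : Fin 4 => edgeScalar m n ((j : ℝ) / 3) • J.slopeNodes m n j)
        (J.productNodes m n) u := by
  by_cases h : m = n
  · subst h
    exact product_aux J (fun u _ _ => product_mid_self m J) u
  rcases oriented_or h with h | h
  · exact product_aux J (fun u h1 h2 => product_mid_oriented h J h1 h2) u
  -- On an edge oriented the other way the identity is the one of the reversed edge at `1 - u`.
  · have key := product_aux J.rev (fun u h1 h2 => product_mid_oriented h J.rev h1 h2) (1 - u)
    rw [herm_reflect] at key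
    have e1 : J.valueNodes m n = fun j => J.rev.valueNodes n m j.rev := by
      funext j; rw [← valueNodes_rev, rev_rev]
    have e2 : J.slopeNodes m n = fun j => - J.rev.slopeNodes n m j.rev := by
      funext j; rw [← slopeNodes_rev, rev_rev]
    have e3 : J.productNodes m n = fun j => - J.rev.productNodes n m j.rev := by
      funext j; rw [← productNodes_rev, rev_rev]
    rw [edgeScalar_reflect n m u, e1, e2, e3, hermDeriv_reflect, smul_neg, neg_smul, neg_neg, key]
    congr 1
    funext j
    rw [edgeScalar_reflect n m, smul_neg, neg_smul, neg_neg]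
    congr 2
    fin_cases j <;> norm_num [Fin.rev]

/-- The position of the far end enters through `load`. As `γ` is not zero, moving the far vertex
gives the first inner slope any desired value without touching the data at the near vertex. -/
theorem slopes_shift (m n : ℕ) :
    ∃ γ : ℝ, γ ≠ 0 ∧ ∀ (y₀ m₀ a₀ y₁ m₁ a₁ δ : E3),
      (slopes m n ⟨y₀, m₀, a₀, y₁ + δ, m₁, a₁⟩).1
        = (slopes m n ⟨y₀, m₀, a₀, y₁, m₁, a₁⟩).1 + γ • δ := by
  by_cases h : m = n
  · subst h
    refine ⟨3 / 2, by norm_num, fun y₀ m₀ a₀ y₁ m₁ a₁ δ => ?_⟩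
    simp only [slopes_self, evenSlopes, load]
    module
  rcases oriented_or h with h | h
  · set μ := rampJump (cosValue m) (-cosValue n) with hμ
    refine ⟨54 / 15 - (12 + μ)⁻¹ * (54 / 5), ?_, fun y₀ m₀ a₀ y₁ m₁ a₁ δ => ?_⟩
    · have : μ = 9 ∨ μ = 6 := by rw [hμ, rampJump]; split_ifs <;> simp
      rcases this with h | h <;> rw [h] <;> norm_num
    · simp only [slopes_oriented h, rampSlopes, load, ← hμ]
      module
  · set μ := rampJump (cosValue n) (-cosValue m) with hμ
    refine ⟨(12 + μ)⁻¹ * (54 / 5), ?_, fun y₀ m₀ a₀ y₁ m₁ a₁ δ => ?_⟩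
    · have : μ = 9 ∨ μ = 6 := by rw [hμ, rampJump]; split_ifs <;> simp
      rcases this with h | h <;> rw [h] <;> norm_num
    · simp only [slopes_oriented' h, rampSlopes, load, rev, ← hμ]
      module

/-- Serves a genericity argument: spreading the vertices along a line makes the sum of the inner
slopes nonzero in that direction. -/
theorem slopes_sum_shift (m n : ℕ) :
    ∃ γ : ℝ, γ ≠ 0 ∧ ∀ (y₀ m₀ a₀ y₁ m₁ a₁ : E3),
      (slopes m n ⟨y₀, m₀, a₀, y₁, m₁, a₁⟩).1 + (slopes m n ⟨y₀, m₀, a₀, y₁, m₁, a₁⟩).2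
        = (slopes m n ⟨0, m₀, a₀, 0, m₁, a₁⟩).1 + (slopes m n ⟨0, m₀, a₀, 0, m₁, a₁⟩).2
          + γ • (y₁ - y₀) := by
  by_cases h : m = n
  · subst h
    refine ⟨3, by norm_num, fun y₀ m₀ a₀ y₁ m₁ a₁ => ?_⟩
    simp only [slopes_self, evenSlopes, load]
    module
  rcases oriented_or h with h | h
  · refine ⟨54 / 15, by norm_num, fun y₀ m₀ a₀ y₁ m₁ a₁ => ?_⟩
    simp only [slopes_oriented h, rampSlopes, load]
    module
  · refine ⟨54 / 15, by norm_num, fun y₀ m₀ a₀ y₁ m₁ a₁ => ?_⟩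
    simp only [slopes_oriented' h, rampSlopes, load, rev]
    module

/-- In this coordinate the load vanishes and with it the sum of the two inner slopes, while the
second derivatives at the ends keep each of them nonzero. -/
theorem slopes_vertical (m n : ℕ) (J : Ends) (i : Fin 3) (hy₀ : J.y₀ i = 0) (hy₁ : J.y₁ i = 0)
    (hm₀ : J.m₀ i = 0) (hm₁ : J.m₁ i = 0) (ha₀ : J.a₀ i = 1) (ha₁ : J.a₁ i = 1) :
    (J.slopes m n).1 i ≠ 0 ∧ (J.slopes m n).2 i = - (J.slopes m n).1 i := by
  by_cases h : m = n
  · subst h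
    simp [slopes_self, evenSlopes, load, hy₀, hy₁, hm₀, hm₁, ha₀, ha₁]
    norm_num
  rcases oriented_or h with h | h
  · have hμ := (rampJump_pos (cosValue m) (-cosValue n)).ne'
    simp [slopes_oriented h, rampSlopes, load, hy₀, hy₁, hm₀, hm₁, ha₀, ha₁, hμ]
  · have hμ := (rampJump_pos (cosValue n) (-cosValue m)).ne'
    simp [slopes_oriented' h, rampSlopes, load, rev, hy₀, hy₁, hm₀, hm₁, ha₀, ha₁, hμ]

end Ends

/-! ### Curves without straight segments -/

theorem cubic_coeffs_eq_zero {x y z a b c d : ℝ} (hyz : y < z)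
    (h : ∀ u ∈ Set.Icc y z, a + b * (u - x) + c * (u - x) ^ 2 + d * (u - x) ^ 3 = 0) :
    a = 0 ∧ b = 0 ∧ c = 0 ∧ d = 0 := by
  set p : ℝ[X] := C a + C b * X + C c * X ^ 2 + C d * X ^ 3 with hp
  have hp0 : p = 0 := by
    refine p.eq_zero_of_infinite_isRoot ((Set.Icc_infinite
      (show y - x < z - x by linarith)).mono fun u hu => ?_)
    have := h (u + x) ⟨by linarith [hu.1], by linarith [hu.2]⟩
    simpa [hp, IsRoot] using this
  have hc : ∀ n, p.coeff n = 0 := fun n => by rw [hp0, coeff_zero]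
  refine ⟨?_, ?_, ?_, ?_⟩
  · simpa [hp, coeff_X, coeff_C, coeff_X_pow] using hc 0
  · simpa [hp, coeff_X, coeff_C, coeff_X_pow] using hc 1
  · simpa [hp, coeff_X, coeff_C, coeff_X_pow] using hc 2
  · simpa [hp, coeff_X, coeff_C, coeff_X_pow] using hc 3

/-- A linear functional that kills the direction of the line is constant on the segment. Then its
polynomial has no higher coefficients, and the functional kills `m₀` and `m₁`; both would lie in the
line spanned by `v`. -/
theorem not_collinear_piece {a y z : ℝ} {y₀ m₀ y₁ m₁ : E3}
    (hm : LinearIndependent ℝ ![m₀, m₁]) (hyz : y < z) :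
    ¬ Collinear ℝ (piece a y₀ m₀ y₁ m₁ '' Set.Icc y z) := by
  intro hcol
  obtain ⟨p, v, hv⟩ := (collinear_iff_exists_forall_eq_smul_vadd _).1 hcol
  have key : ∀ φ : E3 →ₗ[ℝ] ℝ, φ v = 0 → φ m₀ = 0 ∧ φ m₁ = 0 := by
    intro φ hφ
    have h : ∀ u ∈ Set.Icc y z, (φ y₀ - φ p) + φ m₀ * (u - a)
        + (-27 * φ y₀ - 6 * φ m₀ + 27 * φ y₁ - 3 * φ m₁) * (u - a) ^ 2
        + (54 * φ y₀ + 9 * φ m₀ - 54 * φ y₁ + 9 * φ m₁) * (u - a) ^ 3 = 0 := by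
      intro u hu
      obtain ⟨r, hr⟩ := hv _ ⟨u, hu, rfl⟩
      have := congrArg φ hr
      simp only [piece, vadd_eq_add, map_add, map_smul, hφ, smul_eq_mul, mul_zero, zero_add] at this
      linear_combination this
    obtain ⟨-, h1, h2, h3⟩ := cubic_coeffs_eq_zero hyz h
    -- Twice the quadratic coefficient plus the cubic one is `3 (φ m₁ - φ m₀)`.
    exact ⟨h1, by linarith⟩
  have hspan : ∀ m : E3, (∀ φ : E3 →ₗ[ℝ] ℝ, φ v = 0 → φ m = 0) → ∃ r : ℝ, r • v = m := by
    intro m h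
    rw [← Submodule.mem_span_singleton]
    by_contra hn
    obtain ⟨φ, h1, h2⟩ := Submodule.exists_le_ker_of_notMem hn
    exact h1 (h φ (h2 (Submodule.mem_span_singleton_self v)))
  obtain ⟨r, hr⟩ := hspan m₀ fun φ hφ => (key φ hφ).1
  obtain ⟨s, hs⟩ := hspan m₁ fun φ hφ => (key φ hφ).2
  rw [LinearIndependent.pair_iff] at hm
  have h0 := hm s (-r) (by rw [← hr, ← hs]; module)
  have hr0 : r = 0 := by simpa using h0.2
  have := hm 1 0 (by rw [← hr, hr0]; simp)
  exact one_ne_zero this.1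

theorem not_collinear_herm_start {y m : Fin 4 → E3} (h : LinearIndependent ℝ ![m 0, m 1]) {b : ℝ}
    (hb : 0 < b) : ¬ Collinear ℝ (herm y m '' Set.Icc 0 b) := by
  intro hc
  refine not_collinear_piece (a := 0) (y₀ := y 0) (y₁ := y 1) h
    (show 0 < min b (1 / 3) by positivity) (hc.subset ?_)
  rintro _ ⟨u, hu, rfl⟩
  exact ⟨u, ⟨hu.1, hu.2.trans (min_le_left _ _)⟩, herm_left _ _ (hu.2.trans (min_le_right _ _))⟩

theorem not_collinear_herm {y m : Fin 4 → E3} (h₀ : LinearIndependent ℝ ![m 0, m 1])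
    (h₁ : LinearIndependent ℝ ![m 1, m 2]) (h₂ : LinearIndependent ℝ ![m 2, m 3]) {a b : ℝ}
    (hab : a < b) : ¬ Collinear ℝ (herm y m '' Set.Icc a b) := by
  intro hc
  rcases lt_or_ge a (1 / 3) with h | h
  · refine not_collinear_piece (a := 0) (y₀ := y 0) (y₁ := y 1) h₀
      (show a < min b (1 / 3) from lt_min hab h) (hc.subset ?_)
    rintro _ ⟨u, hu, rfl⟩
    exact ⟨u, ⟨hu.1, hu.2.trans (min_le_left _ _)⟩, herm_left _ _ (hu.2.trans (min_le_right _ _))⟩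
  rcases lt_or_ge a (2 / 3) with h' | h'
  · refine not_collinear_piece (a := 1 / 3) (y₀ := y 1) (y₁ := y 2) h₁
      (show a < min b (2 / 3) from lt_min hab h') (hc.subset ?_)
    rintro _ ⟨u, hu, rfl⟩
    exact ⟨u, ⟨hu.1, hu.2.trans (min_le_left _ _)⟩,
      herm_mid _ _ (h.trans hu.1) (hu.2.trans (min_le_right _ _))⟩
  · refine not_collinear_piece (a := 2 / 3) (y₀ := y 2) (y₁ := y 3) h₂ hab (hc.subset ?_)
    rintro _ ⟨u, hu, rfl⟩
    exact ⟨u, hu, herm_right _ _ (h'.trans hu.1)⟩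

/-! ### The combinatorics of a gluing -/

namespace QuadGluing

variable (M : QuadGluing)

/-- The next side of the same quad. -/
def next (d : M.Dart) : M.Dart := (d.1, d.2 + 1)

variable {M}

theorem rot_next (d : M.Dart) : M.rot (M.next d) = M.opp d := by
  simp [rot, next]

theorem rot_symm (d : M.Dart) : M.rot.symm d = M.next (M.opp d) := by
  rw [Equiv.symm_apply_eq, rot_next, M.opp_opp]

theorem rot_symm_opp (d : M.Dart) : M.rot.symm (M.opp d) = M.next d := by
  rw [rot_symm, M.opp_opp]

theorem valence_rot (d : M.Dart) : M.valence (M.rot d) = M.valence d := by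
  have := M.finite_quad
  exact Function.minimalPeriod_apply (Function.Injective.mem_periodicPts M.rot.injective d)

theorem valence_rot_symm (d : M.Dart) : M.valence (M.rot.symm d) = M.valence d := by
  rw [← valence_rot (M.rot.symm d), Equiv.apply_symm_apply]

end QuadGluing

theorem localPatch_next {M : QuadGluing} (S : M.Quad → ℝ → ℝ → E3) (d : M.Dart) (u v : ℝ) :
    localPatch S (M.next d) u v = localPatch S d (1 - v) u := by
  obtain ⟨q, i⟩ := d
  fin_cases i <;> simp [localPatch, QuadGluing.next, cornerChart]

/-- Seen from the opposite dart, the cross-boundary derivative of the other patch has the same form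
as that of the given one; this makes the constraint symmetric in the two darts of an edge. -/
theorem d1_localPatch_rot_symm {M : QuadGluing} (S : M.Quad → ℝ → ℝ → E3) (d : M.Dart) (u : ℝ) :
    d1 (localPatch S (M.rot.symm d)) 0 u = d2 (localPatch S (M.opp d)) (1 - u) 0 := by
  simp only [d1, d2, QuadGluing.rot_symm, localPatch_next]

/-! ### Patches with prescribed boundary -/

/-- A function that turns every nonzero vector into a linearly independent one. -/
def turn (x : E3) : E3 :=
  if x 0 = 0 ∧ x 1 = 0 then !₂[x 2, 0, 0] else !₂[-x 1, x 0, 0]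

/-- Oddness makes the two `turn` terms along an edge cancel in the sum of the cross-boundary
derivatives, since the derivative of the curve changes sign with the direction of the edge. -/
theorem turn_neg (x : E3) : turn (-x) = - turn x := by
  unfold turn
  by_cases h : x 0 = 0 ∧ x 1 = 0
  · rw [if_pos h, if_pos (by simpa using h)]
    ext i; fin_cases i <;> simp
  · rw [if_neg h, if_neg (by simpa using h)]
    ext i; fin_cases i <;> simp

theorem linearIndependent_turn {x : E3} (hx : x ≠ 0) (r : ℝ) :
    LinearIndependent ℝ ![x, r • x + turn x] := by
  rw [LinearIndependent.pair_iff]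
  intro s t h
  have h0 := congrFun (congrArg WithLp.ofLp h) 0
  have h1 := congrFun (congrArg WithLp.ofLp h) 1
  have h2 := congrFun (congrArg WithLp.ofLp h) 2
  unfold turn at h0 h1 h2
  split_ifs at h0 h1 h2 with hc
  · have hx2 : x 2 ≠ 0 := by
      intro h3
      apply hx
      ext i; fin_cases i
      · exact hc.1
      · exact hc.2
      · exact h3
    simp [hc.1, hc.2] at h0 h1 h2
    have ht : t = 0 := by tauto
    subst ht
    simpa [hx2] using h2
  · simp at h0 h1 h2
    have hpos : 0 < x 0 ^ 2 + x 1 ^ 2 := by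
      rcases not_and_or.1 hc with h | h <;> positivity
    have ht : t * (x 0 ^ 2 + x 1 ^ 2) = 0 := by linear_combination x 0 * h1 - x 1 * h0
    have ht' : t = 0 := by
      rcases mul_eq_zero.1 ht with h | h
      · exact h
      · exact absurd h hpos.ne'
    subst ht'
    have hs : s * (x 0 ^ 2 + x 1 ^ 2) = 0 := by linear_combination x 0 * h0 + x 1 * h1
    rcases mul_eq_zero.1 hs with h | h
    · exact ⟨h, rfl⟩
    · exact absurd h hpos.ne'

/-- The nodal data without the last node. -/
def dropLast (y : Fin 4 → E3) : Fin 4 → E3 := ![y 0, y 1, y 2, 0]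

/-- Nodal values and derivatives of the boundary curves `y`, `m` and of the cross-boundary
derivatives `w`, `w'`, with the compatibility conditions at the corners. -/
structure BoundaryData (M : QuadGluing) where
  (y m w w' : M.Dart → Fin 4 → E3)
  y_three : ∀ d, y d 3 = y (M.next d) 0
  m_three : ∀ d, m d 3 = - w (M.next d) 0
  w_three : ∀ d, w d 3 = m (M.next d) 0
  w'_three : ∀ d, w' d 3 = - w' (M.next d) 0

namespace BoundaryData

variable {M : QuadGluing} (B : BoundaryData M)

/-- The contribution of one side, except for its end point. -/
def side (d : M.Dart) (u v : ℝ) : E3 :=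
  hermValue 0 v • herm (dropLast (B.y d)) (dropLast (B.m d)) u
    + hermSlope 0 v • herm (dropLast (B.w d)) (dropLast (B.w' d)) u

/-- The patches with the given boundary data. -/
def patch (q : M.Quad) (x y : ℝ) : E3 :=
  B.side (q, 0) x y + B.side (q, 1) y (1 - x) + B.side (q, 2) (1 - x) (1 - y)
    + B.side (q, 3) (1 - y) x

theorem localPatch_patch (d : M.Dart) (u v : ℝ) : localPatch B.patch d u v
    = B.side d u v + B.side (M.next d) v (1 - u)
      + B.side (M.next (M.next d)) (1 - u) (1 - v)
      + B.side (M.next (M.next (M.next d))) (1 - v) u := by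
  obtain ⟨q, i⟩ := d
  fin_cases i <;> simp [localPatch, QuadGluing.next, cornerChart, patch] <;> abel_nf

theorem isBicubicSpline_side (d : M.Dart) : IsBicubicSpline twoDoubleKnots (B.side d) :=
  ((smul_herm_mem (isCubicSpline_hermValue 0) _ _).swap).add
    ((smul_herm_mem (isCubicSpline_hermSlope 0) _ _).swap)

end BoundaryData

theorem IsBicubicSpline.reflect_left {p : ℝ → ℝ → E3} (hp : IsBicubicSpline twoDoubleKnots p) :
    IsBicubicSpline twoDoubleKnots (fun u v => p (1 - u) v) := by
  unfold IsBicubicSpline at hp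
  induction hp using Submodule.span_induction with
  | mem r hr =>
    obtain ⟨f, g, x, hf, hg, rfl⟩ := hr
    exact smul_mem_bicubic hf.reflect_twoDoubleKnots hg x
  | zero => exact Submodule.zero_mem _
  | add p q _ _ hp hq => exact hp.add hq
  | smul r p _ hp => exact hp.const_smul r

theorem BoundaryData.isBicubicSpline_patch {M : QuadGluing} (B : BoundaryData M) (q : M.Quad) :
    IsBicubicSpline twoDoubleKnots (B.patch q) := by
  have h1 := (B.isBicubicSpline_side (q, 1)).swap.reflect_left
  have h2 := (B.isBicubicSpline_side (q, 2)).reflect_left.swap.reflect_left.swap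
  have h3 := (B.isBicubicSpline_side (q, 3)).reflect_left.swap
  exact (((B.isBicubicSpline_side (q, 0)).add h1).add h2).add h3

theorem hermValue_reflect (u : ℝ) : hermValue 0 (1 - u) = hermValue 3 u := by
  rw [hermValue, hermValue, herm_reflect]
  congr 1
  · funext j; fin_cases j <;> rfl
  · funext j; simp

theorem hermSlope_reflect (u : ℝ) : hermSlope 0 (1 - u) = - hermSlope 3 u := by
  rw [hermSlope, hermSlope, herm_reflect, herm_eq_sum, herm_eq_sum (0 : Fin 4 → ℝ)]
  simp [Fin.sum_univ_four, Pi.single_apply, Fin.rev]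

theorem herm_dropLast (y m : Fin 4 → E3) (u : ℝ) :
    herm (dropLast y) (dropLast m) u + hermValue 3 u • y 3 + hermSlope 3 u • m 3 = herm y m u := by
  rw [herm_eq_sum, herm_eq_sum]
  simp [Fin.sum_univ_four, dropLast]
  abel

namespace BoundaryData

variable {M : QuadGluing} (B : BoundaryData M)

theorem hermValue_zero : hermValue 0 0 = 1 := by rw [hermValue, herm_zero]; simp

theorem hermSlope_zero : hermSlope 0 0 = 0 := by rw [hermSlope, herm_zero]; simp

theorem hermValue_one : hermValue 0 1 = 0 := by rw [hermValue, herm_one]; simp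

theorem hermSlope_one : hermSlope 0 1 = 0 := by rw [hermSlope, herm_one]; simp

/-- At `v = 0` the opposite side contributes nothing, and the two neighbouring sides contribute only
at corners: the next one supplies the last node that `dropLast` removed, the previous one vanishes
because its own last node was removed. Each corner is thus counted once. -/
theorem localPatch_edge (d : M.Dart) (u : ℝ) :
    localPatch B.patch d u 0 = herm (B.y d) (B.m d) u := by
  rw [B.localPatch_patch, ← herm_dropLast]
  simp only [side, hermValue_zero, hermSlope_zero, sub_zero, hermValue_one, hermSlope_one,
    herm_zero, herm_one, hermValue_reflect, hermSlope_reflect, B.y_three, B.m_three]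
  simp [dropLast]
  abel

theorem hasDerivAt_localPatch_cross (d : M.Dart) (u : ℝ) :
    HasDerivAt (fun v => localPatch B.patch d u v) (herm (B.w d) (B.w' d) u) 0 := by
  have hv0 : HasDerivAt (hermValue 0) 0 0 := by
    exact (hasDerivAt_herm _ _ _).congr_deriv (by simp [hermDeriv_zero])
  have hs0 : HasDerivAt (hermSlope 0) 1 0 := by
    exact (hasDerivAt_herm _ _ _).congr_deriv (by simp [hermDeriv_zero])
  have hv1 : HasDerivAt (fun v => hermValue 0 (1 - v)) 0 0 := by
    have h : HasDerivAt (hermValue 0) 0 (1 - 0) := by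
      exact (hasDerivAt_herm _ _ _).congr_deriv (by simp [hermDeriv_one])
    simpa using HasDerivAt.comp_const_sub 1 0 h
  have hs1 : HasDerivAt (fun v => hermSlope 0 (1 - v)) 0 0 := by
    have h : HasDerivAt (hermSlope 0) 0 (1 - 0) := by
      exact (hasDerivAt_herm _ _ _).congr_deriv (by simp [hermDeriv_one])
    simpa using HasDerivAt.comp_const_sub 1 0 h
  have hA : ∀ y m : Fin 4 → E3, HasDerivAt (herm (dropLast y) (dropLast m)) (m 0) 0 := fun y m => by
    simpa [hermDeriv_zero, dropLast] using hasDerivAt_herm (dropLast y) (dropLast m) 0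
  -- The data at the last node are zero, so a dropped interpolant is flat at its end.
  have hA1 : ∀ y m : Fin 4 → E3,
      HasDerivAt (fun v => herm (dropLast y) (dropLast m) (1 - v)) 0 0 := fun y m => by
    have h : HasDerivAt (herm (dropLast y) (dropLast m)) 0 (1 - 0) := by
      simpa [hermDeriv_one, dropLast] using hasDerivAt_herm (dropLast y) (dropLast m) 1
    simpa using HasDerivAt.comp_const_sub 1 0 h
  have e0 := (hv0.smul_const (herm (dropLast (B.y d)) (dropLast (B.m d)) u)).add
    (hs0.smul_const (herm (dropLast (B.w d)) (dropLast (B.w' d)) u))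
  have e1 := ((hA (B.y (M.next d)) (B.m (M.next d))).const_smul (hermValue 0 (1 - u))).add
    ((hA (B.w (M.next d)) (B.w' (M.next d))).const_smul (hermSlope 0 (1 - u)))
  set d' := M.next (M.next d)
  have e2 := (hv1.smul_const (herm (dropLast (B.y d')) (dropLast (B.m d')) (1 - u))).add
    (hs1.smul_const (herm (dropLast (B.w d')) (dropLast (B.w' d')) (1 - u)))
  have e3 := ((hA1 (B.y (M.next d')) (B.m (M.next d'))).const_smul (hermValue 0 u)).add
    ((hA1 (B.w (M.next d')) (B.w' (M.next d'))).const_smul (hermSlope 0 u))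
  have e := ((e0.add e1).add e2).add e3
  refine (e.congr_deriv ?_).congr_of_eventuallyEq (Filter.Eventually.of_forall fun v => ?_)
  · rw [← herm_dropLast (B.w d), hermValue_reflect, hermSlope_reflect, B.w_three, B.w'_three]
    simp
    abel
  · exact B.localPatch_patch d u v

theorem d2_localPatch (d : M.Dart) (u : ℝ) :
    d2 (localPatch B.patch d) u 0 = herm (B.w d) (B.w' d) u :=
  (B.hasDerivAt_localPatch_cross d u).deriv

theorem d1_localPatch (d : M.Dart) (u : ℝ) :
    d1 (localPatch B.patch d) u 0 = hermDeriv (B.y d) (B.m d) u := by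
  simp only [d1, B.localPatch_edge]
  exact (hasDerivAt_herm _ _ u).deriv

theorem d1_d1_localPatch (d : M.Dart) : d1 (d1 (localPatch B.patch d)) 0 0
    = (54 : ℝ) • (B.y d 1 - B.y d 0) - (12 : ℝ) • B.m d 0 - (6 : ℝ) • B.m d 1 := by
  rw [d1]
  simp only [B.d1_localPatch]
  exact (hasDerivAt_hermDeriv_zero _ _).deriv

theorem d1_d2_localPatch (d : M.Dart) : d1 (d2 (localPatch B.patch d)) 0 0 = B.w' d 0 := by
  rw [d1]
  simp only [B.d2_localPatch]
  rw [(hasDerivAt_herm _ _ _).deriv, hermDeriv_zero]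

end BoundaryData

/-- The derivatives of a patch at boundary points in terms of the local patches. -/
theorem regularAtEdgeKnots_of_local {M : QuadGluing} {S : M.Quad → ℝ → ℝ → E3}
    (h : ∀ d : M.Dart, ∀ t ∈ twoDoubleKnots,
      LinearIndependent ℝ ![d1 (localPatch S d) t 0, d2 (localPatch S d) t 0]) :
    RegularAtEdgeKnots twoDoubleKnots S := by
  have hsub : ∀ t ∈ twoDoubleKnots, 1 - t ∈ twoDoubleKnots := by
    intro t ht
    rw [mem_twoDoubleKnots] at *
    rcases ht with rfl | rfl
    · right; norm_num
    · left; norm_num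
  intro q t ht z hz
  simp only [Set.mem_insert_iff, Set.mem_singleton_iff] at hz
  rcases hz with rfl | rfl | rfl | rfl
  · exact h (q, 0) t ht
  · have := h (q, 1) t ht
    have e1 : d1 (localPatch S (q, 1)) t 0 = d2 (S q) 1 t := by
      simp [d1, d2, localPatch, cornerChart]
    have e2 : d2 (localPatch S (q, 1)) t 0 = - d1 (S q) 1 t := by
      have := deriv_comp_const_sub (f := fun x => S q x t) 1 0
      simpa [d1, d2, localPatch, cornerChart] using this
    rw [e1, e2] at this
    rw [LinearIndependent.pair_iff] at this ⊢
    intro a b hab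
    have := this b (-a) (by rw [← hab]; module)
    exact ⟨by simpa using this.2, this.1⟩
  · have := h (q, 2) (1 - t) (hsub t ht)
    have e1 : d1 (localPatch S (q, 2)) (1 - t) 0 = - d1 (S q) t 1 := by
      have := deriv_comp_const_sub (f := fun x => S q x 1) 1 (1 - t)
      simpa [d1, d2, localPatch, cornerChart] using this
    have e2 : d2 (localPatch S (q, 2)) (1 - t) 0 = - d2 (S q) t 1 := by
      have := deriv_comp_const_sub (f := fun y => S q t y) 1 0
      simpa [d1, d2, localPatch, cornerChart] using this
    rw [e1, e2] at this
    rw [LinearIndependent.pair_iff] at this ⊢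
    intro a b hab
    have := this (-a) (-b) (by rw [← hab]; module)
    exact ⟨by simpa using this.1, by simpa using this.2⟩
  · have := h (q, 3) (1 - t) (hsub t ht)
    have e1 : d1 (localPatch S (q, 3)) (1 - t) 0 = - d2 (S q) 0 t := by
      have := deriv_comp_const_sub (f := fun y => S q 0 y) 1 (1 - t)
      simpa [d1, d2, localPatch, cornerChart] using this
    have e2 : d2 (localPatch S (q, 3)) (1 - t) 0 = d1 (S q) 0 t := by
      simp [d1, d2, localPatch, cornerChart]
    rw [e1, e2] at this
    rw [LinearIndependent.pair_iff] at this ⊢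
    intro a b hab
    have := this (-b) a (by rw [← hab]; module)
    exact ⟨this.2, by simpa using this.1⟩

/-! ### Frames at the vertices -/

/-- Each dart is a power `k` of the rotation applied to a representative of its cycle, and `ζ ^ k`
is its phase. Another exponent differs by a multiple of the valence, and `ζ` is a root of unity of
that order. -/
theorem QuadGluing.exists_phase (M : QuadGluing) (hM : ∀ d, 3 ≤ M.valence d) :
    ∃ ω : M.Dart → ℂ, (∀ d, ω d ≠ 0) ∧ ∀ d, ω (M.rot d)
      = ω d * Complex.exp ((2 * Real.pi / M.valence d : ℝ) * Complex.I) := by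
  let st := Equiv.Perm.SameCycle.setoid M.rot
  let rep : M.Dart → M.Dart := fun d => (Quotient.mk st d).out
  have hrep : ∀ d, M.rot.SameCycle (rep d) d := fun d =>
    Quotient.exact (Quotient.out_eq (Quotient.mk st d))
  have hrot : ∀ d, rep (M.rot d) = rep d := fun d => by
    have : Quotient.mk st (M.rot d) = Quotient.mk st d :=
      Quotient.sound (Equiv.Perm.SameCycle.symm ⟨1, by simp⟩)
    simp only [rep, this]
  choose k hk using hrep
  let ζ : M.Dart → ℂ := fun d => Complex.exp ((2 * Real.pi / M.valence d : ℝ) * Complex.I)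
  have hζ : ∀ d, ζ d ^ M.valence d = 1 := fun d => by
    have h0 : (M.valence d : ℂ) ≠ 0 := by
      have := hM d
      exact_mod_cast (show M.valence d ≠ 0 by omega)
    rw [← Complex.exp_nat_mul, ← Complex.exp_two_pi_mul_I]
    congr 1
    push_cast
    field_simp
  have hne : ∀ d, ζ d ≠ 0 := fun d => Complex.exp_ne_zero _
  refine ⟨fun d => ζ d ^ k d, fun d => zpow_ne_zero _ (hne d), fun d => ?_⟩
  have hval : ζ (M.rot d) = ζ d := by simp only [ζ, QuadGluing.valence_rot]
  change ζ (M.rot d) ^ k (M.rot d) = ζ d ^ k d * ζ d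
  rw [hval, ← zpow_add_one₀ (hne d)]
  have h1 : (M.rot ^ k (M.rot d)) (rep d) = M.rot ((M.rot ^ k d) (rep d)) := by
    have := hk (M.rot d)
    rw [hrot] at this
    rw [this, hk]
  -- The chosen exponent of the next dart need not be `k d + 1`; the difference of the two fixes the
  -- representative.
  have h2 : (M.rot ^ (k (M.rot d) - (k d + 1))) • rep d = rep d := by
    rw [sub_eq_neg_add, zpow_add, Equiv.Perm.smul_def, Equiv.Perm.mul_apply, h1, zpow_neg,
      Equiv.Perm.inv_eq_iff_eq, add_comm, zpow_add, zpow_one, Equiv.Perm.mul_apply]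
  rw [MulAction.zpow_smul_eq_iff_minimalPeriod_dvd] at h2
  have hv : Function.minimalPeriod (fun x => M.rot • x) (rep d) = M.valence d := by
    change M.valence (rep d) = M.valence d
    have : ∀ j : ℤ, M.valence ((M.rot ^ j) (rep d)) = M.valence (rep d) := by
      intro j
      induction j using Int.induction_on with
      | zero => simp
      | succ j ih => rw [add_comm, zpow_add, zpow_one, Equiv.Perm.mul_apply,
          QuadGluing.valence_rot, ih]
      | pred j ih =>
        rw [sub_eq_add_neg, add_comm, zpow_add, zpow_neg, zpow_one, Equiv.Perm.mul_apply]
        exact (QuadGluing.valence_rot_symm _).trans ih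
    rw [← this (k d), hk]
  rw [hv] at h2
  obtain ⟨c, hc⟩ := h2
  rw [show k (M.rot d) = (k d + 1) + M.valence d * c by linarith, zpow_add₀ (hne d), zpow_mul,
    zpow_natCast, hζ, one_zpow, mul_one]

/-- Two neighbouring phases add up to `2 cos (2π / n)` times the middle one, and every real-linear
image of the phases inherits this. The factor `ν ≠ 0` keeps consecutive tangents independent in the
horizontal projection, while `ρ` tilts the tangent plane freely. -/
theorem isUnbiasedFrame_of_phase {M : QuadGluing} (hM : ∀ d, 3 ≤ M.valence d) {ω : M.Dart → ℂ}
    (h0 : ∀ d, ω d ≠ 0) (hω : ∀ d, ω (M.rot d)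
      = ω d * Complex.exp ((2 * Real.pi / M.valence d : ℝ) * Complex.I))
    {pos : M.Dart → E3} (hpos : ∀ d, pos (M.rot d) = pos d) {ν ρ : M.Dart → ℂ}
    (hν0 : ∀ d, ν d ≠ 0) (hν : ∀ d, ν (M.rot d) = ν d) (hρ : ∀ d, ρ (M.rot d) = ρ d) :
    IsUnbiasedFrame M pos
      (fun d => !₂[(ν d * ω d).re, (ν d * ω d).im, (ρ d * ω d).re]) := by
  have hexp : ∀ x : ℝ, Complex.exp (x * Complex.I) = ⟨Real.cos x, Real.sin x⟩ := fun x => by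
    apply Complex.ext
    · exact Complex.exp_ofReal_mul_I_re x
    · exact Complex.exp_ofReal_mul_I_im x
  refine ⟨hpos, fun d => ?_, fun d => ?_⟩
  · set x := 2 * Real.pi / M.valence d with hx
    have hsin : Real.sin x ≠ 0 := by
      have h3 : (3 : ℝ) ≤ M.valence d := by exact_mod_cast hM d
      have := Real.pi_pos
      refine (Real.sin_pos_of_pos_of_lt_pi (by positivity) ?_).ne'
      rw [hx, div_lt_iff₀ (by linarith)]
      nlinarith
    rw [LinearIndependent.pair_iff]
    intro s t h
    have e0 := congrFun (congrArg WithLp.ofLp h) 0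
    have e1 := congrFun (congrArg WithLp.ofLp h) 1
    simp only [hω, hν] at e0 e1
    rw [← hx, hexp] at e0 e1
    have e : (ν d * ω d) * (⟨s + t * Real.cos x, t * Real.sin x⟩ : ℂ) = 0 := by
      apply Complex.ext
      · simp at e0 ⊢; linear_combination e0
      · simp at e1 ⊢; linear_combination e1
    have e2 := (mul_eq_zero.1 e).resolve_left (mul_ne_zero (hν0 d) (h0 d))
    have e3 := congrArg Complex.im e2
    have e4 := congrArg Complex.re e2
    simp only [Complex.zero_im, Complex.zero_re] at e3 e4
    have ht : t = 0 := (mul_eq_zero.1 e3).resolve_right hsin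
    exact ⟨by simpa [ht] using e4, ht⟩
  · have hs : ω (M.rot.symm d) = ω d
        * Complex.exp (-((2 * Real.pi / M.valence d : ℝ) * Complex.I)) := by
      have := hω (M.rot.symm d)
      rw [Equiv.apply_symm_apply, QuadGluing.valence_rot_symm] at this
      rw [this, mul_assoc, ← Complex.exp_add]
      simp
    have hν' : ν (M.rot.symm d) = ν d := by rw [← hν, Equiv.apply_symm_apply]
    have hρ' : ρ (M.rot.symm d) = ρ d := by rw [← hρ, Equiv.apply_symm_apply]
    have key : ω (M.rot d) + ω (M.rot.symm d) = (unbiasedValue M d : ℝ) * ω d := by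
      have e2 : Complex.exp (-((2 * Real.pi / M.valence d : ℝ) * Complex.I))
          = Complex.exp (((-(2 * Real.pi / M.valence d) : ℝ) : ℂ) * Complex.I) := by
        congr 1; push_cast; ring
      rw [hω, hs, e2, hexp, hexp, unbiasedValue, Real.cos_neg, Real.sin_neg]
      generalize Real.cos _ = c
      generalize Real.sin _ = s
      apply Complex.ext <;> simp <;> ring
    have keyν : ν d * ω (M.rot d) + ν d * ω (M.rot.symm d)
        = (unbiasedValue M d : ℝ) * (ν d * ω d) := by
      linear_combination ν d * key
    have keyρ : ρ d * ω (M.rot d) + ρ d * ω (M.rot.symm d)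
        = (unbiasedValue M d : ℝ) * (ρ d * ω d) := by
      linear_combination ρ d * key
    ext i
    fin_cases i
    · simpa [hν, hν'] using congrArg Complex.re keyν
    · simpa [hν, hν'] using congrArg Complex.im keyν
    · simpa [hρ, hρ'] using congrArg Complex.re keyρ

/-! ### The construction -/

/-- The scalar functions on a mesh. -/
def meshScalar (M : QuadGluing) (d : M.Dart) : ℝ → ℝ :=
  edgeScalar (M.valence d) (M.valence (M.opp d))

/-- End data of the boundary curve along a dart. -/
def dartEnds {M : QuadGluing} (X : VertexData M) (d : M.Dart) : Ends :=
  ⟨X.pos d, X.tangent d, X.second d, X.pos (M.opp d), -X.tangent (M.opp d), X.second (M.opp d)⟩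

theorem dartEnds_opp {M : QuadGluing} (X : VertexData M) (d : M.Dart) :
    dartEnds X (M.opp d) = (dartEnds X d).rev := by
  simp [dartEnds, Ends.rev, M.opp_opp]

/-- Derivatives at the nodes of the boundary curve along a dart. -/
def dartSlopes {M : QuadGluing} (X : VertexData M) (d : M.Dart) : Fin 4 → E3 :=
  (dartEnds X d).slopeNodes (M.valence d) (M.valence (M.opp d))

/-- Values at the nodes of the boundary curve along a dart. -/
def dartValues {M : QuadGluing} (X : VertexData M) (d : M.Dart) : Fin 4 → E3 :=
  (dartEnds X d).valueNodes (M.valence d) (M.valence (M.opp d))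

/-- Derivatives at the nodes of the sum of the cross-boundary derivatives along a dart. -/
def dartProducts {M : QuadGluing} (X : VertexData M) (d : M.Dart) : Fin 4 → E3 :=
  (dartEnds X d).productNodes (M.valence d) (M.valence (M.opp d))

section

variable {M : QuadGluing} (X : VertexData M)

theorem dartSlopes_opp (d : M.Dart) (j : Fin 4) :
    dartSlopes X (M.opp d) j = - dartSlopes X d j.rev := by
  rw [dartSlopes, dartEnds_opp, M.opp_opp, Ends.slopeNodes_rev]; rfl

theorem dartValues_opp (d : M.Dart) (j : Fin 4) :
    dartValues X (M.opp d) j = dartValues X d j.rev := by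
  rw [dartValues, dartEnds_opp, M.opp_opp, Ends.valueNodes_rev]; rfl

theorem dartProducts_opp (d : M.Dart) (j : Fin 4) :
    dartProducts X (M.opp d) j = - dartProducts X d j.rev := by
  rw [dartProducts, dartEnds_opp, M.opp_opp, Ends.productNodes_rev]; rfl

/-- Cross-boundary derivatives at the nodes. -/
def dartCross (d : M.Dart) : Fin 4 → E3 :=
  ![X.tangent (M.rot d),
    (meshScalar M d (1 / 3) / 2) • dartSlopes X d 1 + turn (dartSlopes X d 1),
    (meshScalar M d (2 / 3) / 2) • dartSlopes X d 2 + turn (dartSlopes X d 2),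
    X.tangent (M.next d)]

/-- Twists at the nodes. -/
def dartTwist (d : M.Dart) : Fin 4 → E3 :=
  ![X.mixed d, (1 / 2 : ℝ) • dartProducts X d 1, (1 / 2 : ℝ) • dartProducts X d 2,
    -X.mixed (M.next d)]

/-- The boundary data of the construction. -/
def boundaryData (hX : IsUnbiasedFrame M X.pos X.tangent) : BoundaryData M where
  y := dartValues X
  m := dartSlopes X
  w := dartCross X
  w' := dartTwist X
  y_three d := by
    change X.pos (M.opp d) = X.pos (M.next d)
    rw [← M.rot_next, hX.pos_rot]
  m_three d := by
    change - X.tangent (M.opp d) = - X.tangent (M.rot (M.next d))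
    rw [M.rot_next]
  w_three d := rfl
  w'_three d := rfl

variable {X}

/-- By `Ends.product_eq` both sides of the constraint are Hermite interpolants, so comparing nodal
data suffices. At the end nodes this is admissibility of the vertex data; at the inner nodes the two
halves add up and the `turn` terms cancel. -/
theorem isSplineSurface_patch (hX : IsAdmissible (meshScalar M) X) :
    IsSplineSurface twoDoubleKnots (meshScalar M) (boundaryData X hX.frame).patch := by
  set B := boundaryData X hX.frame with hB
  refine ⟨B.isBicubicSpline_patch, fun d u _ => ?_, fun d u _ => ?_⟩
  · rw [QuadGluing.rot_symm, localPatch_next, B.localPatch_edge, B.localPatch_edge, herm_reflect]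
    congr 1
    · funext j
      change dartValues X d j = dartValues X (M.opp d) j.rev
      rw [dartValues_opp, Fin.rev_rev]
    · funext j
      change dartSlopes X d j = - dartSlopes X (M.opp d) j.rev
      rw [dartSlopes_opp, Fin.rev_rev, neg_neg]
  · rw [d1_localPatch_rot_symm, B.d1_localPatch, B.d2_localPatch, B.d2_localPatch, herm_reflect,
      ← herm_add]
    have key := (dartEnds X d).product_eq (M.valence d) (M.valence (M.opp d)) u
    refine Eq.trans ?_ key.symm
    have hfirst := hX.frame.tangent_rot
    have hmixed := hX.mixed_rot
    have huv : ∀ d, unbiasedValue M d = cosValue (M.valence d) := fun d => rfl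
    have hsc : ∀ j : Fin 4, edgeScalar (M.valence (M.opp d)) (M.valence d) ((j.rev : ℝ) / 3)
        = - edgeScalar (M.valence d) (M.valence (M.opp d)) ((j : ℝ) / 3) := by
      intro j
      rw [edgeScalar_reflect (M.valence d)]
      congr 2
      fin_cases j <;> norm_num [Fin.rev]
    have hsc1 : meshScalar M (M.opp d) (2 / 3) = - meshScalar M d (1 / 3) := by
      simp only [meshScalar, M.opp_opp, Ends.edgeScalar_two_thirds]
    have hsc2 : meshScalar M (M.opp d) (1 / 3) = - meshScalar M d (2 / 3) := by
      have := Ends.edgeScalar_two_thirds (M.valence (M.opp d)) (M.valence d)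
      simp only [meshScalar, M.opp_opp, this, neg_neg]
    have s1 : dartSlopes X (M.opp d) 2 = - dartSlopes X d 1 := dartSlopes_opp X d 2
    have s2 : dartSlopes X (M.opp d) 1 = - dartSlopes X d 2 := dartSlopes_opp X d 1
    have p1 : dartProducts X (M.opp d) 2 = - dartProducts X d 1 := dartProducts_opp X d 2
    have p2 : dartProducts X (M.opp d) 1 = - dartProducts X d 2 := dartProducts_opp X d 1
    congr 1
    · funext j
      fin_cases j
      · change X.tangent (M.rot d) + X.tangent (M.next (M.opp d))
          = edgeScalar _ _ (((0 : Fin 4) : ℝ) / 3) • X.tangent d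
        have := hfirst d
        rw [QuadGluing.rot_symm, huv] at this
        rw [this]
        norm_num [edgeScalar_zero]
      · change ((meshScalar M d (1 / 3) / 2) • dartSlopes X d 1 + turn (dartSlopes X d 1))
          + ((meshScalar M (M.opp d) (2 / 3) / 2) • dartSlopes X (M.opp d) 2
            + turn (dartSlopes X (M.opp d) 2))
          = edgeScalar _ _ (((1 : Fin 4) : ℝ) / 3) • dartSlopes X d 1
        rw [s1, hsc1, turn_neg, show ((1 : Fin 4) : ℝ) / 3 = 1 / 3 by norm_num, meshScalar]
        module
      · change ((meshScalar M d (2 / 3) / 2) • dartSlopes X d 2 + turn (dartSlopes X d 2))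
          + ((meshScalar M (M.opp d) (1 / 3) / 2) • dartSlopes X (M.opp d) 1
            + turn (dartSlopes X (M.opp d) 1))
          = edgeScalar _ _ (((2 : Fin 4) : ℝ) / 3) • dartSlopes X d 2
        rw [s2, hsc2, turn_neg, show ((2 : Fin 4) : ℝ) / 3 = 2 / 3 by norm_num, meshScalar]
        module
      · change X.tangent (M.next d) + X.tangent (M.rot (M.opp d))
          = edgeScalar _ _ (((3 : Fin 4) : ℝ) / 3) • (-X.tangent (M.opp d))
        have := hfirst (M.opp d)
        rw [QuadGluing.rot_symm_opp, huv] at this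
        rw [add_comm, this, show ((3 : Fin 4) : ℝ) / 3 = 1 by
          rw [show ((3 : Fin 4) : ℕ) = 3 from rfl]; norm_num,
          edgeScalar_reflect (M.valence (M.opp d)), sub_self, edgeScalar_zero]
        module
    · funext j
      fin_cases j
      · change X.mixed d + -(-X.mixed (M.next (M.opp d)))
          = cosValue (M.valence d) • X.second d
            + edgeScalarSlope (M.valence d) (M.valence (M.opp d)) • X.tangent d
        have := hmixed d
        rw [QuadGluing.rot_symm, huv, meshScalar, derivWithin_edgeScalar] at this
        rw [neg_neg, this]
      · change (1 / 2 : ℝ) • dartProducts X d 1 + -((1 / 2 : ℝ) • dartProducts X (M.opp d) 2)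
          = dartProducts X d 1
        rw [p1]; module
      · change (1 / 2 : ℝ) • dartProducts X d 2 + -((1 / 2 : ℝ) • dartProducts X (M.opp d) 1)
          = dartProducts X d 2
        rw [p2]; module
      · change -X.mixed (M.next d) + -(X.mixed (M.opp d))
          = edgeScalarSlope (M.valence (M.opp d)) (M.valence d) • (-X.tangent (M.opp d))
            - cosValue (M.valence (M.opp d)) • X.second (M.opp d)
        have := hmixed (M.opp d)
        rw [QuadGluing.rot_symm_opp, huv, meshScalar, derivWithin_edgeScalar, M.opp_opp] at this
        rw [← neg_add, add_comm, this]
        module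

theorem interpolates_patch (hX : IsUnbiasedFrame M X.pos X.tangent) :
    Interpolates (boundaryData X hX).patch X := by
  set B := boundaryData X hX with hB
  intro d
  refine ⟨?_, ?_, ?_, ?_⟩
  · rw [B.localPatch_edge, herm_zero]; rfl
  · rw [B.d1_localPatch, hermDeriv_zero]; rfl
  · rw [B.d1_d1_localPatch]
    change (54 : ℝ) • (X.pos d + (1 / 54 : ℝ) • (X.second d + (12 : ℝ) • X.tangent d
      + (6 : ℝ) • dartSlopes X d 1) - X.pos d) - (12 : ℝ) • X.tangent d
      - (6 : ℝ) • dartSlopes X d 1 = X.second d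
    module
  · rw [B.d1_d2_localPatch]; rfl

theorem edgeCurve_patch (hX : IsUnbiasedFrame M X.pos X.tangent) (d : M.Dart) :
    edgeCurve (boundaryData X hX).patch d = herm (dartValues X d) (dartSlopes X d) :=
  funext fun u => (boundaryData X hX).localPatch_edge d u

theorem regular_patch (hX : IsUnbiasedFrame M X.pos X.tangent)
    (h1 : ∀ d, dartSlopes X d 1 ≠ 0) (h2 : ∀ d, dartSlopes X d 2 ≠ 0) :
    RegularAtEdgeKnots twoDoubleKnots (boundaryData X hX).patch := by
  refine regularAtEdgeKnots_of_local fun d t ht => ?_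
  rw [BoundaryData.d1_localPatch, BoundaryData.d2_localPatch]
  rcases mem_twoDoubleKnots.1 ht with rfl | rfl
  · rw [hermDeriv_third, herm_mid _ _ le_rfl (by norm_num), piece_start]
    exact linearIndependent_turn (h1 d) _
  · rw [hermDeriv_two_thirds, herm_right _ _ le_rfl, piece_start]
    exact linearIndependent_turn (h2 d) _

end

theorem linearIndependent_of_coord {x y : E3} (i : Fin 3) (hx : x ≠ 0) (hxi : x i = 0)
    (hyi : y i ≠ 0) : LinearIndependent ℝ ![x, y] := by
  rw [LinearIndependent.pair_iff]
  intro s t h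
  have hi := congrFun (congrArg WithLp.ofLp h) i
  simp [hxi, hyi] at hi
  subst hi
  simpa [hx] using h

/-- There are finitely many vertices, so they can be numbered; since no edge is a loop, its two ends
get different numbers. -/
theorem QuadMesh.exists_index (M : QuadMesh) :
    ∃ idx : M.Dart → ℝ, (∀ d, idx (M.rot d) = idx d) ∧ ∀ d, idx (M.opp d) ≠ idx d := by
  have := M.finite_quad
  let st := Equiv.Perm.SameCycle.setoid M.rot
  obtain ⟨f, hf⟩ := exists_injective_nat (Quotient st)
  refine ⟨fun d => f (Quotient.mk st d), fun d => ?_, fun d h => ?_⟩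
  · have : Quotient.mk st (M.rot d) = Quotient.mk st d :=
      Quotient.sound (Equiv.Perm.SameCycle.symm ⟨1, by simp⟩)
    simp only [this]
  · have h1 : Quotient.mk st (M.opp d) = Quotient.mk st d := hf (Nat.cast_injective (R := ℝ) h)
    exact M.loopless d (Quotient.exact h1.symm)

theorem succeeds_twoDoubleKnots (M : QuadMesh) :
    Succeeds twoDoubleKnots M.toQuadGluing (meshScalar M.toQuadGluing) := by
  have hfin := M.finite_quad
  have hval := M.three_le_valence
  have huv : ∀ d, unbiasedValue M.toQuadGluing d = cosValue (M.valence d) := fun d => rfl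
  have hder : ∀ d, derivWithin (meshScalar M.toQuadGluing d) (Set.Icc 0 1) 0
      = edgeScalarSlope (M.valence d) (M.valence (M.opp d)) := fun d => derivWithin_edgeScalar _ _
  -- At valence four the divisor is zero and the quotient is zero by convention, which is right
  -- because the slope vanishes there too.
  have hcancel : ∀ d : M.Dart, cosValue (M.valence d) *
      (edgeScalarSlope (M.valence d) (M.valence (M.opp d)) / cosValue (M.valence d))
        = edgeScalarSlope (M.valence d) (M.valence (M.opp d)) := fun d => by
    by_cases h4 : M.valence d = 4
    · rw [h4, edgeScalarSlope_four]; simp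
    · exact mul_div_cancel₀ _ (cosValue_ne_zero (hval d) h4)
  have hrealize : ∀ X : VertexData M.toQuadGluing, ∀ hX : IsAdmissible (meshScalar _) X,
      IsSplineSurface twoDoubleKnots (meshScalar _) (boundaryData X hX.frame).patch ∧
        Interpolates (boundaryData X hX.frame).patch X :=
    fun X hX => ⟨isSplineSurface_patch hX, interpolates_patch hX.frame⟩
  refine ⟨⟨fun d => edgeScalar_zero _ _, fun d u _ => ?_, fun d =>
    (hasDerivWithinAt_edgeScalar _ _).differentiableWithinAt⟩, ?_, ?_, ?_, ?_⟩
  · simp only [meshScalar, M.opp_opp]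
    exact edgeScalar_reflect _ _ _
  · intro pos tangent hframe
    -- A tangential second derivative that cancels the term with `α'(0)`, so that zero twists are
    -- admissible.
    refine ⟨fun d => (-(edgeScalarSlope (M.valence d) (M.valence (M.opp d))
      / cosValue (M.valence d))) • tangent d, fun _ => 0, hframe, fun d => ?_⟩
    rw [hder, huv, smul_smul, mul_neg, hcancel]
    module
  · exact fun X hX => ⟨_, hrealize X hX⟩
  · intro X hX d
    obtain ⟨γ, hγ, hshift⟩ := Ends.slopes_shift (M.valence d) (M.valence (M.opp d))
    classical
    -- Displacement of the far vertex that makes the first inner slope equal to `turn (X.tangent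
    -- d)`, hence independent of the tangent at the start.
    set δ : E3 := γ⁻¹ • (turn (X.tangent d) - dartSlopes X d 1) with hδ
    have hrotiff : ∀ e, M.SameVertex (M.opp d) (M.rot e) ↔ M.SameVertex (M.opp d) e := fun e =>
      Equiv.Perm.sameCycle_apply_right
    set Y : VertexData M.toQuadGluing :=
      ⟨fun e => if M.SameVertex (M.opp d) e then X.pos e + δ else X.pos e,
        X.tangent, X.second, X.mixed⟩ with hY
    have hYa : IsAdmissible (meshScalar M.toQuadGluing) Y := by
      refine ⟨⟨fun e => ?_, hX.frame.regular, hX.frame.tangent_rot⟩, hX.mixed_rot⟩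
      simp only [hY, hrotiff, hX.frame.pos_rot]
    have hdd : ¬ M.SameVertex (M.opp d) d := fun h => M.loopless d h.symm
    refine ⟨Y, _, hYa, fun e he => ⟨?_, rfl, rfl, rfl⟩, (hrealize Y hYa).1, (hrealize Y hYa).2,
      fun b hb _ => ?_⟩
    · have : ¬ M.SameVertex (M.opp d) e := fun h => hdd (h.trans he.symm)
      simp only [hY, if_neg this]
    · rw [edgeCurve_patch]
      refine not_collinear_herm_start ?_ hb
      have hne : X.tangent d ≠ 0 := (hX.frame.regular d).ne_zero 0
      have h1 : dartSlopes Y d 1 = turn (X.tangent d) := by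
        have e1 : Y.pos d = X.pos d := if_neg hdd
        have e2 : Y.pos (M.opp d) = X.pos (M.opp d) + δ := if_pos (Equiv.Perm.SameCycle.refl _ _)
        change (Ends.slopes _ _ ⟨Y.pos d, X.tangent d, X.second d, Y.pos (M.opp d),
          -X.tangent (M.opp d), X.second (M.opp d)⟩).1 = _
        rw [e1, e2, hshift, hδ, smul_smul, mul_inv_cancel₀ hγ, one_smul]
        change dartSlopes X d 1 + _ = _
        abel
      have h0 : dartSlopes Y d 0 = X.tangent d := rfl
      rw [h0, h1]
      have := linearIndependent_turn hne 0
      rwa [zero_smul, zero_add] at this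
  · obtain ⟨ω, hω0, hω⟩ := M.exists_phase hval
    obtain ⟨idx, hidx, hne⟩ := M.exists_index
    have hframe := fun (pos : M.Dart → E3) (hpos : ∀ d, pos (M.rot d) = pos d) =>
      isUnbiasedFrame_of_phase hval hω0 hω hpos (ν := fun _ => 1) (ρ := fun _ => 0)
        (fun _ => one_ne_zero) (fun _ => rfl) (fun _ => rfl)
    set tangent : M.Dart → E3 :=
      fun d => !₂[((1 : ℂ) * ω d).re, ((1 : ℂ) * ω d).im, ((0 : ℂ) * ω d).re]
    have ht2 : ∀ d, tangent d 2 = 0 := fun d => by simp [tangent]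
    -- All tangents are horizontal; a unit vertical second derivative is added at each vertex, so
    -- that the inner slopes leave the horizontal plane.
    set second : M.Dart → E3 := fun d =>
      (-(edgeScalarSlope (M.valence d) (M.valence (M.opp d)) / cosValue (M.valence d)))
        • tangent d + !₂[0, 0, 1] with hsecond
    have hs2 : ∀ d, second d 2 = 1 := fun d => by simp [hsecond, ht2]
    set mixed : M.Dart → E3 := fun d => (cosValue (M.valence d) / 2) • !₂[0, 0, 1] with hmixed
    choose γ hγ hsum using fun d : M.Dart =>
      Ends.slopes_sum_shift (M.valence d) (M.valence (M.opp d))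
    set F : M.Dart → E3 := fun d =>
      (Ends.slopes (M.valence d) (M.valence (M.opp d))
        ⟨0, tangent d, second d, 0, -tangent (M.opp d), second (M.opp d)⟩).1
      + (Ends.slopes (M.valence d) (M.valence (M.opp d))
        ⟨0, tangent d, second d, 0, -tangent (M.opp d), second (M.opp d)⟩).2 with hF
    -- The vertical parts of the inner slopes are opposite, so their independence only needs a sum
    -- with nonzero first coordinate. Each dart excludes a single scale `R`.
    obtain ⟨R, hR⟩ : ∃ R : ℝ, ∀ d : M.Dart, F d 0 + γ d * (R * idx (M.opp d) - R * idx d) ≠ 0 := by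
      have hf : (Set.range fun d : M.Dart => -F d 0 / (γ d * (idx (M.opp d) - idx d))).Finite :=
        Set.finite_range _
      obtain ⟨R, hR⟩ := hf.exists_notMem
      refine ⟨R, fun d h => hR ⟨d, ?_⟩⟩
      have : γ d * (idx (M.opp d) - idx d) ≠ 0 := mul_ne_zero (hγ d) (sub_ne_zero.2 (hne d))
      rw [div_eq_iff this]
      linear_combination -h
    set X : VertexData M.toQuadGluing := ⟨fun d => (R * idx d) • !₂[1, 0, 0], tangent, second, mixed⟩
      with hXdef
    have hX : IsAdmissible (meshScalar M.toQuadGluing) X := by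
      refine ⟨hframe _ fun d => by simp only [hXdef, hidx], fun d => ?_⟩
      change mixed d + mixed (M.rot.symm d)
        = cosValue (M.valence d) • second d + derivWithin _ _ _ • tangent d
      rw [hder, hmixed, hsecond, smul_add, smul_smul, mul_neg, hcancel]
      simp only [QuadGluing.valence_rot_symm]
      module
    have hvert : ∀ d, dartSlopes X d 1 2 ≠ 0 ∧ dartSlopes X d 2 2 = - dartSlopes X d 1 2 := fun d =>
      Ends.slopes_vertical _ _ (dartEnds X d) 2 (by simp [dartEnds, hXdef])
        (by simp [dartEnds, hXdef]) (ht2 d) (by simp [dartEnds, hXdef, ht2]) (hs2 d) (hs2 _)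
    have htne : ∀ d, tangent d ≠ 0 := fun d => (hX.frame.regular d).ne_zero 0
    have hsumne : ∀ d, dartSlopes X d 1 0 + dartSlopes X d 2 0 ≠ 0 := fun d => by
      have := congrFun (congrArg WithLp.ofLp (hsum d (X.pos d) (tangent d) (second d)
        (X.pos (M.opp d)) (-tangent (M.opp d)) (second (M.opp d)))) 0
      have e : dartSlopes X d 1 0 + dartSlopes X d 2 0
          = F d 0 + γ d * (R * idx (M.opp d) - R * idx d) := by
        refine Eq.trans this ?_
        simp [hF, hXdef]
      rw [e]
      exact hR d
    have h10 : ∀ d, dartSlopes X d 1 ≠ 0 := fun d h => (hvert d).1 (by rw [h]; rfl)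
    have h20 : ∀ d, dartSlopes X d 2 ≠ 0 := fun d h => (hvert d).1 (by
      have := (hvert d).2
      rw [h] at this
      simpa using this.symm)
    have hl0 : ∀ d, LinearIndependent ℝ ![dartSlopes X d 0, dartSlopes X d 1] := fun d =>
      linearIndependent_of_coord 2 (htne d) (ht2 d) (hvert d).1
    have hl1 : ∀ d, LinearIndependent ℝ ![dartSlopes X d 1, dartSlopes X d 2] := fun d => by
      rw [LinearIndependent.pair_iff]
      intro s t h
      have e2 := congrFun (congrArg WithLp.ofLp h) 2
      have e0 := congrFun (congrArg WithLp.ofLp h) 0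
      simp [(hvert d).2] at e0 e2
      have hst : (s - t) * dartSlopes X d 1 2 = 0 := by linear_combination e2
      have hst' : s = t := by
        rcases mul_eq_zero.1 hst with h | h
        · linarith
        · exact absurd h (hvert d).1
      subst hst'
      have : s * (dartSlopes X d 1 0 + dartSlopes X d 2 0) = 0 := by linear_combination e0
      have := (mul_eq_zero.1 this).resolve_right (hsumne d)
      exact ⟨this, this⟩
    have hl2 : ∀ d, LinearIndependent ℝ ![dartSlopes X d 2, dartSlopes X d 3] := fun d => by
      have h3 : dartSlopes X d 3 = - tangent (M.opp d) := rfl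
      have := linearIndependent_of_coord (x := dartSlopes X d 3) (y := dartSlopes X d 2) 2
        (by rw [h3]; exact neg_ne_zero.2 (htne _)) (by rw [h3]; simp [ht2])
        (by rw [(hvert d).2]; exact neg_ne_zero.2 (hvert d).1)
      rw [LinearIndependent.pair_iff] at this ⊢
      intro s t h
      exact (this t s (by rw [add_comm, h])).symm
    refine ⟨X, _, hX, (hrealize X hX).1, (hrealize X hX).2, regular_patch hX.frame h10 h20,
      fun d a b _ hab _ => ?_⟩
    rw [edgeCurve_patch]
    exact not_collinear_herm (hl0 d) (hl1 d) (hl2 d) hab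

/-! ### Splines near a point -/

theorem exists_gap (K : Multiset ℝ) (x : ℝ) :
    ∃ ε > 0, ∀ t ∈ K, t ≠ x → ε ≤ |t - x| := by
  induction K using Multiset.induction_on with
  | empty => exact ⟨1, one_pos, by simp⟩
  | cons s K ih =>
    obtain ⟨ε, hε, h⟩ := ih
    by_cases hs : s = x
    · refine ⟨ε, hε, fun t ht htx => ?_⟩
      rcases Multiset.mem_cons.1 ht with rfl | ht
      · exact absurd hs htx
      · exact h t ht htx
    · refine ⟨min ε |s - x|, lt_min hε (abs_pos.2 (sub_ne_zero.2 hs)), fun t ht htx => ?_⟩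
      rcases Multiset.mem_cons.1 ht with rfl | ht
      · exact min_le_right _ _
      · exact (min_le_left _ _).trans (h t ht htx)

theorem exists_gap_left (K : Multiset ℝ) {x y : ℝ} (hxy : x < y) :
    ∃ l, x ≤ l ∧ l < y ∧ ∀ t ∈ K, t ∉ Set.Ioo l y := by
  obtain ⟨ε, hε, h⟩ := exists_gap K y
  refine ⟨max x (y - ε), le_max_left _ _, max_lt hxy (by linarith), fun t ht hm => ?_⟩
  have h1 := h t ht hm.2.ne
  have h2 : y - ε < t := (le_max_right _ _).trans_lt hm.1
  rw [abs_of_neg (by linarith [hm.2])] at h1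
  linarith

theorem exists_gap_right (K : Multiset ℝ) {x y : ℝ} (hxy : x < y) :
    ∃ r, x < r ∧ r ≤ y ∧ ∀ t ∈ K, t ∉ Set.Ioo x r := by
  obtain ⟨ε, hε, h⟩ := exists_gap K x
  refine ⟨min y (x + ε), lt_min hxy (by linarith), min_le_left _ _, fun t ht hm => ?_⟩
  have h1 := h t ht hm.1.ne'
  have h2 : t < x + ε := hm.2.trans_le (min_le_right _ _)
  rw [abs_of_pos (by linarith [hm.1])] at h1
  linarith

namespace IsTaylorCubic

variable {f : ℝ → ℝ} {x y z a b c d : ℝ}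

theorem recenter {s : Set ℝ} (h : IsTaylorCubic f x s a b c d) (x' : ℝ) :
    IsTaylorCubic f x' s (a + b * (x' - x) + c * (x' - x) ^ 2 + d * (x' - x) ^ 3)
      (b + 2 * c * (x' - x) + 3 * d * (x' - x) ^ 2) (c + 3 * d * (x' - x)) d :=
  fun u hu => by rw [h u hu]; ring

theorem mono {s t : Set ℝ} (h : IsTaylorCubic f x s a b c d) (hst : t ⊆ s) :
    IsTaylorCubic f x t a b c d := fun u hu => h u (hst hu)

theorem hasDerivAt_cubic (x a b c d u : ℝ) :
    HasDerivAt (fun u => a + b * (u - x) + c * (u - x) ^ 2 + d * (u - x) ^ 3)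
      (b + 2 * c * (u - x) + 3 * d * (u - x) ^ 2) u := by
  have h : HasDerivAt (fun u : ℝ => u - x) 1 u := (hasDerivAt_id u).sub_const x
  refine HasDerivAt.congr_deriv ((((h.const_mul b).const_add a).add ((h.pow 2).const_mul c)).add
    ((h.pow 3).const_mul d)) ?_
  push_cast; ring

theorem deriv_eq (h : IsTaylorCubic f x (Set.Icc y z) a b c d) (hf : Differentiable ℝ f)
    (hyz : y < z) {u : ℝ} (hu : u ∈ Set.Icc y z) :
    deriv f u = b + 2 * c * (u - x) + 3 * d * (u - x) ^ 2 :=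
  (uniqueDiffOn_Icc hyz u hu).eq_deriv _ (hf u).hasDerivAt.hasDerivWithinAt
    ((hasDerivAt_cubic x a b c d u).hasDerivWithinAt.congr h (h u hu))

theorem deriv_deriv_eq (h : IsTaylorCubic f x (Set.Icc y z) a b c d) (hf : Differentiable ℝ f)
    (hyz : y < z) {u : ℝ} (hu : u ∈ Set.Icc y z) (hf' : DifferentiableAt ℝ (deriv f) u) :
    deriv (deriv f) u = 2 * c + 6 * d * (u - x) := by
  have h1 : HasDerivAt (fun u => b + 2 * c * (u - x) + 3 * d * (u - x) ^ 2 + 0 * (u - x) ^ 3)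
      (2 * c + 2 * (3 * d) * (u - x) + 3 * 0 * (u - x) ^ 2) u :=
    hasDerivAt_cubic x b (2 * c) (3 * d) 0 u
  have h2 := (uniqueDiffOn_Icc hyz u hu).eq_deriv _ hf'.hasDerivAt.hasDerivWithinAt
    (h1.hasDerivWithinAt.congr (fun v hv => by rw [h.deriv_eq hf hyz hv]; ring)
      (by rw [h.deriv_eq hf hyz hu]; ring))
  rw [h2]; ring

theorem ext (h : IsTaylorCubic f x (Set.Icc y z) a b c d) (hyz : y < z) {a' b' c' d' : ℝ}
    (h' : IsTaylorCubic f x (Set.Icc y z) a' b' c' d') :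
    a = a' ∧ b = b' ∧ c = c' ∧ d = d' := by
  have := cubic_coeffs_eq_zero (x := x) (a := a - a') (b := b - b') (c := c - c') (d := d - d')
    hyz fun u hu => by
      have h1 := h u hu
      have h2 := h' u hu
      linear_combination h2 - h1
  simpa [sub_eq_zero] using this

/-- An affine function times a quadratic has degree at most three, so coefficients may be compared.
The cubic coefficient `d` enters `C` only with the factor `p`; that is why the cases `p = 0` and `p
≠ 0` are treated differently later. -/
theorem mul_coeffs (h : IsTaylorCubic f x (Set.Icc y z) a b c d) (hf : Differentiable ℝ f)
    (hyz : y < z) {w : ℝ → ℝ} {A B C D p q : ℝ} (hw : IsTaylorCubic w x (Set.Icc y z) A B C D)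
    (hmul : ∀ u ∈ Set.Icc y z, w u = (p + q * (u - x)) * deriv f u) :
    A = p * b ∧ B = q * b + 2 * p * c ∧ C = 2 * q * c + 3 * p * d ∧ D = 3 * q * d := by
  refine hw.ext hyz fun u hu => ?_
  rw [hmul u hu, h.deriv_eq hf hyz hu]
  ring

end IsTaylorCubic

theorem IsCubicSpline.contDiffAt {K : Multiset ℝ} {f : ℝ → ℝ} (hf : IsCubicSpline K f) (x : ℝ) :
    ContDiffAt ℝ ((3 - K.count x : ℕ)) f x := by
  by_cases hx : x ∈ K
  · exact hf.smooth x hx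
  · obtain ⟨l, -, hl, hl'⟩ := exists_gap_left K (show x - 1 < x by linarith)
    obtain ⟨r, hr, -, hr'⟩ := exists_gap_right K (show x < x + 1 by linarith)
    obtain ⟨p, -, hp⟩ := hf.piecewise l r (hl.trans hr) (fun t ht hm => by
      rcases lt_trichotomy t x with h | rfl | h
      · exact hl' t ht ⟨hm.1, h⟩
      · exact hx ht
      · exact hr' t ht ⟨h, hm.2⟩)
    have hc : ContDiff ℝ ((3 - K.count x : ℕ)) (fun u => p.eval u) := by
      simpa using p.contDiff_aeval (𝕜 := ℝ) ((3 - K.count x : ℕ))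
    exact hc.contDiffAt.congr_of_eventuallyEq (Filter.eventually_of_mem (Icc_mem_nhds hl hr) hp)

theorem IsKnotMultiset.count_le {K : Multiset ℝ} (hK : IsKnotMultiset K) (x : ℝ) :
    K.count x ≤ 2 := by
  by_cases hx : x ∈ K
  · exact (hK x hx).2.2
  · rw [Multiset.count_eq_zero_of_notMem hx]; exact Nat.zero_le _

theorem IsCubicSpline.differentiable {K : Multiset ℝ} {f : ℝ → ℝ} (hf : IsCubicSpline K f)
    (hK : IsKnotMultiset K) : Differentiable ℝ f := fun x => by
  refine (hf.contDiffAt x).differentiableAt ?_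
  have := hK.count_le x
  exact_mod_cast (show 3 - K.count x ≠ 0 by omega)

theorem IsCubicSpline.differentiableAt_deriv {K : Multiset ℝ} {f : ℝ → ℝ}
    (hf : IsCubicSpline K f) {x : ℝ} (hx : K.count x ≤ 1) : DifferentiableAt ℝ (deriv f) x := by
  have h2 : ContDiffAt ℝ 2 f x := (hf.contDiffAt x).of_le (by
    exact_mod_cast (show 2 ≤ 3 - K.count x by omega))
  have h3 : ContDiffAt ℝ 1 (fderiv ℝ f) x := h2.fderiv_right (by norm_num)
  have h4 : ContDiffAt ℝ 1 (fun y => fderiv ℝ f y 1) x := h3.clm_apply contDiffAt_const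
  exact h4.differentiableAt one_ne_zero

theorem IsCubicSpline.taylor_pair {K : Multiset ℝ} {f : ℝ → ℝ} (hf : IsCubicSpline K f)
    (hK : IsKnotMultiset K) {l y r : ℝ} (hl : l < y) (hr : y < r)
    (hlK : ∀ t ∈ K, t ∉ Set.Ioo l y) (hrK : ∀ t ∈ K, t ∉ Set.Ioo y r) :
    ∃ a b c c' d d', IsTaylorCubic f y (Set.Icc l y) a b c d ∧
      IsTaylorCubic f y (Set.Icc y r) a b c' d' ∧ (K.count y ≤ 1 → c = c') := by
  obtain ⟨a, b, c, d, h⟩ := hf.taylor hl hlK y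
  obtain ⟨a', b', c', d', h'⟩ := hf.taylor hr hrK y
  have hd := hf.differentiable hK
  have e1 : a = a' := by
    have h1 := h y ⟨hl.le, le_rfl⟩
    have h2 := h' y ⟨le_rfl, hr.le⟩
    simp at h1 h2; linarith
  have e2 : b = b' := by
    have h1 := h.deriv_eq hd hl ⟨hl.le, le_rfl⟩
    have h2 := h'.deriv_eq hd hr ⟨le_rfl, hr.le⟩
    simp at h1 h2; linarith
  subst e1 e2
  refine ⟨a, b, c, c', d, d', h, h', fun hc => ?_⟩
  have h1 := h.deriv_deriv_eq hd hl ⟨hl.le, le_rfl⟩ (hf.differentiableAt_deriv hc)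
  have h2 := h'.deriv_deriv_eq hd hr ⟨le_rfl, hr.le⟩ (hf.differentiableAt_deriv hc)
  simp at h1 h2; linarith

/-! ### The constraints along one edge -/

/-- `f` is a possible coordinate of the boundary curve, `w` of the sum of the cross-boundary
derivatives. -/
structure IsEdgePair (K : Multiset ℝ) (α f w : ℝ → ℝ) : Prop where
  left : IsCubicSpline K f
  right : IsCubicSpline K w
  eq : ∀ u ∈ Set.Icc (0 : ℝ) 1, w u = α u * deriv f u

theorem IsEdgePair.reflect {K : Multiset ℝ} {α f w : ℝ → ℝ} (h : IsEdgePair K α f w) :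
    IsEdgePair (K.map fun t => 1 - t) (fun u => - α (1 - u)) (fun u => f (1 - u))
      (fun u => w (1 - u)) := by
  refine ⟨h.left.reflect, h.right.reflect, fun u hu => ?_⟩
  rw [h.eq (1 - u) ⟨by linarith [hu.2], by linarith [hu.1]⟩, deriv_comp_const_sub]
  ring

theorem IsEdgePair.combine {K : Multiset ℝ} {α f w f' w' : ℝ → ℝ} (h : IsEdgePair K α f w)
    (h' : IsEdgePair K α f' w') (hK : IsKnotMultiset K) (r : ℝ) :
    IsEdgePair K α (fun u => f u + r * f' u) (fun u => w u + r * w' u) := by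
  refine ⟨h.left.add (h'.left.const_mul r), h.right.add (h'.right.const_mul r), fun u hu => ?_⟩
  have d1 := (h.left.differentiable hK u).hasDerivAt
  have d2 := (h'.left.differentiable hK u).hasDerivAt
  have : deriv (fun u => f u + r * f' u) u = deriv f u + r * deriv f' u :=
    (d1.add (d2.const_mul r)).deriv
  rw [this, h.eq u hu, h'.eq u hu]
  ring

/-- What a successful construction says about one edge. -/
structure EdgeSituation (K : Multiset ℝ) (α : ℝ → ℝ) : Prop where
  knots : IsKnotMultiset K
  diff_zero : DifferentiableWithinAt ℝ α (Set.Icc 0 1) 0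
  diff_one : DifferentiableWithinAt ℝ α (Set.Icc 0 1) 1
  jets : ∀ x₀ x₁ x₂ y₀ y₁ y₂ : ℝ, ∃ f w, IsEdgePair K α f w ∧
    (f 0 = x₀ ∧ deriv f 0 = x₁ ∧ deriv (deriv f) 0 = x₂) ∧
    (f 1 = y₀ ∧ deriv f 1 = y₁ ∧ deriv (deriv f) 1 = y₂)
  curve : ∃ g W : Fin 3 → ℝ → ℝ, (∀ i, IsEdgePair K α (g i) (W i)) ∧
    (∀ t ∈ K, ∃ i, deriv (g i) t ≠ 0) ∧
    ∀ a b : ℝ, 0 ≤ a → a < b → b ≤ 1 → ∀ p E : Fin 3 → ℝ,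
      ¬ ∀ u ∈ Set.Icc a b, ∃ r, ∀ i, g i u = p i + r * E i
  start : ∃ f w, IsEdgePair K α f w ∧ f 0 = 0 ∧ deriv f 0 = 0 ∧ deriv (deriv f) 0 = 0 ∧
    ∀ b, 0 < b → b ≤ 1 → ∃ u ∈ Set.Icc 0 b, f u ≠ 0
  finish : ∃ f w, IsEdgePair K α f w ∧ f 1 = 0 ∧ deriv f 1 = 0 ∧ deriv (deriv f) 1 = 0 ∧
    ∀ a, 0 ≤ a → a < 1 → ∃ u ∈ Set.Icc a 1, f u ≠ 0

theorem IsKnotMultiset.reflect {K : Multiset ℝ} (hK : IsKnotMultiset K) :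
    IsKnotMultiset (K.map fun t => 1 - t) := by
  intro t ht
  obtain ⟨s, hs, rfl⟩ := Multiset.mem_map.1 ht
  obtain ⟨h1, h2, h3⟩ := hK s hs
  refine ⟨by linarith, by linarith, ?_⟩
  rwa [Multiset.count_map_eq_count' (fun t : ℝ => 1 - t) _ (fun a b h => by simpa using h)]

theorem deriv_deriv_reflect (f : ℝ → ℝ) (u : ℝ) :
    deriv (deriv fun x => f (1 - x)) u = deriv (deriv f) (1 - u) := by
  have h : (deriv fun x => f (1 - x)) = fun x => - deriv f (1 - x) :=
    funext fun x => by rw [deriv_comp_const_sub]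
  rw [h, deriv.fun_neg, deriv_comp_const_sub, neg_neg]

theorem count_reflect (K : Multiset ℝ) (t : ℝ) :
    (K.map fun t => 1 - t).count (1 - t) = K.count t :=
  Multiset.count_map_eq_count' (fun t : ℝ => 1 - t) _ (fun a b h => by simpa using h) t

theorem mem_reflect {K : Multiset ℝ} {t : ℝ} : t ∈ (K.map fun t => 1 - t) ↔ 1 - t ∈ K := by
  rw [Multiset.mem_map]
  constructor
  · rintro ⟨s, hs, rfl⟩; simpa using hs
  · exact fun h => ⟨1 - t, h, by ring⟩

theorem EdgeSituation.reflect {K : Multiset ℝ} {α : ℝ → ℝ} (hS : EdgeSituation K α) :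
    EdgeSituation (K.map fun t => 1 - t) (fun u => - α (1 - u)) := by
  have hmaps : Set.MapsTo (fun u : ℝ => 1 - u) (Set.Icc 0 1) (Set.Icc 0 1) :=
    fun u hu => ⟨by linarith [hu.2], by linarith [hu.1]⟩
  have hrd : ∀ u, DifferentiableWithinAt ℝ (fun u : ℝ => 1 - u) (Set.Icc 0 1) u :=
    fun u => by fun_prop
  refine ⟨hS.knots.reflect, ?_, ?_, ?_, ?_, ?_, ?_⟩
  · have h : DifferentiableWithinAt ℝ α (Set.Icc 0 1) ((fun u : ℝ => 1 - u) 0) := by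
      simpa using hS.diff_one
    exact (h.comp 0 (hrd 0) hmaps).neg
  · have h : DifferentiableWithinAt ℝ α (Set.Icc 0 1) ((fun u : ℝ => 1 - u) 1) := by
      simpa using hS.diff_zero
    exact (h.comp 1 (hrd 1) hmaps).neg
  · intro x₀ x₁ x₂ y₀ y₁ y₂
    obtain ⟨f, w, hfw, ⟨h0, h1, h2⟩, h3, h4, h5⟩ := hS.jets y₀ (-y₁) y₂ x₀ (-x₁) x₂
    refine ⟨_, _, hfw.reflect, ⟨?_, ?_, ?_⟩, ?_, ?_, ?_⟩
    · simpa using h3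
    · rw [deriv_comp_const_sub]; simp [h4]
    · rw [deriv_deriv_reflect]; simpa using h5
    · simpa using h0
    · rw [deriv_comp_const_sub]; simp [h1]
    · rw [deriv_deriv_reflect]; simpa using h2
  · obtain ⟨g, W, hg, hreg, hstr⟩ := hS.curve
    refine ⟨fun i u => g i (1 - u), fun i u => W i (1 - u), fun i => (hg i).reflect,
      fun t ht => ?_, fun a b ha hab hb p E h => ?_⟩
    · obtain ⟨i, hi⟩ := hreg _ (mem_reflect.1 ht)
      exact ⟨i, by rw [deriv_comp_const_sub]; exact neg_ne_zero.2 hi⟩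
    · refine hstr (1 - b) (1 - a) (by linarith) (by linarith) (by linarith) p E fun u hu => ?_
      simpa using h (1 - u) ⟨by linarith [hu.2], by linarith [hu.1]⟩
  · obtain ⟨f, w, hfw, h0, h1, h2, h3⟩ := hS.finish
    refine ⟨_, _, hfw.reflect, by simpa using h0, ?_, ?_, fun b hb hb' => ?_⟩
    · rw [deriv_comp_const_sub]; simp [h1]
    · rw [deriv_deriv_reflect]; simpa using h2
    · obtain ⟨u, hu, hne⟩ := h3 (1 - b) (by linarith) (by linarith)
      exact ⟨1 - u, ⟨by linarith [hu.2], by linarith [hu.1]⟩, by simpa using hne⟩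
  · obtain ⟨f, w, hfw, h0, h1, h2, h3⟩ := hS.start
    refine ⟨_, _, hfw.reflect, by simpa using h0, ?_, ?_, fun b hb hb' => ?_⟩
    · rw [deriv_comp_const_sub]; simp [h1]
    · rw [deriv_deriv_reflect]; simpa using h2
    · obtain ⟨u, hu, hne⟩ := h3 (1 - b) (by linarith) (by linarith)
      exact ⟨1 - u, ⟨by linarith [hu.2], by linarith [hu.1]⟩, by simpa using hne⟩

/-- The scalar function may be replaced by the affine function with value `p` and slope `q`
at `x`. -/
def IsAffineOn (K : Multiset ℝ) (α : ℝ → ℝ) (s : Set ℝ) (x p q : ℝ) : Prop :=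
  ∀ f w, IsEdgePair K α f w → ∀ u ∈ s, w u = (p + q * (u - x)) * deriv f u

theorem IsAffineOn.recenter {K : Multiset ℝ} {α : ℝ → ℝ} {s : Set ℝ} {x p q : ℝ}
    (h : IsAffineOn K α s x p q) (x' : ℝ) : IsAffineOn K α s x' (p + q * (x' - x)) q :=
  fun f w hfw u hu => by rw [h f w hfw u hu]; ring

theorem IsAffineOn.mono {K : Multiset ℝ} {α : ℝ → ℝ} {s t : Set ℝ} {x p q : ℝ}
    (h : IsAffineOn K α s x p q) (hts : t ⊆ s) : IsAffineOn K α t x p q :=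
  fun f w hfw u hu => h f w hfw u (hts hu)

theorem IsAffineOn.union {K : Multiset ℝ} {α : ℝ → ℝ} {a b c x p q : ℝ}
    (h : IsAffineOn K α (Set.Icc a b) x p q) (h' : IsAffineOn K α (Set.Icc b c) x p q) :
    IsAffineOn K α (Set.Icc a c) x p q := fun f w hfw u hu => by
  rcases le_total u b with hub | hub
  · exact h f w hfw u ⟨hu.1, hub⟩
  · exact h' f w hfw u ⟨hub, hu.2⟩

theorem IsAffineOn.reflect {K : Multiset ℝ} {α : ℝ → ℝ} {l r x p q : ℝ}
    (h : IsAffineOn K α (Set.Icc l r) x p q) :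
    IsAffineOn (K.map fun t => 1 - t) (fun u => - α (1 - u)) (Set.Icc (1 - r) (1 - l)) (1 - x)
      (-p) q := by
  intro f w hfw u hu
  have hfw' := hfw.reflect
  have e1 : ((K.map fun t => 1 - t).map fun t => 1 - t) = K := by
    rw [Multiset.map_map]
    simp
  have e2 : (fun u => - (fun u => - α (1 - u)) (1 - u)) = α := by
    funext u; simp
  rw [e1, e2] at hfw'
  have := h _ _ hfw' (1 - u) ⟨by linarith [hu.2], by linarith [hu.1]⟩
  rw [deriv_comp_const_sub, sub_sub_cancel] at this
  rw [this]; ring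

theorem IsAffineOn.of_reflect {K : Multiset ℝ} {α : ℝ → ℝ} {l r x p q : ℝ}
    (h : IsAffineOn (K.map fun t => 1 - t) (fun u => - α (1 - u)) (Set.Icc l r) x p q) :
    IsAffineOn K α (Set.Icc (1 - r) (1 - l)) (1 - x) (-p) q := by
  have e1 : ((K.map fun t => 1 - t).map fun t => 1 - t) = K := by
    rw [Multiset.map_map]
    simp
  have e2 : (fun u => - (fun u => - α (1 - u)) (1 - u)) = α := by
    funext u; simp
  have := h.reflect
  rwa [e1, e2] at this

theorem IsTaylorCubic.reflect {f : ℝ → ℝ} {l r x a b c d : ℝ}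
    (h : IsTaylorCubic f x (Set.Icc l r) a b c d) :
    IsTaylorCubic (fun u => f (1 - u)) (1 - x) (Set.Icc (1 - r) (1 - l)) a (-b) c (-d) :=
  fun u hu => by
    have := h (1 - u) ⟨by linarith [hu.2], by linarith [hu.1]⟩
    simp only [this]; ring

theorem no_knots_reflect {K : Multiset ℝ} {l r : ℝ} (h : ∀ t ∈ K, t ∉ Set.Ioo l r) :
    ∀ t ∈ (K.map fun t => 1 - t), t ∉ Set.Ioo (1 - r) (1 - l) := fun t ht hm =>
  h _ (mem_reflect.1 ht) ⟨by linarith [hm.2], by linarith [hm.1]⟩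

/-! ### Affine form of the scalar function and its continuation across single knots. -/

namespace EdgeSituation

variable {K : Multiset ℝ} {α : ℝ → ℝ}

/-- Two affine functions on the two sides of a single knot agree. -/
theorem affine_unique (hS : EdgeSituation K α) {l y r p q p' q' : ℝ} (hl : l < y) (hr : y < r)
    (hlK : ∀ t ∈ K, t ∉ Set.Ioo l y) (hrK : ∀ t ∈ K, t ∉ Set.Ioo y r) (hy : y ∈ K)
    (hy1 : K.count y ≤ 1) (h : IsAffineOn K α (Set.Icc l y) y p q)
    (h' : IsAffineOn K α (Set.Icc y r) y p' q') : p = p' ∧ q = q' := by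
  obtain ⟨g, W, hg, hreg, -⟩ := hS.curve
  obtain ⟨i, hi⟩ := hreg y hy
  obtain ⟨a, b, c, c', d, d', t1, t2, hc⟩ := (hg i).left.taylor_pair hS.knots hl hr hlK hrK
  obtain ⟨A, B, C, C', D, D', t3, t4, -⟩ := (hg i).right.taylor_pair hS.knots hl hr hlK hrK
  have hd := (hg i).left.differentiable hS.knots
  have hb : b ≠ 0 := by
    have := t1.deriv_eq hd hl ⟨hl.le, le_rfl⟩
    simp at this
    rwa [← this]
  obtain ⟨e1, e2, -, -⟩ := t1.mul_coeffs hd hl t3 (h _ _ (hg i))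
  obtain ⟨e3, e4, -, -⟩ := t2.mul_coeffs hd hr t4 (h' _ _ (hg i))
  have hp : p = p' := mul_right_cancel₀ hb (e1.symm.trans e3)
  subst hp
  refine ⟨rfl, mul_right_cancel₀ hb ?_⟩
  have := hc hy1
  subst this
  linarith

theorem eq_zero_of_zero_on_Ioc {h : ℝ → ℝ} (hc : Continuous h) {y z : ℝ} (hyz : y < z)
    (h0 : ∀ u ∈ Set.Ioc y z, h u = 0) : h y = 0 := by
  have h1 : Set.EqOn h (fun _ => 0) (closure (Set.Ioc y z)) :=
    Set.EqOn.closure h0 hc continuous_const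
  rw [closure_Ioc hyz.ne] at h1
  exact h1 ⟨le_rfl, hyz.le⟩

/-- An affine function that vanishes at a single knot continues across the knot. -/
theorem affine_step_zero (hS : EdgeSituation K α) {l y r q : ℝ} (h0 : 0 ≤ l) (hl : l < y)
    (hr : y < r) (h1 : r ≤ 1) (hlK : ∀ t ∈ K, t ∉ Set.Ioo l y) (hrK : ∀ t ∈ K, t ∉ Set.Ioo y r)
    (hy1 : K.count y ≤ 1) (h : IsAffineOn K α (Set.Icc l y) y 0 q) :
    IsAffineOn K α (Set.Icc y r) y 0 q := by
  -- As `p = 0`, the coefficients of `w` up to second order do not involve the cubic coefficient of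
  -- `f`, the only one that may jump at a single knot. The difference therefore has a triple zero.
  have key : ∀ f w, IsEdgePair K α f w → ∃ E, ∀ u ∈ Set.Icc y r,
      w u - (0 + q * (u - y)) * deriv f u = E * (u - y) ^ 3 := by
    intro f w hfw
    obtain ⟨a, b, c, c', d, d', t1, t2, hc⟩ := hfw.left.taylor_pair hS.knots hl hr hlK hrK
    obtain ⟨A, B, C, C', D, D', t3, t4, hC⟩ := hfw.right.taylor_pair hS.knots hl hr hlK hrK
    have hd := hfw.left.differentiable hS.knots
    obtain ⟨e1, e2, e3, e4⟩ := t1.mul_coeffs hd hl t3 (h _ _ hfw)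
    refine ⟨D' - 3 * q * d', fun u hu => ?_⟩
    rw [t4 u hu, t2.deriv_eq hd hr hu, ← hC hy1, ← hc hy1, e1, e2, e3]
    ring
  obtain ⟨g, W, hg, -, hstr⟩ := hS.curve
  choose E hE using fun i => key _ _ (hg i)
  have hmem : ∀ u ∈ Set.Icc y r, u ∈ Set.Icc (0 : ℝ) 1 := fun u hu =>
    ⟨by linarith [hu.1], hu.2.trans h1⟩
  have hα : ∀ i, ∀ u ∈ Set.Icc y r, (α u - q * (u - y)) * deriv (g i) u = E i * (u - y) ^ 3 := by
    intro i u hu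
    rw [← hE i u hu, (hg i).eq u (hmem u hu)]; ring
  -- If some `E j` is not zero, then `α u - q (u - y)` has no zero beyond the knot and the
  -- derivative of the curve is parallel to the constant vector `E`: the curve would be straight.
  have hE0 : ∀ i, E i = 0 := by
    by_contra hne
    push Not at hne
    obtain ⟨j, hj⟩ := hne
    refine hstr y r (by linarith) hr h1 (fun i => g i y) E fun u hu => ?_
    refine ⟨(g j u - g j y) / E j, fun i => ?_⟩
    have hprop : ∀ v ∈ Set.Icc y r, E j * deriv (g i) v - E i * deriv (g j) v = 0 := by
      intro v hv
      rcases hv.1.eq_or_lt with rfl | hv'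
      · have hcont : Continuous fun v => E j * deriv (g i) v - E i * deriv (g j) v := by
          have hc : ∀ i, Continuous (deriv (g i)) := fun i => by
            rw [continuous_iff_continuousAt]
            intro x
            have hk := hS.knots.count_le x
            have h2 : ContDiffAt ℝ 1 (g i) x := ((hg i).left.contDiffAt x).of_le (by
              exact_mod_cast (show 1 ≤ 3 - K.count x by omega))
            have h3 : ContDiffAt ℝ 0 (fderiv ℝ (g i)) x := h2.fderiv_right (by norm_num)
            exact (h3.clm_apply contDiffAt_const (g := fun _ => (1 : ℝ))).continuousAt
          exact (continuous_const.mul (hc i)).sub (continuous_const.mul (hc j))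
        refine eq_zero_of_zero_on_Ioc hcont hr fun v hv => ?_
        have hpos : 0 < (v - y) ^ 3 := pow_pos (by linarith [hv.1]) 3
        have hi := hα i v ⟨hv.1.le, hv.2⟩
        have hj' := hα j v ⟨hv.1.le, hv.2⟩
        have hne : α v - q * (v - y) ≠ 0 := by
          intro h0
          rw [h0, zero_mul] at hj'
          exact (mul_ne_zero hj hpos.ne') hj'.symm
        apply mul_left_cancel₀ hne
        linear_combination E j * hi - E i * hj'
      · have hpos : 0 < (v - y) ^ 3 := pow_pos (by linarith) 3
        have hi := hα i v hv
        have hj' := hα j v hv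
        have hne : α v - q * (v - y) ≠ 0 := by
          intro h0
          rw [h0, zero_mul] at hj'
          exact (mul_ne_zero hj hpos.ne') hj'.symm
        apply mul_left_cancel₀ hne
        linear_combination E j * hi - E i * hj'
    obtain ⟨a, b, c, d, ti⟩ := (hg i).left.taylor hr hrK y
    obtain ⟨a', b', c', d', tj⟩ := (hg j).left.taylor hr hrK y
    have hdi := (hg i).left.differentiable hS.knots
    have hdj := (hg j).left.differentiable hS.knots
    obtain ⟨e1, e2, e3, -⟩ := cubic_coeffs_eq_zero (x := y) (a := E j * b - E i * b')
      (b := 2 * (E j * c - E i * c')) (c := 3 * (E j * d - E i * d')) (d := 0) hr fun v hv => by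
        have := hprop v hv
        rw [ti.deriv_eq hdi hr hv, tj.deriv_eq hdj hr hv] at this
        linear_combination this
    have iy := ti y ⟨le_rfl, hr.le⟩
    have jy := tj y ⟨le_rfl, hr.le⟩
    have iu := ti u hu
    have ju := tj u hu
    rw [iy, jy, iu, ju]
    field_simp
    linear_combination (u - y) * e1 + (u - y) ^ 2 / 2 * e2 + (u - y) ^ 3 / 3 * e3
  obtain ⟨i, hi⟩ : ∃ i, ∃ u ∈ Set.Icc y r, deriv (g i) u ≠ 0 := by
    by_contra hne
    push Not at hne
    refine hstr y r (by linarith) hr h1 (fun i => g i y) 0 fun u hu => ⟨0, fun i => ?_⟩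
    obtain ⟨a, b, c, d, ti⟩ := (hg i).left.taylor hr hrK y
    have hdi := (hg i).left.differentiable hS.knots
    obtain ⟨e1, e2, e3, -⟩ := cubic_coeffs_eq_zero (x := y) (a := b)
      (b := 2 * c) (c := 3 * d) (d := 0) hr fun v hv => by
        have := hne i v hv
        rw [ti.deriv_eq hdi hr hv] at this
        linear_combination this
    rw [ti u hu, ti y ⟨le_rfl, hr.le⟩]
    simp only [Pi.zero_apply]
    linear_combination (u - y) * e1 + (u - y) ^ 2 / 2 * e2 + (u - y) ^ 3 / 3 * e3
  intro f w hfw u hu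
  obtain ⟨F, hF⟩ := key f w hfw
  obtain ⟨v, hv, hvne⟩ := hi
  have hdi := (hg i).left.differentiable hS.knots
  obtain ⟨a, b, c, d, ti⟩ := (hg i).left.taylor hr hrK y
  -- A nonzero `F` would again exclude zeros of `α u - q (u - y)` beyond the knot, and then `E i =
  -- 0` would force the derivative of `g i` to vanish identically on the segment.
  have hF0 : F = 0 := by
    by_contra hF0
    refine hvne ?_
    have hzero : ∀ v ∈ Set.Ioc y r, deriv (g i) v = 0 := by
      intro v hv
      have hv' : v ∈ Set.Icc y r := ⟨hv.1.le, hv.2⟩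
      have e1 := hα i v hv'
      rw [hE0 i, zero_mul] at e1
      rcases mul_eq_zero.1 e1 with e | e
      · exfalso
        have e2 := hF v hv'
        rw [hfw.eq v (hmem v hv'), ← sub_mul, zero_add, e, zero_mul] at e2
        exact mul_ne_zero hF0 (pow_pos (by linarith [hv.1]) 3).ne' e2.symm
      · exact e
    obtain ⟨m, hm1, hm2⟩ := exists_between hr
    obtain ⟨e1, e2, e3, -⟩ := cubic_coeffs_eq_zero (x := y) (a := b)
      (b := 2 * c) (c := 3 * d) (d := 0) hm2 fun v hv => by
        have := hzero v ⟨hm1.trans_le hv.1, hv.2⟩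
        rw [ti.deriv_eq hdi hr ⟨hm1.le.trans hv.1, hv.2⟩] at this
        linear_combination this
    rw [ti.deriv_eq hdi hr hv]
    linear_combination e1 + (v - y) * e2 + (v - y) ^ 2 * e3
  have := hF u hu
  rw [hF0, zero_mul] at this
  linarith

/-- The scalar function is affine where a cubic with a triple zero at `y` occurs. -/
theorem affine_of_triple_zero (hS : EdgeSituation K α) {y r d C D : ℝ} (h0 : 0 ≤ y) (hr : y < r)
    (h1 : r ≤ 1) (hrK : ∀ t ∈ K, t ∉ Set.Ioo y r) {f w : ℝ → ℝ} (hfw : IsEdgePair K α f w)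
    (hd : d ≠ 0) (tf : IsTaylorCubic f y (Set.Icc y r) 0 0 0 d)
    (tw : IsTaylorCubic w y (Set.Icc y r) 0 0 C D) :
    IsAffineOn K α (Set.Icc y r) y (C / (3 * d)) (D / (3 * d)) := by
  -- At `y` itself the derivative of `f` is zero and says nothing about `α`.
  have hα : ∀ u ∈ Set.Ioc y r, α u = C / (3 * d) + D / (3 * d) * (u - y) := by
    intro u hu
    have hu' : u ∈ Set.Icc y r := ⟨hu.1.le, hu.2⟩
    have e := hfw.eq u ⟨by linarith [hu.1], hu.2.trans h1⟩
    rw [tw u hu', tf.deriv_eq (hfw.left.differentiable hS.knots) hr hu'] at e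
    have hpos : (u - y) ^ 2 ≠ 0 := (pow_pos (by linarith [hu.1]) 2).ne'
    apply mul_left_cancel₀ hpos
    field_simp
    linear_combination -e
  intro f' w' hfw' u hu
  obtain ⟨a, b, c, e, tf'⟩ := hfw'.left.taylor hr hrK y
  obtain ⟨A, B, C', D', tw'⟩ := hfw'.right.taylor hr hrK y
  have hdf := hfw'.left.differentiable hS.knots
  set p := C / (3 * d)
  set q := D / (3 * d)
  -- The formula for `α` is not available at `y`; the polynomial identity is read off on `[m, r]`
  -- and then holds on the whole segment.
  obtain ⟨m, hm1, hm2⟩ := exists_between hr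
  obtain ⟨e1, e2, e3, e4⟩ := cubic_coeffs_eq_zero (x := y) (a := A - p * b)
    (b := B - (q * b + 2 * p * c)) (c := C' - (2 * q * c + 3 * p * e)) (d := D' - 3 * q * e) hm2
    fun v hv => by
      have hv' : v ∈ Set.Icc y r := ⟨hm1.le.trans hv.1, hv.2⟩
      have h2 := hfw'.eq v ⟨by linarith [hv'.1], hv'.2.trans h1⟩
      rw [tw' v hv', hα v ⟨hm1.trans_le hv.1, hv.2⟩, tf'.deriv_eq hdf hr hv'] at h2
      linear_combination h2
  rw [tw' u hu, tf'.deriv_eq hdf hr hu]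
  linear_combination e1 + (u - y) * e2 + (u - y) ^ 2 * e3 + (u - y) ^ 3 * e4

/-- An affine function that does not vanish at a single knot continues across the knot if a cubic
with a triple zero at the knot occurs; then all curves continue as the same cubics. -/
theorem affine_step_ne (hS : EdgeSituation K α) {l y r p q d : ℝ} (h0 : 0 ≤ l) (hl : l < y)
    (hr : y < r) (h1 : r ≤ 1) (hlK : ∀ t ∈ K, t ∉ Set.Ioo l y) (hrK : ∀ t ∈ K, t ∉ Set.Ioo y r)
    (hy : y ∈ K) (hy1 : K.count y ≤ 1) (hp : p ≠ 0) (h : IsAffineOn K α (Set.Icc l y) y p q)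
    {f w : ℝ → ℝ} (hfw : IsEdgePair K α f w) (hd : d ≠ 0)
    (tf : IsTaylorCubic f y (Set.Icc l y) 0 0 0 d) :
    IsAffineOn K α (Set.Icc y r) y p q ∧ ∀ f w, IsEdgePair K α f w → ∀ a b c d,
      IsTaylorCubic f y (Set.Icc l y) a b c d → IsTaylorCubic f y (Set.Icc y r) a b c d := by
  have haff : IsAffineOn K α (Set.Icc y r) y p q := by
    obtain ⟨a, b, c, c', e, e', t1, t2, hc⟩ := hfw.left.taylor_pair hS.knots hl hr hlK hrK
    obtain ⟨A, B, C, C', D, D', t3, t4, hC⟩ := hfw.right.taylor_pair hS.knots hl hr hlK hrK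
    have hdf := hfw.left.differentiable hS.knots
    obtain ⟨rfl, rfl, rfl, rfl⟩ := t1.ext hl tf
    obtain rfl := hc hy1
    obtain rfl := hC hy1
    obtain ⟨e1, e2, e3, -⟩ := t1.mul_coeffs hdf hl t3 (h _ _ hfw)
    simp only [mul_zero, zero_add] at e1 e2 e3
    subst e1
    obtain rfl : B = 0 := by linarith
    -- The second-order coefficient of `w` survives the single knot. Hence `w`, and with it `f'`,
    -- cannot vanish identically beyond the knot, so the triple zero of `f` has a nonzero
    -- coefficient on the right as well.
    have hCne : C ≠ 0 := by rw [e3]; exact mul_ne_zero (mul_ne_zero (by norm_num) hp) hd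
    have he' : e' ≠ 0 := by
      rintro rfl
      obtain ⟨-, -, h3, -⟩ := cubic_coeffs_eq_zero (x := y) (a := 0) (b := 0) (c := C) (d := D') hr
        fun u hu => by
          have h2 := hfw.eq u ⟨by linarith [hu.1], hu.2.trans h1⟩
          rw [t4 u hu, t2.deriv_eq hdf hr hu] at h2
          linear_combination h2
      exact hCne h3
    have key := hS.affine_of_triple_zero (by linarith) hr h1 hrK hfw he' t2 t4
    obtain ⟨h2, h3⟩ := hS.affine_unique hl hr hlK hrK hy hy1 h key
    rwa [← h2, ← h3] at key
  refine ⟨haff, fun f w hfw a b c d tf => ?_⟩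
  obtain ⟨a', b', c', c'', e, e', t1, t2, hc⟩ := hfw.left.taylor_pair hS.knots hl hr hlK hrK
  obtain ⟨A, B, C, C', D, D', t3, t4, hC⟩ := hfw.right.taylor_pair hS.knots hl hr hlK hrK
  have hdf := hfw.left.differentiable hS.knots
  obtain ⟨rfl, rfl, rfl, rfl⟩ := t1.ext hl tf
  obtain rfl := hc hy1
  obtain rfl := hC hy1
  obtain ⟨-, -, e3, -⟩ := t1.mul_coeffs hdf hl t3 (h _ _ hfw)
  obtain ⟨-, -, e4, -⟩ := t2.mul_coeffs hdf hr t4 (haff _ _ hfw)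
  -- The second-order coefficient `2 q c + 3 p e` of `w` is the same on both sides, and `p ≠ 0`.
  have : e = e' := by
    have : p * e = p * e' := by linarith
    exact mul_left_cancel₀ hp this
  rwa [this]

/-- The first segment. -/
theorem affine_first (hS : EdgeSituation K α) {x : ℝ} (hx : 0 < x) (hx1 : x ≤ 1)
    (hxK : ∀ t ∈ K, t ∉ Set.Ioo 0 x) :
    IsAffineOn K α (Set.Icc 0 x) 0 (α 0) (derivWithin α (Set.Icc 0 1) 0) := by
  obtain ⟨f, w, hfw, f0, f1, f2, hne⟩ := hS.start
  have hdf := hfw.left.differentiable hS.knots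
  have hc0 : K.count 0 ≤ 1 := by
    rw [Multiset.count_eq_zero_of_notMem fun h => (hS.knots 0 h).1.false]; exact zero_le_one
  obtain ⟨a, b, c, d, tf⟩ := hfw.left.taylor hx hxK 0
  obtain ⟨A, B, C, D, tw⟩ := hfw.right.taylor hx hxK 0
  have hmem : (0 : ℝ) ∈ Set.Icc 0 x := ⟨le_rfl, hx.le⟩
  obtain rfl : a = 0 := by simpa [f0] using (tf 0 hmem).symm
  obtain rfl : b = 0 := by simpa [f1] using (tf.deriv_eq hdf hx hmem).symm
  obtain rfl : c = 0 := by
    simpa [f2] using (tf.deriv_deriv_eq hdf hx hmem (hfw.left.differentiableAt_deriv hc0)).symm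
  have hd : d ≠ 0 := by
    rintro rfl
    obtain ⟨u, hu, hu'⟩ := hne x hx hx1
    exact hu' (by simpa using tf u hu)
  set p := α 0
  set q := derivWithin α (Set.Icc 0 1) 0
  have hα : ∀ u ∈ Set.Icc 0 x, A + B * u + C * u ^ 2 + D * u ^ 3 = α u * (3 * d * u ^ 2) := by
    intro u hu
    have := hfw.eq u ⟨hu.1, hu.2.trans hx1⟩
    rw [tw u hu, tf.deriv_eq hdf hx hu] at this
    simp only [sub_zero] at this
    linear_combination this
  obtain rfl : A = 0 := by simpa using hα 0 hmem
  have hderiv : HasDerivWithinAt α q (Set.Icc 0 1) 0 := hS.diff_zero.hasDerivWithinAt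
  have hsub : Set.Ioc 0 x ⊆ Set.Icc (0 : ℝ) 1 := fun u hu => ⟨hu.1.le, hu.2.trans hx1⟩
  have hcont : Filter.Tendsto α (nhdsWithin 0 (Set.Ioc 0 x)) (nhds p) :=
    (hderiv.mono hsub).continuousWithinAt.tendsto
  have hid : Filter.Tendsto (fun u : ℝ => u) (nhdsWithin 0 (Set.Ioc 0 x)) (nhds 0) :=
    tendsto_nhdsWithin_of_tendsto_nhds Filter.tendsto_id
  have hslope : Filter.Tendsto (slope α 0) (nhdsWithin 0 (Set.Ioc 0 x)) (nhds q) :=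
    (hasDerivWithinAt_iff_tendsto_slope' (by simp)).1 (hderiv.mono hsub)
  have hbot : (nhdsWithin (0 : ℝ) (Set.Ioc 0 x)).NeBot := by
    rw [← mem_closure_iff_nhdsWithin_neBot, closure_Ioc hx.ne]; exact hmem
  -- Here `f` is `d u³`. Continuity of `α` at the end gives `w` a double zero, and the value and the
  -- derivative of `α` at the end are then read off from `C` and `D`.
  have hB : B = 0 := by
    have h1 : Filter.Tendsto (fun u => B + C * u + D * u ^ 2) (nhdsWithin 0 (Set.Ioc 0 x))
        (nhds (B + C * 0 + D * 0 ^ 2)) := (tendsto_const_nhds.add (hid.const_mul C)).add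
      ((hid.pow 2).const_mul D)
    have h2 : Filter.Tendsto (fun u => α u * (3 * d * u)) (nhdsWithin 0 (Set.Ioc 0 x))
        (nhds (p * (3 * d * 0))) := hcont.mul (hid.const_mul (3 * d))
    have h3 := tendsto_nhds_unique_of_eventuallyEq h1 h2
      (Filter.eventually_of_mem self_mem_nhdsWithin fun u hu => by
        apply mul_left_cancel₀ (ne_of_gt hu.1 : u ≠ 0)
        linear_combination hα u ⟨hu.1.le, hu.2⟩)
    simpa using h3
  subst hB
  have hC : C = 3 * d * p := by
    have h1 : Filter.Tendsto (fun u => C + D * u) (nhdsWithin 0 (Set.Ioc 0 x))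
        (nhds (C + D * 0)) := tendsto_const_nhds.add (hid.const_mul D)
    have h3 := tendsto_nhds_unique_of_eventuallyEq h1 (hcont.const_mul (3 * d))
      (Filter.eventually_of_mem self_mem_nhdsWithin fun u hu => by
        apply mul_left_cancel₀ (pow_ne_zero 2 (ne_of_gt hu.1) : u ^ 2 ≠ 0)
        linear_combination hα u ⟨hu.1.le, hu.2⟩)
    simpa using h3
  have hD : D = 3 * d * q := by
    refine tendsto_nhds_unique_of_eventuallyEq (tendsto_const_nhds (x := D))
      (hslope.const_mul (3 * d)) (Filter.eventually_of_mem self_mem_nhdsWithin fun u hu => ?_)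
    have hu0 : u ≠ 0 := ne_of_gt hu.1
    have h := hα u ⟨hu.1.le, hu.2⟩
    change D = 3 * d * slope α 0 u
    rw [slope_def_field, sub_zero, ← mul_div_assoc, eq_div_iff hu0]
    apply mul_left_cancel₀ (pow_ne_zero 2 hu0)
    rw [hC] at h
    linear_combination h
  have key := hS.affine_of_triple_zero le_rfl hx hx1 hxK hfw hd tf tw
  have e1 : C / (3 * d) = p := by rw [hC]; field_simp
  have e2 : D / (3 * d) = q := by rw [hD]; field_simp
  rwa [e1, e2] at key

end EdgeSituation

/-! ### Consequences for a whole edge with zero, one or several knots. -/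

namespace EdgeSituation

variable {K : Multiset ℝ} {α : ℝ → ℝ}

theorem zero_notMem (hS : EdgeSituation K α) : (0 : ℝ) ∉ K := fun h => (hS.knots 0 h).1.false

theorem one_notMem (hS : EdgeSituation K α) : (1 : ℝ) ∉ K := fun h => (hS.knots 1 h).2.1.false

theorem coeffs_eq_jet (hS : EdgeSituation K α) {f w : ℝ → ℝ} (hfw : IsEdgePair K α f w)
    {l r x a b c d : ℝ} (hlr : l < r) (hx : x ∈ Set.Icc l r) (hxK : x ∉ K)
    (tf : IsTaylorCubic f x (Set.Icc l r) a b c d) :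
    a = f x ∧ b = deriv f x ∧ c = deriv (deriv f) x / 2 := by
  have hdf := hfw.left.differentiable hS.knots
  have hc0 : K.count x ≤ 1 := by
    rw [Multiset.count_eq_zero_of_notMem hxK]; exact zero_le_one
  refine ⟨by simpa using (tf x hx).symm, by simpa using (tf.deriv_eq hdf hlr hx).symm, ?_⟩
  rw [tf.deriv_deriv_eq hdf hlr hx (hfw.left.differentiableAt_deriv hc0)]
  ring

/-- An induction over the knots below `x`, from left to right. -/
theorem induction_knots (hS : EdgeSituation K α) {P : ℝ → Prop} (C : ℝ → Prop)
    (first : ∀ x, 0 < x → x ≤ 1 → (∀ t ∈ K, t ∉ Set.Ioo 0 x) → P x)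
    (step : ∀ y x, 0 < y → y < x → x ≤ 1 → y ∈ K → C y → (∀ t ∈ K, t ∉ Set.Ioo y x) → P y → P x)
    (x : ℝ) (hx : 0 < x) (hx1 : x ≤ 1) (hC : ∀ t ∈ K, t < x → C t) : P x := by
  obtain ⟨n, hn⟩ : ∃ n, (K.toFinset.filter (· < x)).card = n := ⟨_, rfl⟩
  induction n using Nat.strong_induction_on generalizing x with
  | _ n ih =>
    rcases (K.toFinset.filter (· < x)).eq_empty_or_nonempty with he | hne
    · refine first x hx hx1 fun t ht hm => ?_
      have : t ∈ K.toFinset.filter (· < x) := by simp [ht, hm.2]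
      rw [he] at this
      simp at this
    · set y := (K.toFinset.filter (· < x)).max' hne with hy
      have hymem := Finset.max'_mem _ hne
      rw [← hy, Finset.mem_filter, Multiset.mem_toFinset] at hymem
      obtain ⟨hyK, hyx⟩ := hymem
      have hy0 := (hS.knots y hyK).1
      refine step y x hy0 hyx hx1 hyK (hC y hyK hyx) (fun t ht hm => ?_)
        (ih _ ?_ y hy0 (hyx.le.trans hx1) (fun t ht hty => hC t ht (hty.trans hyx)) rfl)
      · have := Finset.le_max' (K.toFinset.filter (· < x)) t (by simp [ht, hm.2])
        exact absurd hm.1 (not_lt.2 this)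
      · rw [← hn]
        refine Finset.card_lt_card ⟨fun t ht => ?_, fun h => ?_⟩
        · simp only [Finset.mem_filter, Multiset.mem_toFinset] at ht ⊢
          exact ⟨ht.1, ht.2.trans hyx⟩
        · have : y ∈ K.toFinset.filter (· < y) := h (by simp [hyK, hyx])
          simp at this

/-- As long as only single knots occur, at which the affine continuation of the scalar function
from the first segment does not vanish, there are no breaks. -/
theorem no_break (hS : EdgeSituation K α) (x : ℝ) (hx : 0 < x) (hx1 : x ≤ 1)
    (h : ∀ t ∈ K, t < x → K.count t ≤ 1 ∧ α 0 + derivWithin α (Set.Icc 0 1) 0 * t ≠ 0) :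
    IsAffineOn K α (Set.Icc 0 x) 0 (α 0) (derivWithin α (Set.Icc 0 1) 0) ∧
      ∀ f w, IsEdgePair K α f w → ∃ a b c d, IsTaylorCubic f 0 (Set.Icc 0 x) a b c d := by
  set p := α 0
  set q := derivWithin α (Set.Icc 0 1) 0
  refine hS.induction_knots (P := fun x => IsAffineOn K α (Set.Icc 0 x) 0 p q ∧
    ∀ f w, IsEdgePair K α f w → ∃ a b c d, IsTaylorCubic f 0 (Set.Icc 0 x) a b c d)
    (fun t => K.count t ≤ 1 ∧ p + q * t ≠ 0) ?_ ?_ x hx hx1 h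
  · exact fun x hx hx1 hxK => ⟨hS.affine_first hx hx1 hxK,
      fun f w hfw => hfw.left.taylor hx hxK 0⟩
  · rintro y x hy hyx hx1 hyK ⟨hy1, hyne⟩ hgap ⟨haff, htay⟩
    obtain ⟨l, h0l, hly, hlK⟩ := exists_gap_left K hy
    have hsub : Set.Icc l y ⊆ Set.Icc 0 y := Set.Icc_subset_Icc_left h0l
    have hmem : (0 : ℝ) ∈ Set.Icc 0 y := ⟨le_rfl, hy.le⟩
    -- The prescribed jet is that of `(u - y) ^ 3` at `0`. The cubic coefficient cannot be
    -- prescribed; it is corrected to one by a multiple of the spline `e u ^ 3` from `start`. This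
    -- yields the triple zero at `y` that `affine_step_ne` requires.
    obtain ⟨f₁, w₁, hfw₁, ⟨j0, j1, j2⟩, -⟩ := hS.jets (-y ^ 3) (3 * y ^ 2) (-6 * y) 0 0 0
    obtain ⟨f₀, w₀, hfw₀, k0, k1, k2, hne⟩ := hS.start
    obtain ⟨a, b, c, d, t₁⟩ := htay _ _ hfw₁
    obtain ⟨a', b', c', e, t₀⟩ := htay _ _ hfw₀
    obtain ⟨rfl, rfl, rfl⟩ := hS.coeffs_eq_jet hfw₁ hy hmem hS.zero_notMem t₁
    obtain ⟨rfl, rfl, rfl⟩ := hS.coeffs_eq_jet hfw₀ hy hmem hS.zero_notMem t₀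
    rw [k0, k1, k2] at t₀
    rw [j0, j1, j2] at t₁
    have he : e ≠ 0 := by
      rintro rfl
      obtain ⟨u, hu, hu'⟩ := hne y hy (hyx.le.trans hx1)
      exact hu' (by simpa using t₀ u hu)
    have tf : IsTaylorCubic (fun u => f₁ u + (1 - d) / e * f₀ u) y (Set.Icc l y) 0 0 0 1 := by
      intro u hu
      simp only
      rw [t₁ u (hsub hu), t₀ u (hsub hu)]
      field_simp
      ring
    have haff' := (haff.recenter y).mono hsub
    obtain ⟨r1, r2⟩ := hS.affine_step_ne h0l hly hyx hx1 hlK hgap hyK hy1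
      (by simpa using hyne) haff' (hfw₁.combine hfw₀ hS.knots ((1 - d) / e)) one_ne_zero tf
    refine ⟨haff.union fun f w hfw u hu => ?_, fun f w hfw => ?_⟩
    · rw [r1 f w hfw u hu]; ring
    · obtain ⟨a, b, c, d, t⟩ := htay f w hfw
      have t' := r2 f w hfw _ _ _ _ ((t.recenter y).mono hsub)
      refine ⟨a, b, c, d, fun u hu => ?_⟩
      rcases le_total u y with huy | huy
      · exact t u ⟨hu.1, huy⟩
      · rw [t' u ⟨huy, hu.2⟩]; ring

/-- A scalar function that vanishes on the first segment vanishes up to the first double knot. -/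
theorem zero_up_to (hS : EdgeSituation K α) (x : ℝ) (hx : 0 < x) (hx1 : x ≤ 1) (hα : α 0 = 0)
    (hα' : derivWithin α (Set.Icc 0 1) 0 = 0) (h : ∀ t ∈ K, t < x → K.count t ≤ 1) :
    IsAffineOn K α (Set.Icc 0 x) 0 0 0 := by
  refine hS.induction_knots (P := fun x => IsAffineOn K α (Set.Icc 0 x) 0 0 0)
    (fun t => K.count t ≤ 1) ?_ ?_ x hx hx1 h
  · intro x hx hx1 hxK
    have := hS.affine_first hx hx1 hxK
    rwa [hα, hα'] at this
  · intro y x hy hyx hx1 hyK hy1 hgap haff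
    obtain ⟨l, h0l, hly, hlK⟩ := exists_gap_left K hy
    have haff' := (haff.recenter y).mono (Set.Icc_subset_Icc_left h0l)
    rw [zero_mul, add_zero] at haff'
    refine haff.union fun f w hfw u hu => ?_
    rw [hS.affine_step_zero h0l hly hyx hx1 hlK hgap hy1 haff' f w hfw u hu]
    ring

/-- The mirror image of `no_break`. The slope `Q` is obtained before `x`, so that the same affine
function serves all intervals ending at `1`. -/
theorem no_break_right (hS : EdgeSituation K α) : ∃ Q, ∀ x, 0 ≤ x → x < 1 →
    (∀ t ∈ K, x < t → K.count t ≤ 1 ∧ α 1 + Q * (t - 1) ≠ 0) →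
    IsAffineOn K α (Set.Icc x 1) 1 (α 1) Q ∧
      ∀ f w, IsEdgePair K α f w → ∃ a b c d, IsTaylorCubic f 1 (Set.Icc x 1) a b c d := by
  refine ⟨derivWithin (fun u => - α (1 - u)) (Set.Icc 0 1) 0, fun x hx0 hx1 h => ?_⟩
  obtain ⟨h1, h2⟩ := hS.reflect.no_break (1 - x) (by linarith) (by linarith) fun t ht htx => by
    obtain ⟨h1, h2⟩ := h (1 - t) (mem_reflect.1 ht) (by linarith)
    have hc := count_reflect K (1 - t)
    rw [sub_sub_cancel] at hc
    refine ⟨hc.trans_le h1, fun h0 => h2 ?_⟩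
    simp only [sub_zero] at h0
    linear_combination -h0
  refine ⟨by simpa using h1.of_reflect, fun f w hfw => ?_⟩
  obtain ⟨a, b, c, d, t⟩ := h2 _ _ hfw.reflect
  exact ⟨_, _, _, _, by simpa using t.reflect⟩

theorem affine_step_zero_left (hS : EdgeSituation K α) {l y r q : ℝ} (h0 : 0 ≤ l) (hl : l < y)
    (hr : y < r) (h1 : r ≤ 1) (hlK : ∀ t ∈ K, t ∉ Set.Ioo l y) (hrK : ∀ t ∈ K, t ∉ Set.Ioo y r)
    (hy1 : K.count y ≤ 1) (h : IsAffineOn K α (Set.Icc y r) y 0 q) :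
    IsAffineOn K α (Set.Icc l y) y 0 q := by
  have h' := h.reflect
  rw [neg_zero] at h'
  have := (hS.reflect.affine_step_zero (by linarith) (by linarith) (by linarith) (by linarith)
    (no_knots_reflect hrK) (no_knots_reflect hlK) (by rwa [count_reflect]) h').of_reflect
  simpa using this

/-- Two affine functions on the two sides of a knot agree at the knot, and they agree altogether if
they vanish there. -/
theorem affine_match (hS : EdgeSituation K α) {l y r p q p' q' : ℝ} (hl : l < y) (hr : y < r)
    (hlK : ∀ t ∈ K, t ∉ Set.Ioo l y) (hrK : ∀ t ∈ K, t ∉ Set.Ioo y r) (hy : y ∈ K)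
    (h : IsAffineOn K α (Set.Icc l y) y p q) (h' : IsAffineOn K α (Set.Icc y r) y p' q') :
    p = p' ∧ (p = 0 → q = q') := by
  obtain ⟨g, W, hg, hreg, -⟩ := hS.curve
  obtain ⟨i, hi⟩ := hreg y hy
  obtain ⟨a, b, c, c', d, d', t1, t2, -⟩ := (hg i).left.taylor_pair hS.knots hl hr hlK hrK
  obtain ⟨A, B, C, C', D, D', t3, t4, -⟩ := (hg i).right.taylor_pair hS.knots hl hr hlK hrK
  have hd := (hg i).left.differentiable hS.knots
  have hb : b ≠ 0 := by
    have := t1.deriv_eq hd hl ⟨hl.le, le_rfl⟩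
    simp at this
    rwa [← this]
  obtain ⟨e1, e2, -, -⟩ := t1.mul_coeffs hd hl t3 (h _ _ (hg i))
  obtain ⟨e3, e4, -, -⟩ := t2.mul_coeffs hd hr t4 (h' _ _ (hg i))
  have hp : p = p' := mul_right_cancel₀ hb (e1.symm.trans e3)
  subst hp
  refine ⟨rfl, ?_⟩
  rintro rfl
  refine mul_right_cancel₀ hb ?_
  linarith

/-- If `α'(0) = 0`, the zero function propagates to the other end, against `α(1) ≠ 0`. Otherwise the
affine function vanishes only at `0`, every `f` is a single cubic, and a triple zero at `0` leaves
only `d u ^ 3`, which cannot have value one and slope zero at `1`. -/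
theorem false_of_no_double (hS : EdgeSituation K α) (h0 : α 0 = 0) (h1 : α 1 ≠ 0)
    (hK : ∀ t, K.count t ≤ 1) : False := by
  by_cases hq : derivWithin α (Set.Icc 0 1) 0 = 0
  · have haff := hS.zero_up_to 1 one_pos le_rfl h0 hq fun t _ _ => hK t
    obtain ⟨f, w, hfw, -, -, h, -⟩ := hS.jets 0 0 0 0 1 0
    have e1 := haff f w hfw 1 ⟨zero_le_one, le_rfl⟩
    have e2 := hfw.eq 1 ⟨zero_le_one, le_rfl⟩
    rw [h] at e1 e2
    exact h1 (by linarith)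
  · obtain ⟨-, htay⟩ := hS.no_break 1 one_pos le_rfl fun t ht _ => ⟨hK t, by
      rw [h0, zero_add]; exact mul_ne_zero hq (hS.knots t ht).1.ne'⟩
    obtain ⟨f, w, hfw, ⟨i0, i1, i2⟩, j0, j1, -⟩ := hS.jets 0 0 0 1 0 0
    obtain ⟨a, b, c, d, t⟩ := htay f w hfw
    have hmem : (0 : ℝ) ∈ Set.Icc (0 : ℝ) 1 := ⟨le_rfl, zero_le_one⟩
    obtain ⟨rfl, rfl, rfl⟩ := hS.coeffs_eq_jet hfw one_pos hmem hS.zero_notMem t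
    rw [i0, i1, i2] at t
    have e1 := t 1 ⟨zero_le_one, le_rfl⟩
    have e2 := t.deriv_eq (hfw.left.differentiable hS.knots) one_pos
      (⟨zero_le_one, le_rfl⟩ : (1 : ℝ) ∈ Set.Icc (0 : ℝ) 1)
    rw [j0] at e1
    rw [j1] at e2
    simp at e1 e2
    exact one_ne_zero (e1.trans e2)

/-- Two single knots after a double knot, with the zero of the scalar function at the last one. -/
theorem slope_of_three_knots (hS : EdgeSituation K α) {τ y' y q Q : ℝ} (hτ : 0 < τ)
    (hτy' : τ < y') (hy'y : y' < y) (hy : y < 1) (g₀ : ∀ t ∈ K, t ∉ Set.Ioo 0 τ)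
    (g₁ : ∀ t ∈ K, t ∉ Set.Ioo τ y') (g₂ : ∀ t ∈ K, t ∉ Set.Ioo y' y)
    (g₃ : ∀ t ∈ K, t ∉ Set.Ioo y 1) (hτK : τ ∈ K) (hy'K : y' ∈ K) (hy'1 : K.count y' ≤ 1)
    (hy1 : K.count y ≤ 1) (hL : IsAffineOn K α (Set.Icc 0 τ) τ (q * τ) q)
    (hR : IsAffineOn K α (Set.Icc y' y) y 0 Q) (hQ : Q ≠ 0) : q * τ = Q * (τ - y) := by
  have hm0 : (0 : ℝ) ∈ Set.Icc 0 τ := ⟨le_rfl, hτ.le⟩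
  have hR' := hR.recenter y'
  -- Two splines with zero jet at `0` are multiples of `u ^ 3` on the first segment, so a
  -- combination of them vanishes there; its jet at `1` is still nontrivial, with second derivative
  -- zero.
  obtain ⟨f, w, hfw, hf0, hf2, hf1⟩ : ∃ f w, IsEdgePair K α f w ∧
      IsTaylorCubic f τ (Set.Icc 0 τ) 0 0 0 0 ∧ deriv (deriv f) 1 = 0 ∧
      ¬ (f 1 = 0 ∧ deriv f 1 = 0) := by
    obtain ⟨f₁, w₁, h₁, ⟨i0, i1, i2⟩, j0, j1, j2⟩ := hS.jets 0 0 0 1 0 0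
    obtain ⟨f₂, w₂, h₂, ⟨k0, k1, k2⟩, l0, l1, l2⟩ := hS.jets 0 0 0 0 1 0
    obtain ⟨a, b, c, d₁, t₁⟩ := h₁.left.taylor hτ g₀ 0
    obtain ⟨rfl, rfl, rfl⟩ := hS.coeffs_eq_jet h₁ hτ hm0 hS.zero_notMem t₁
    obtain ⟨a, b, c, d₂, t₂⟩ := h₂.left.taylor hτ g₀ 0
    obtain ⟨rfl, rfl, rfl⟩ := hS.coeffs_eq_jet h₂ hτ hm0 hS.zero_notMem t₂
    rw [i0, i1, i2] at t₁
    rw [k0, k1, k2] at t₂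
    by_cases hd : d₁ = 0
    · refine ⟨f₁, w₁, h₁, fun u hu => ?_, j2, fun h => one_ne_zero (j0.symm.trans h.1)⟩
      rw [t₁ u hu, hd]; ring
    · have hcomb := h₂.combine h₁ hS.knots (-d₂ / d₁)
      obtain ⟨a, b, c, d, t⟩ := hcomb.left.taylor hy g₃ 1
      obtain ⟨a₁, b₁, c₁, e₁, s₁⟩ := h₁.left.taylor hy g₃ 1
      obtain ⟨a₂, b₂, c₂, e₂, s₂⟩ := h₂.left.taylor hy g₃ 1
      have hm1 : (1 : ℝ) ∈ Set.Icc y 1 := ⟨hy.le, le_rfl⟩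
      have q₁ := hS.coeffs_eq_jet h₁ hy hm1 hS.one_notMem s₁
      have q₂ := hS.coeffs_eq_jet h₂ hy hm1 hS.one_notMem s₂
      have q := hS.coeffs_eq_jet hcomb hy hm1 hS.one_notMem t
      obtain ⟨-, r1, r2, -⟩ := t.ext hy (a' := a₂ + -d₂ / d₁ * a₁) (b' := b₂ + -d₂ / d₁ * b₁)
        (c' := c₂ + -d₂ / d₁ * c₁) (d' := e₂ + -d₂ / d₁ * e₁) fun u hu => by
          rw [s₁ u hu, s₂ u hu]; ring
      refine ⟨_, _, hcomb, fun u hu => ?_, ?_, fun h => ?_⟩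
      · simp only
        rw [t₁ u hu, t₂ u hu]
        field_simp
        ring
      · have := q.2.2
        rw [r2, q₁.2.2, q₂.2.2, j2, l2] at this
        linarith
      · have := q.2.1
        rw [r1, q₁.2.1, q₂.2.1, j1, l1, h.2] at this
        linarith
  have hdf := hfw.left.differentiable hS.knots
  have hwz : ∀ {l r x}, l < r → 0 ≤ l → r ≤ 1 → IsTaylorCubic f x (Set.Icc l r) 0 0 0 0 →
      IsTaylorCubic w x (Set.Icc l r) 0 0 0 0 := by
    intro l r x hlr hl hr h u hu
    rw [hfw.eq u ⟨hl.trans hu.1, hu.2.trans hr⟩, h.deriv_eq hdf hlr hu]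
    ring
  -- If `f` were zero up to `y'`, it would stay zero up to `y`, because the scalar function does not
  -- vanish at `y'`. Beyond `y` it would be a multiple of `(u - y) ^ 3`, excluded by its jet at `1`.
  have hz : ¬ IsTaylorCubic f y' (Set.Icc τ y') 0 0 0 0 := by
    intro h
    obtain ⟨a, b, c, c', d, d', t1, t2, hc⟩ := hfw.left.taylor_pair hS.knots hτy' hy'y g₁ g₂
    obtain ⟨A, B, C, C', D, D', t3, t4, hC⟩ := hfw.right.taylor_pair hS.knots hτy' hy'y g₁ g₂
    obtain rfl := hc hy'1
    obtain rfl := hC hy'1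
    obtain ⟨rfl, rfl, rfl, rfl⟩ := t1.ext hτy' h
    obtain ⟨rfl, rfl, rfl, rfl⟩ :=
      t3.ext hτy' (hwz hτy' hτ.le (hy'y.le.trans hy.le) h)
    obtain ⟨-, -, e, -⟩ := t2.mul_coeffs hdf hy'y t4 (hR' _ _ hfw)
    have hd' : d' = 0 := by
      have : Q * (y' - y) * d' = 0 := by linarith
      exact (mul_eq_zero.1 this).resolve_left (mul_ne_zero hQ (by linarith))
    subst hd'
    obtain ⟨a, b, c, c', d, d', s1, s2, hc⟩ := hfw.left.taylor_pair hS.knots hy'y hy g₂ g₃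
    obtain rfl := hc hy1
    obtain ⟨rfl, rfl, rfl, rfl⟩ := s1.ext hy'y (a' := 0) (b' := 0) (c' := 0) (d' := 0)
      fun u hu => by rw [t2 u hu]; ring
    obtain ⟨e1, e2, e3⟩ := hS.coeffs_eq_jet hfw hy ⟨hy.le, le_rfl⟩ hS.one_notMem (s2.recenter 1)
    rw [hf2] at e3
    have hd' : d' = 0 := by
      have : (1 - y) * d' = 0 := by linarith
      exact (mul_eq_zero.1 this).resolve_left (by linarith)
    subst hd'
    exact hf1 ⟨by rw [← e1]; ring, by rw [← e2]; ring⟩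
  obtain ⟨a, b', b, c, d₀, d, t1, t2, -⟩ := hfw.left.taylor_pair hS.knots hτ hτy' g₀ g₁
  obtain ⟨A, B, C₀, C, D₀, D, t3, t4, -⟩ := hfw.right.taylor_pair hS.knots hτ hτy' g₀ g₁
  obtain ⟨rfl, rfl, -, -⟩ := t1.ext hτ hf0
  obtain ⟨rfl, rfl, -, -⟩ :=
    t3.ext hτ (hwz hτ le_rfl (by linarith) hf0)
  obtain ⟨g, W, hg, hreg, -⟩ := hS.curve
  obtain ⟨i, hi⟩ := hreg τ hτK
  have hdg := (hg i).left.differentiable hS.knots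
  obtain ⟨ga, gb, gc', gc, gd', gd, v1, v2, -⟩ := (hg i).left.taylor_pair hS.knots hτ hτy' g₀ g₁
  obtain ⟨GA, GB, GC', GC, GD', GD, v3, v4, -⟩ := (hg i).right.taylor_pair hS.knots hτ hτy' g₀ g₁
  have hgb : gb ≠ 0 := by
    have := v1.deriv_eq hdg hτ ⟨hτ.le, le_rfl⟩
    simp at this
    rwa [← this]
  obtain ⟨hGA, hGB, -, -⟩ := v1.mul_coeffs hdg hτ v3 (hL _ _ (hg i))
  -- Elimination of the unknown scalar function between `f` and a curve `g i` that is regular at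
  -- `τ`.
  have hprod : ∀ u ∈ Set.Icc τ y', (C * (u - τ) ^ 2 + D * (u - τ) ^ 3) *
      (gb + 2 * gc * (u - τ) + 3 * gd * (u - τ) ^ 2) = (GA + GB * (u - τ) + GC * (u - τ) ^ 2 +
        GD * (u - τ) ^ 3) * (2 * c * (u - τ) + 3 * d * (u - τ) ^ 2) := by
    intro u hu
    have hu' : u ∈ Set.Icc (0 : ℝ) 1 := ⟨hτ.le.trans hu.1, by linarith [hu.2]⟩
    have e1 := hfw.eq u hu'
    have e2 := (hg i).eq u hu'
    rw [t4 u hu, t2.deriv_eq hdf hτy' hu] at e1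
    rw [v4 u hu, v2.deriv_eq hdg hτy' hu] at e2
    linear_combination (gb + 2 * gc * (u - τ) + 3 * gd * (u - τ) ^ 2) * e1 -
      (2 * c * (u - τ) + 3 * d * (u - τ) ^ 2) * e2
  by_cases hq : q = 0
  · exfalso
    subst hq
    obtain rfl : GA = 0 := by rw [hGA]; ring
    obtain rfl : GB = 0 := by rw [hGB]; ring
    -- Divide the product identity by `(u - τ) ^ 2` and let `u` tend to `τ`.
    have hC : C = 0 := by
      have := eq_zero_of_zero_on_Ioc (h := fun u => (C + D * (u - τ)) *
        (gb + 2 * gc * (u - τ) + 3 * gd * (u - τ) ^ 2) - (GC * (u - τ) +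
        GD * (u - τ) ^ 2) * (2 * c + 3 * d * (u - τ))) (by fun_prop) hτy' fun u hu => by
          have hne : (u - τ) ^ 2 ≠ 0 := pow_ne_zero 2 (by linarith [hu.1])
          apply mul_left_cancel₀ hne
          linear_combination hprod u ⟨hu.1.le, hu.2⟩
      simpa [hgb] using this
    subst hC
    obtain ⟨a, b, e, e', k, k', s1, s2, hc⟩ := hfw.left.taylor_pair hS.knots hτy' hy'y g₁ g₂
    obtain ⟨A', B', E, E', L, L', s3, s4, hC⟩ := hfw.right.taylor_pair hS.knots hτy' hy'y g₁ g₂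
    obtain rfl := hc hy'1
    obtain ⟨rfl, rfl, rfl, -⟩ := s1.ext hτy' (t2.recenter y')
    obtain ⟨rfl, rfl, rfl, -⟩ := s3.ext hτy' (t4.recenter y')
    obtain ⟨e1, e2, -, -⟩ := s2.mul_coeffs hdf hy'y s4 (hR' _ _ hfw)
    obtain ⟨x, hx, rfl⟩ : ∃ x, 0 < x ∧ y' = τ + x := ⟨y' - τ, by linarith, by ring⟩
    obtain ⟨m, hm, rfl⟩ : ∃ m, 0 < m ∧ y = τ + x + m := ⟨y - (τ + x), by linarith, by ring⟩
    -- `E1` and `E2` are the conditions that value and first derivative of `w` at the knot `y'` fit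
    -- the affine scalar function beyond it, with the lengths `x = y' - τ` and `m = y - y'`.
    have E1 : D * x ^ 2 = -Q * m * (2 * c + 3 * d * x) := by
      apply mul_left_cancel₀ hx.ne'
      linear_combination e1
    have E2 : (m + x) * (2 * c + 3 * d * x) = -2 * m * c := by
      apply mul_left_cancel₀ hQ
      apply mul_left_cancel₀ hx.ne'
      linear_combination 3 * x * E1 - x * e2
    have hA : 2 * c + 3 * d * x ≠ 0 := by
      intro hA
      rw [hA, mul_zero] at E2
      have hc0 : c = 0 := by
        have : m * c = 0 := by linarith
        exact (mul_eq_zero.1 this).resolve_left hm.ne'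
      have hd0 : d = 0 := by
        have : x * d = 0 := by linarith
        exact (mul_eq_zero.1 this).resolve_left hx.ne'
      subst hc0 hd0
      exact hz fun u hu => by rw [t2 u hu]; ring
    -- By `E2` the derivative of `f` has a zero at `τ + s`, within the segment. There `w = D (u - τ)
    -- ^ 3` must vanish too, so `D = 0`, which contradicts `E1`.
    set s := x * (m + x) / (2 * m + x) with hs
    have hs0 : 0 < s := by positivity
    have hsx : s ≤ x := by
      rw [hs, div_le_iff₀ (by positivity)]
      nlinarith
    have hsz : 2 * c + 3 * d * s = 0 := by
      rw [hs]
      field_simp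
      linear_combination E2
    have hmem : τ + s ∈ Set.Icc τ (τ + x) := ⟨by linarith, by linarith⟩
    have e3 := hfw.eq (τ + s) ⟨by linarith, by linarith⟩
    rw [t4 _ hmem, t2.deriv_eq hdf hτy' hmem] at e3
    have hD : D = 0 := by
      have : D * s ^ 3 = 0 := by linear_combination e3 + α (τ + s) * s * hsz
      exact (mul_eq_zero.1 this).resolve_right (pow_pos hs0 3).ne'
    rw [hD, zero_mul] at E1
    exact mul_ne_zero (mul_ne_zero (neg_ne_zero.2 hQ) hm.ne') hA E1.symm
  -- Divide the product identity by `u - τ` and let `u` tend to `τ`. Then `f` has a triple zero at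
  -- `τ`, the scalar function is affine on `[τ, y']`, and it can be matched at both ends of that
  -- segment.
  · have hc : c = 0 := by
      have := eq_zero_of_zero_on_Ioc (h := fun u => (C * (u - τ) + D * (u - τ) ^ 2) *
        (gb + 2 * gc * (u - τ) + 3 * gd * (u - τ) ^ 2) - (GA + GB * (u - τ) + GC * (u - τ) ^ 2 +
        GD * (u - τ) ^ 3) * (2 * c + 3 * d * (u - τ))) (by fun_prop) hτy' fun u hu => by
          have hne : u - τ ≠ 0 := by linarith [hu.1]
          apply mul_left_cancel₀ hne
          linear_combination hprod u ⟨hu.1.le, hu.2⟩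
      simpa [hGA, hgb, hq, hτ.ne'] using this
    subst hc
    have hd : d ≠ 0 := by
      rintro rfl
      exact hz fun u hu => by rw [t2 u hu]; ring
    have haff := hS.affine_of_triple_zero hτ.le hτy' (hy'y.le.trans hy.le) g₁ hfw hd t2 t4
    obtain ⟨e1, e2⟩ := hS.affine_unique hτy' hy'y g₁ g₂ hy'K hy'1 (haff.recenter y') hR'
    obtain ⟨e3, -⟩ := hS.affine_match hτ hτy' g₀ g₁ hτK hL haff
    rw [e2] at e1
    linear_combination e3 + e1

/-- The affine functions from the two ends are continued towards the double knot `τ`. If the one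
from the right has no zero at a knot beyond `τ`, there are only two cubic pieces and the jets are
too rigid. If it vanishes at a knot `y > τ`, matching at `τ` gives `q τ = Q (τ - y)` with `α(1) = Q
(1 - y)`: opposite signs. -/
theorem slope_mul_neg_of_one_double (hS : EdgeSituation K α) (h0 : α 0 = 0) (h1 : α 1 ≠ 0)
    {τ : ℝ} (hτ2 : K.count τ = 2) (hK : ∀ t, t ≠ τ → K.count t ≤ 1) (hcard : K.card ≤ 4) :
    derivWithin α (Set.Icc 0 1) 0 * α 1 < 0 := by
  have hτK : τ ∈ K := Multiset.count_pos.1 (by omega)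
  obtain ⟨hτ, hτ1, -⟩ := hS.knots τ hτK
  set q := derivWithin α (Set.Icc 0 1) 0 with hq
  have hbelow : ∀ t ∈ K, t < τ → K.count t ≤ 1 := fun t _ htτ => hK t htτ.ne
  have hchain : q ≠ 0 → ∀ t ∈ K, t < τ → K.count t ≤ 1 ∧ α 0 + q * t ≠ 0 := fun hq t ht htτ =>
    ⟨hbelow t ht htτ, by rw [h0, zero_add]; exact mul_ne_zero hq (hS.knots t ht).1.ne'⟩
  have hL : IsAffineOn K α (Set.Icc 0 τ) τ (q * τ) q := by
    by_cases hq0 : q = 0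
    · have := (hS.zero_up_to τ hτ hτ1.le h0 hq0 hbelow).recenter τ
      simpa [hq0] using this
    · have := (hS.no_break τ hτ hτ1.le (hchain hq0)).1.recenter τ
      simpa [h0] using this
  obtain ⟨l, hl0, hlτ, hlK⟩ := exists_gap_left K hτ
  have hL' := hL.mono (Set.Icc_subset_Icc_left hl0)
  obtain ⟨Q, hQ⟩ := hS.no_break_right
  have hfin : ∀ y, τ < y → y < 1 → α 1 = Q * (1 - y) → q * τ = Q * (τ - y) → q * α 1 < 0 := by
    intro y hτy hy1 e1 e2
    have hQ0 : Q ≠ 0 := by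
      rintro rfl
      exact h1 (by rw [e1, zero_mul])
    have hpos : 0 < Q ^ 2 := by positivity
    have : q * α 1 * τ = -(Q ^ 2 * (y - τ) * (1 - y)) := by
      rw [e1]; linear_combination Q * (1 - y) * e2
    have h2 : 0 < Q ^ 2 * (y - τ) * (1 - y) :=
      mul_pos (mul_pos hpos (by linarith)) (by linarith)
    by_contra hcon
    nlinarith
  by_cases hy : ∃ y ∈ K, τ < y ∧ α 1 + Q * (y - 1) = 0
  · obtain ⟨y, hyK, hτy, hy0⟩ := hy
    have hyone := (hS.knots y hyK).2.1
    have hα1 : α 1 = Q * (1 - y) := by linarith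
    have hQ0 : Q ≠ 0 := by
      rintro rfl
      exact h1 (by rw [hα1, zero_mul])
    obtain ⟨hR, -⟩ := hQ y (by linarith) hyone fun t ht hyt => ⟨hK t (hτy.trans hyt).ne', by
      rw [hα1, show Q * (1 - y) + Q * (t - 1) = Q * (t - y) by ring]
      exact mul_ne_zero hQ0 (by linarith)⟩
    have hR' : IsAffineOn K α (Set.Icc y 1) y 0 Q := by
      have := hR.recenter y
      rwa [hy0] at this
    obtain ⟨r, hyr, hr1, hrK⟩ := exists_gap_right K hyone
    -- The zero at the single knot `y` does not stop the continuation to the left, but it does allow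
    -- breaks of the curves.
    have hstep : ∀ l, 0 ≤ l → l < y → (∀ t ∈ K, t ∉ Set.Ioo l y) →
        IsAffineOn K α (Set.Icc l y) y 0 Q := fun l hl hly hlK =>
      hS.affine_step_zero_left hl hly hyr hr1 hlK hrK (hK y hτy.ne')
        (hR'.mono (Set.Icc_subset_Icc_right hr1))
    by_cases hgap : ∀ t ∈ K, t ∉ Set.Ioo τ y
    · obtain ⟨e, -⟩ := hS.affine_match hlτ hτy hlK hgap hτK hL'
        ((hstep τ hτ.le hτy hgap).recenter τ)
      exact hfin y hτy hyone hα1 (by linarith)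
    · push Not at hgap
      obtain ⟨y', hy'K, hτy', hy'y⟩ := hgap
      -- The bound on the number of knots enters here: one more knot between `τ` and `y` exhausts
      -- it.
      have hKeq : ({τ, τ, y', y} : Multiset ℝ) = K := by
        refine Multiset.eq_of_le_of_card_le (Multiset.le_iff_count.2 fun t => ?_)
          (by simpa using hcard)
        have p1 := Multiset.count_pos.2 hy'K
        have p2 := Multiset.count_pos.2 hyK
        simp only [Multiset.insert_eq_cons, Multiset.count_cons, Multiset.count_singleton]
        split_ifs <;> subst_vars <;> first | omega | linarith
      have hmemK : ∀ t ∈ K, t = τ ∨ t = y' ∨ t = y := by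
        intro t ht
        rw [← hKeq] at ht
        simpa using ht
      refine hfin y hτy hyone hα1 (hS.slope_of_three_knots hτ hτy' hy'y hyone ?_ ?_ ?_ ?_ hτK hy'K
        (hK y' hτy'.ne') (hK y hτy.ne') hL (hstep y' (by linarith) hy'y ?_) hQ0)
      all_goals
        rintro t ht ⟨m1, m2⟩
        rcases hmemK t ht with rfl | rfl | rfl <;> linarith
  · exfalso
    push Not at hy
    obtain ⟨hR, htayR⟩ := hQ τ hτ.le hτ1 fun t ht hτt => ⟨hK t hτt.ne', hy t ht hτt⟩
    obtain ⟨r, hτr, hr1, hrK⟩ := exists_gap_right K hτ1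
    have hR' := (hR.recenter τ).mono (Set.Icc_subset_Icc_right hr1)
    obtain ⟨e1, e2⟩ := hS.affine_match hlτ hτr hlK hrK hτK hL' hR'
    have hq0 : q ≠ 0 := by
      intro hq0
      have := e2 (by rw [hq0, zero_mul])
      rw [hq0] at this e1
      rw [← this] at e1
      exact h1 (by linarith)
    -- Zero jet at `0` and the jet of `(u - τ) ^ 2` at `1`. Joining the two cubics at `τ` with
    -- continuous derivative forces `f = 0` on the left and `(u - τ) ^ 2` on the right; then `w'`
    -- would jump at `τ` by `2 q τ ≠ 0`.
    obtain ⟨f, w, hfw, ⟨i0, i1, i2⟩, j0, j1, j2⟩ :=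
      hS.jets 0 0 0 ((1 - τ) ^ 2) (2 * (1 - τ)) 2
    have hdf := hfw.left.differentiable hS.knots
    obtain ⟨a, b, c, d, t⟩ := (hS.no_break τ hτ hτ1.le (hchain hq0)).2 f w hfw
    obtain ⟨rfl, rfl, rfl⟩ := hS.coeffs_eq_jet hfw hτ ⟨le_rfl, hτ.le⟩ hS.zero_notMem t
    obtain ⟨a, b, c, e, t'⟩ := htayR f w hfw
    obtain ⟨rfl, rfl, rfl⟩ := hS.coeffs_eq_jet hfw hτ1 ⟨hτ1.le, le_rfl⟩ hS.one_notMem t'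
    rw [i0, i1, i2] at t
    rw [j0, j1, j2] at t'
    have v1 := t τ ⟨hτ.le, le_rfl⟩
    have v2 := t' τ ⟨le_rfl, hτ1.le⟩
    have v3 := t.deriv_eq hdf hτ ⟨hτ.le, le_rfl⟩
    have v4 := t'.deriv_eq hdf hτ1 ⟨le_rfl, hτ1.le⟩
    have he : e = 0 := by
      have : (τ - 1) ^ 2 * e = 0 := by linear_combination v2 - v1 - τ / 3 * (v4 - v3)
      exact (mul_eq_zero.1 this).resolve_left (pow_ne_zero 2 (by linarith))
    have hd : d = 0 := by
      have : τ ^ 2 * d = 0 := by rw [he] at v4; linear_combination (v4 - v3) / 3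
      exact (mul_eq_zero.1 this).resolve_left (pow_ne_zero 2 hτ.ne')
    subst he hd
    obtain ⟨a, b, c, c', d, d', s1, s2, -⟩ := hfw.left.taylor_pair hS.knots hlτ hτr hlK hrK
    obtain ⟨A, B, C, C', D, D', s3, s4, -⟩ := hfw.right.taylor_pair hS.knots hlτ hτr hlK hrK
    obtain ⟨rfl, rfl, rfl, rfl⟩ := s1.ext hlτ (a' := 0) (b' := 0) (c' := 0) (d' := 0) fun u hu => by
      rw [t u ⟨hl0.trans hu.1, hu.2⟩]; ring
    obtain ⟨-, -, hc', -⟩ := s2.ext hτr (a' := 0) (b' := 0) (c' := 1) (d' := 0) fun u hu => by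
      rw [t' u ⟨hu.1, hu.2.trans hr1⟩]; ring
    obtain ⟨-, B1, -, -⟩ := s1.mul_coeffs hdf hlτ s3 (hL' _ _ hfw)
    obtain ⟨-, B2, -, -⟩ := s2.mul_coeffs hdf hτr s4 (hR' _ _ hfw)
    rw [hc', ← e1] at B2
    have : q * τ = 0 := by linarith
    exact mul_ne_zero hq0 hτ.ne' this

end EdgeSituation

/-! ### From a construction to the situation along one edge -/

theorem deriv_apply {c : ℝ → E3} {u : ℝ} (hc : DifferentiableAt ℝ c u) (i : Fin 3) :
    deriv c u i = deriv (fun x => c x i) u := by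
  have := (EuclideanSpace.proj (𝕜 := ℝ) i : E3 →L[ℝ] ℝ).hasFDerivAt.comp_hasDerivAt u
    hc.hasDerivAt
  exact this.deriv.symm

/-- The coordinates of boundary curves and cross-boundary derivatives are splines. -/
theorem IsBicubicSpline.coordinates {K : Multiset ℝ} (hK : IsKnotMultiset K) {p : ℝ → ℝ → E3}
    (hp : IsBicubicSpline K p) :
    (∀ u, Differentiable ℝ (p u)) ∧ (∀ v, Differentiable ℝ fun u => p u v) ∧
      (∀ v i, IsCubicSpline K fun u => p u v i) ∧ ∀ v i, IsCubicSpline K fun u => d2 p u v i := by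
  induction hp using Submodule.span_induction with
  | mem p hp =>
    obtain ⟨f, g, x, hf, hg, rfl⟩ := hp
    have df := hf.differentiable hK
    have dg := hg.differentiable hK
    refine ⟨fun u => by fun_prop, fun v => by fun_prop, fun v i => ?_, fun v i => ?_⟩
    · have : (fun u => ((f u * g v) • x : E3) i) = fun u => (g v * x i) * f u := by
        funext u; simp; ring
      rw [this]
      exact hf.const_mul _
    · have : (fun u => d2 (fun u v => ((f u * g v) • x : E3)) u v i)
          = fun u => (deriv g v * x i) * f u := by
        funext u
        have h : HasDerivAt (fun y => ((f u * g y) • x : E3)) ((f u * deriv g v) • x) v :=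
          ((dg v).hasDerivAt.const_mul (f u)).smul_const x
        rw [d2, h.deriv]; simp; ring
      rw [this]
      exact hf.const_mul _
  | zero =>
    refine ⟨fun u => differentiable_const 0, fun v => differentiable_const 0,
      fun v i => IsCubicSpline.zero K, fun v i => ?_⟩
    have : (fun u => d2 (0 : ℝ → ℝ → E3) u v i) = fun _ => 0 := by
      funext u
      have : d2 (0 : ℝ → ℝ → E3) u v = 0 := deriv_const v (0 : E3)
      rw [this]; rfl
    rw [this]
    exact IsCubicSpline.zero K
  | add p r _ _ hp hr =>
    obtain ⟨p1, p2, p3, p4⟩ := hp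
    obtain ⟨r1, r2, r3, r4⟩ := hr
    refine ⟨fun u => (p1 u).add (r1 u), fun v => (p2 v).add (r2 v),
      fun v i => (p3 v i).add (r3 v i), fun v i => ?_⟩
    have : (fun u => d2 (p + r) u v i) = fun u => d2 p u v i + d2 r u v i := by
      funext u
      have : d2 (p + r) u v = d2 p u v + d2 r u v := deriv_add (p1 u v) (r1 u v)
      rw [this]; rfl
    rw [this]
    exact (p4 v i).add (r4 v i)
  | smul c p _ hp =>
    obtain ⟨p1, p2, p3, p4⟩ := hp
    refine ⟨fun u => (p1 u).const_smul c, fun v => (p2 v).const_smul c,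
      fun v i => (p3 v i).const_mul c, fun v i => ?_⟩
    have : (fun u => d2 (c • p) u v i) = fun u => c * d2 p u v i := by
      funext u
      have : d2 (c • p) u v = c • d2 p u v := deriv_const_smul c (p1 u v)
      rw [this]; rfl
    rw [this]
    exact (p4 v i).const_mul c

/-- As `1` is not a knot, the jet there is determined from the left, although the splines may differ
beyond `1`. -/
theorem IsCubicSpline.jet_one_eq {K : Multiset ℝ} (hK : IsKnotMultiset K) {f g : ℝ → ℝ}
    (hf : IsCubicSpline K f) (hg : IsCubicSpline K g) (h : ∀ u ∈ Set.Icc (0 : ℝ) 1, f u = g u) :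
    deriv f 1 = deriv g 1 ∧ deriv (deriv f) 1 = deriv (deriv g) 1 := by
  obtain ⟨l, hl0, hl1, hlK⟩ := exists_gap_left K (zero_lt_one (α := ℝ))
  obtain ⟨a, b, c, d, t⟩ := hf.taylor hl1 hlK 1
  have t' : IsTaylorCubic g 1 (Set.Icc l 1) a b c d := fun u hu => by
    rw [← h u ⟨hl0.trans hu.1, hu.2⟩]; exact t u hu
  have hm : (1 : ℝ) ∈ Set.Icc l 1 := ⟨hl1.le, le_rfl⟩
  have h1 : K.count 1 ≤ 1 := by
    rw [Multiset.count_eq_zero_of_notMem fun h => (hK 1 h).2.1.false]; exact zero_le_one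
  have df := hf.differentiable hK
  have dg := hg.differentiable hK
  constructor
  · rw [t.deriv_eq df hl1 hm, t'.deriv_eq dg hl1 hm]
  · rw [t.deriv_deriv_eq df hl1 hm (hf.differentiableAt_deriv h1),
      t'.deriv_deriv_eq dg hl1 hm (hg.differentiableAt_deriv h1)]

theorem differentiableAt_deriv_of_coordinates {K : Multiset ℝ} {c : ℝ → E3} {u : ℝ} (hu : u ∉ K)
    (hc : Differentiable ℝ c) (hs : ∀ i, IsCubicSpline K fun x => c x i) :
    DifferentiableAt ℝ (deriv c) u := by
  rw [differentiableAt_euclidean]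
  intro i
  have : (fun x => deriv c x i) = deriv fun x => c x i := funext fun x => deriv_apply (hc x) i
  rw [this]
  refine (hs i).differentiableAt_deriv ?_
  rw [Multiset.count_eq_zero_of_notMem hu]; exact zero_le_one

theorem deriv_deriv_apply {K : Multiset ℝ} {c : ℝ → E3} {u : ℝ} (hu : u ∉ K)
    (hc : Differentiable ℝ c) (hs : ∀ i, IsCubicSpline K fun x => c x i) (i : Fin 3) :
    deriv (deriv c) u i = deriv (deriv fun x => c x i) u := by
  rw [deriv_apply (differentiableAt_deriv_of_coordinates hu hc hs)]
  congr 1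
  exact funext fun x => deriv_apply (hc x) i

section

variable {K : Multiset ℝ} {M : QuadGluing} {α : M.Dart → ℝ → ℝ} {S : M.Quad → ℝ → ℝ → E3}
  {d : M.Dart} {q q' : M.Quad}

theorem edgeCurve_opp (hS : IsUnbiasedG1 α S) {u : ℝ} (hu : u ∈ Set.Icc (0 : ℝ) 1) :
    edgeCurve S (M.opp d) u = edgeCurve S d (1 - u) := by
  have := hS.join d (1 - u) ⟨by linarith [hu.2], by linarith [hu.1]⟩
  rw [QuadGluing.rot_symm, localPatch_next, sub_sub_cancel] at this
  rw [edgeCurve, edgeCurve, this]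

/-- The boundary curve along an edge that is the bottom side of a quad and the top side of
another one. -/
theorem edgePair_of_surface (hK : IsKnotMultiset K) (hS : IsSplineSurface K α S)
    (hd : d = (q, 0)) (hod : M.opp d = (q', 2)) {X : VertexData M} (hX : Interpolates S X)
    (i : Fin 3) : ∃ w, IsEdgePair K (α d) (fun u => edgeCurve S d u i) w ∧
      (edgeCurve S d 0 i = X.pos d i ∧ deriv (fun u => edgeCurve S d u i) 0 = X.tangent d i ∧
        deriv (deriv fun u => edgeCurve S d u i) 0 = X.second d i) ∧
      (edgeCurve S d 1 i = X.pos (M.opp d) i ∧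
        deriv (fun u => edgeCurve S d u i) 1 = - X.tangent (M.opp d) i ∧
        deriv (deriv fun u => edgeCurve S d u i) 1 = X.second (M.opp d) i) := by
  obtain ⟨-, hp1, hp2, hp3⟩ := (hS.spline q).coordinates hK
  obtain ⟨hr0, hr1, hr2, hr3⟩ := (hS.spline q').coordinates hK
  have hc : edgeCurve S d = fun u => S q u 0 := by
    funext u; rw [edgeCurve, hd]; rfl
  have ho : ∀ u v, localPatch S (M.opp d) u v = S q' (1 - u) (1 - v) := by
    intro u v; rw [hod]; rfl
  -- For a bottom side glued to a top side the parameter runs in the same direction in both quads.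
  -- Both cross-boundary derivatives are then splines with knots `K` itself, not with reflected
  -- knots.
  have hco : ∀ u ∈ Set.Icc (0 : ℝ) 1, S q u 0 = S q' u 1 := by
    intro u hu
    have h := edgeCurve_opp hS.g1 (d := d) (u := 1 - u) ⟨by linarith [hu.2], by linarith [hu.1]⟩
    rw [sub_sub_cancel, hc, edgeCurve, ho] at h
    simpa using h.symm
  have h0 : (0 : ℝ) ∉ K := fun h => (hK 0 h).1.false
  have h1 : (1 : ℝ) ∉ K := fun h => (hK 1 h).2.1.false
  obtain ⟨x0, x1, x2, -⟩ := hX d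
  obtain ⟨y0, y1, y2, -⟩ := hX (M.opp d)
  have hrefl : (fun x => localPatch S (M.opp d) x 0) = fun x => S q' (1 - x) 1 := by
    funext x; rw [ho, sub_zero]
  have hd1 : ∀ x, d1 (localPatch S (M.opp d)) x 0 = - deriv (fun u => S q' u 1) (1 - x) := by
    intro x
    rw [d1, hrefl]
    exact deriv_comp_const_sub (fun u => S q' u 1) 1 x
  have hjet := fun i => IsCubicSpline.jet_one_eq hK (hp2 0 i) (hr2 1 i)
    fun u hu => by rw [hco u hu]
  refine ⟨fun u => d2 (S q) u 0 i - d2 (S q') u 1 i, ⟨?_, ?_, fun u hu => ?_⟩, ⟨?_, ?_, ?_⟩,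
    ?_, ?_, ?_⟩
  · rw [hc]; exact hp2 0 i
  · simpa [sub_eq_add_neg] using (hp3 0 i).add ((hr3 1 i).const_mul (-1))
  · have ht := congrArg (fun x : E3 => x i) (hS.g1.tangent d u hu)
    rw [d1_localPatch_rot_symm] at ht
    have e1 : d2 (localPatch S d) u 0 = d2 (S q) u 0 := by rw [hd]; rfl
    have e2 : d2 (localPatch S (M.opp d)) (1 - u) 0 = - d2 (S q') u 1 := by
      have : (fun y => localPatch S (M.opp d) (1 - u) y) = fun y => S q' u (1 - y) := by
        funext y; rw [ho, sub_sub_cancel]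
      rw [d2, this, deriv_comp_const_sub, sub_zero]; rfl
    have e3 : d1 (localPatch S d) u 0 = deriv (fun u => S q u 0) u := by rw [hd]; rfl
    rw [e1, e2, e3] at ht
    have e4 := deriv_apply (hp1 0 u) i
    simp only [PiLp.add_apply, PiLp.neg_apply, PiLp.smul_apply, smul_eq_mul] at ht
    rw [hc, ← e4, ← ht]; ring
  · rw [← x0]; rfl
  · rw [← x1, hc, hd, ← deriv_apply (hp1 0 0) i]; rfl
  · rw [← x2, hc, hd, ← deriv_deriv_apply h0 (hp1 0) (hp2 0) i]; rfl
  · rw [← y0, hc, ho, sub_zero, ← hco 1 ⟨zero_le_one, le_rfl⟩]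
  · rw [← y1, hd1, sub_zero, hc, (hjet i).1, ← deriv_apply (hr1 1 1) i]; simp
  · have e : d1 (d1 (localPatch S (M.opp d))) 0 0 = deriv (deriv fun u => S q' u 1) 1 := by
      have : (fun x => d1 (localPatch S (M.opp d)) x 0)
          = fun x => - deriv (fun u => S q' u 1) (1 - x) := funext hd1
      rw [d1, this, deriv.fun_neg, deriv_comp_const_sub, neg_neg, sub_zero]
    rw [← y2, e, hc, (hjet i).2, ← deriv_deriv_apply h1 (hr1 1) (hr2 1) i]

theorem SameVertex.rot_right_iff {e : M.Dart} : M.SameVertex d (M.rot e) ↔ M.SameVertex d e :=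
  Equiv.Perm.sameCycle_apply_right

/-- Positions, second derivatives and one coordinate of the tangents can be prescribed at both ends
of an edge. -/
theorem exists_admissible (hM : ∀ d, 3 ≤ M.valence d) (hl : ¬ M.SameVertex d (M.opp d))
    (hS : Succeeds K M α) (P P' s s' : E3) (x y : ℝ) : ∃ X : VertexData M, IsAdmissible α X ∧
      X.pos d = P ∧ X.tangent d = !₂[1, 0, x] ∧ X.second d = s ∧
      X.pos (M.opp d) = P' ∧ X.tangent (M.opp d) 2 = y ∧ X.second (M.opp d) = s' := by
  classical
  have hdd : M.SameVertex d d := Equiv.Perm.SameCycle.refl _ _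
  obtain ⟨ω, hω0, hω⟩ := M.exists_phase hM
  -- `ν` rotates the tangent along `d` onto the first axis; `ρ` tilts the tangent planes at the two
  -- ends independently, which is possible because the ends are different vertices.
  obtain ⟨s₀, m₀, hadm⟩ := hS.solvable _ _ (isUnbiasedFrame_of_phase hM hω0 hω
    (pos := fun e => if M.SameVertex d e then P else P')
    (fun e => by simp only [SameVertex.rot_right_iff]) (ν := fun _ => (ω d)⁻¹)
    (ρ := fun e => if M.SameVertex d e then x * (ω d)⁻¹ else y * (ω (M.opp d))⁻¹)
    (fun e => inv_ne_zero (hω0 d)) (fun e => rfl)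
    (fun e => by simp only [SameVertex.rot_right_iff]))
  -- Adding the same vector to all second derivatives at a vertex stays admissible if half of it,
  -- times the unbiased value, is added to all twists.
  set σ : M.Dart → E3 := fun e => if M.SameVertex d e then s - s₀ d else s' - s₀ (M.opp d) with hσ
  have hσrot : ∀ e, σ (M.rot e) = σ e := fun e => by simp only [hσ, SameVertex.rot_right_iff]
  have huv : ∀ e, unbiasedValue M (M.rot.symm e) = unbiasedValue M e := fun e => by
    rw [unbiasedValue, unbiasedValue, QuadGluing.valence_rot_symm]
  refine ⟨⟨_, _, fun e => s₀ e + σ e, fun e => m₀ e + (unbiasedValue M e / 2) • σ e⟩,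
    ⟨hadm.frame, fun e => ?_⟩, ?_, ?_, ?_, ?_, ?_, ?_⟩
  · have h := hadm.mixed_rot e
    have h2 : σ (M.rot.symm e) = σ e := by rw [← hσrot, Equiv.apply_symm_apply]
    simp only [huv, h2] at h ⊢
    rw [add_add_add_comm, h]
    module
  · simp [hdd]
  · simp [hdd, hω0 d]
  · simp [hσ, hdd]
  · simp [hl]
  · simp [hl, hω0 (M.opp d)]
  · simp [hσ, hl]

/-- A curve in space two of whose coordinates vanish is straight. -/
theorem exists_coord_ne_zero {c : ℝ → E3} {s : ℕ → Set ℝ} (hs : Antitone s)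
    (hc : ∀ n, ¬ Collinear ℝ (c '' s n)) :
    ∃ i : Fin 3, i ≠ 0 ∧ ∀ n, ∃ u ∈ s n, c u i ≠ 0 := by
  by_contra hcon
  push Not at hcon
  obtain ⟨n₁, h₁⟩ := hcon 1 (by decide)
  obtain ⟨n₂, h₂⟩ := hcon 2 (by decide)
  refine hc (max n₁ n₂) ((collinear_iff_exists_forall_eq_smul_vadd _).2
    ⟨0, !₂[1, 0, 0], ?_⟩)
  rintro _ ⟨u, hu, rfl⟩
  refine ⟨c u 0, ?_⟩
  ext i
  fin_cases i
  · simp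
  · simpa using h₁ u (hs (le_max_left _ _) hu)
  · simpa using h₂ u (hs (le_max_right _ _) hu)

/-- The jets live in the third coordinate, since all constraints act coordinatewise. For `start` and
`finish` the vertex data lie on the first axis, so the other two coordinates have zero jets; if the
curve does not begin straight, one of them is nonzero arbitrarily close to the end. -/
theorem edgeSituation_of_succeeds (hK : IsKnotMultiset K) (hM : ∀ d, 3 ≤ M.valence d)
    (hl : ¬ M.SameVertex d (M.opp d)) (hS : Succeeds K M α) (hd : d = (q, 0))
    (hod : M.opp d = (q', 2)) : EdgeSituation K (α d) := by
  have hl' : ¬ M.SameVertex (M.opp d) (M.opp (M.opp d)) := by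
    rw [M.opp_opp]; exact fun h => hl (Equiv.Perm.SameCycle.symm h)
  have hdd : M.SameVertex d d := Equiv.Perm.SameCycle.refl _ _
  have hoo : M.SameVertex (M.opp d) (M.opp d) := Equiv.Perm.SameCycle.refl _ _
  refine ⟨hK, hS.unbiased.differentiable d, ?_, ?_, ?_, ?_, ?_⟩
  · have hmaps : Set.MapsTo (fun u : ℝ => 1 - u) (Set.Icc 0 1) (Set.Icc 0 1) :=
      fun u hu => ⟨by linarith [hu.2], by linarith [hu.1]⟩
    have h : DifferentiableWithinAt ℝ (α (M.opp d)) (Set.Icc 0 1) ((fun u : ℝ => 1 - u) 1) := by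
      simpa using hS.unbiased.differentiable (M.opp d)
    refine (h.comp 1 (by fun_prop) hmaps).neg.congr (fun u hu => ?_) ?_
    · simp [hS.unbiased.at_opp d (1 - u) (hmaps hu)]
    · simp [hS.unbiased.at_opp d 0 ⟨le_rfl, zero_le_one⟩]
  · intro x₀ x₁ x₂ y₀ y₁ y₂
    obtain ⟨X, hX, h⟩ := exists_admissible hM hl hS !₂[0, 0, x₀] !₂[0, 0, y₀] !₂[0, 0, x₂]
      !₂[0, 0, y₂] x₁ (-y₁)
    obtain ⟨S, hsurf, hinter⟩ := hS.realizes X hX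
    obtain ⟨w, hw, h1, h2⟩ := edgePair_of_surface hK hsurf hd hod hinter 2
    refine ⟨_, w, hw, ?_, ?_⟩
    · simpa [h] using h1
    · simpa [h] using h2
  · obtain ⟨X, S, hX, hsurf, hinter, hreg, hstr⟩ := hS.not_always_straight
    choose w hw using fun i => edgePair_of_surface hK hsurf hd hod hinter i
    refine ⟨fun i u => edgeCurve S d u i, w, fun i => (hw i).1, fun t ht => ?_,
      fun a b ha hab hb p E h => hstr d a b ha hab hb ?_⟩
    · obtain ⟨-, hp1, -, -⟩ := (hsurf.spline q).coordinates hK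
      have hne := (hreg q t ht (t, 0) (by simp)).ne_zero 0
      by_contra hcon
      push Not at hcon
      apply hne
      ext i
      have h := hcon i
      have hc : (fun u => edgeCurve S d u i) = fun u => S q u 0 i := by
        funext u; rw [edgeCurve, hd]; rfl
      rw [hc, ← deriv_apply (hp1 0 t) i] at h
      exact h
    · refine (collinear_iff_exists_forall_eq_smul_vadd _).2 ⟨WithLp.toLp 2 p, WithLp.toLp 2 E, ?_⟩
      rintro _ ⟨u, hu, rfl⟩
      obtain ⟨r, hr⟩ := h u hu
      refine ⟨r, ?_⟩
      ext i
      simp [hr i, add_comm]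
  · obtain ⟨X, hX, h0, h1, h2, -⟩ := exists_admissible hM hl hS 0 0 0 0 0 0
    obtain ⟨Y, S, hY, hagree, hsurf, hinter, hstr⟩ := hS.not_forced_straight X hX d
    obtain ⟨i, hi0, hi⟩ := exists_coord_ne_zero (c := edgeCurve S d)
      (s := fun n : ℕ => Set.Icc 0 (1 / ((n : ℝ) + 1)))
      (fun m n hmn => Set.Icc_subset_Icc_right (by gcongr)) fun n => hstr _ (by positivity)
        (by rw [div_le_one (by positivity)]; linarith [(Nat.cast_nonneg n : (0 : ℝ) ≤ n)])
    obtain ⟨w, hw, ⟨j0, j1, j2⟩, -⟩ := edgePair_of_surface hK hsurf hd hod hinter i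
    obtain ⟨a0, a1, a2, -⟩ := hagree d hdd
    refine ⟨_, w, hw, ?_, ?_, ?_, fun b hb _ => ?_⟩
    · rw [j0, ← a0, h0]; rfl
    · rw [j1, ← a1, h1]; fin_cases i <;> simp at hi0 ⊢
    · rw [j2, ← a2, h2]; rfl
    · obtain ⟨n, hn⟩ := exists_nat_one_div_lt hb
      obtain ⟨u, hu, hne⟩ := hi n
      exact ⟨u, ⟨hu.1, hu.2.trans hn.le⟩, hne⟩
  · obtain ⟨X, hX, h0, h1, h2, -⟩ := exists_admissible hM hl' hS 0 0 0 0 0 0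
    obtain ⟨Y, S, hY, hagree, hsurf, hinter, hstr⟩ := hS.not_forced_straight X hX (M.opp d)
    obtain ⟨i, hi0, hi⟩ := exists_coord_ne_zero (c := edgeCurve S (M.opp d))
      (s := fun n : ℕ => Set.Icc 0 (1 / ((n : ℝ) + 1)))
      (fun m n hmn => Set.Icc_subset_Icc_right (by gcongr)) fun n => hstr _ (by positivity)
        (by rw [div_le_one (by positivity)]; linarith [(Nat.cast_nonneg n : (0 : ℝ) ≤ n)])
    obtain ⟨w, hw, -, j0, j1, j2⟩ := edgePair_of_surface hK hsurf hd hod hinter i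
    obtain ⟨a0, a1, a2, -⟩ := hagree (M.opp d) hoo
    refine ⟨_, w, hw, ?_, ?_, ?_, fun a ha0 ha => ?_⟩
    · rw [j0, ← a0, h0]; rfl
    · rw [j1, ← a1, h1]; fin_cases i <;> simp at hi0 ⊢
    · rw [j2, ← a2, h2]; rfl
    · obtain ⟨n, hn⟩ := exists_nat_one_div_lt (show 0 < 1 - a by linarith)
      obtain ⟨u, hu, hne⟩ := hi n
      have hu1 : u ≤ 1 - a := hu.2.trans hn.le
      rw [edgeCurve_opp hsurf.g1 ⟨hu.1, by linarith⟩] at hne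
      exact ⟨1 - u, ⟨by linarith, by linarith [hu.1]⟩, hne⟩

/-- Around a vertex of valence four, opposite edges have scalar functions with the same slope. -/
theorem slope_eq_of_valence_four (hM : ∀ d, 3 ≤ M.valence d) (hS : Succeeds K M α)
    (h4 : M.valence d = 4) : derivWithin (α d) (Set.Icc 0 1) 0
      = derivWithin (α (M.rot (M.rot d))) (Set.Icc 0 1) 0 := by
  obtain ⟨ω, hω0, hω⟩ := M.exists_phase hM
  have hframe := isUnbiasedFrame_of_phase hM hω0 hω (pos := fun _ => 0) (fun _ => rfl)
    (ν := fun _ => 1) (ρ := fun _ => 0) (fun _ => one_ne_zero) (fun _ => rfl) (fun _ => rfl)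
  set t : M.Dart → E3 := fun d => !₂[(1 * ω d).re, (1 * ω d).im, (0 * ω d).re]
  obtain ⟨s, m, hadm⟩ := hS.solvable _ _ hframe
  have hper : M.rot (M.rot (M.rot (M.rot d))) = d := by
    have := Function.iterate_minimalPeriod (f := M.rot) (x := d)
    change M.rot^[M.valence d] d = d at this
    rw [h4] at this
    exact this
  have hsymm : M.rot.symm d = M.rot (M.rot (M.rot d)) := by rw [Equiv.symm_apply_eq, hper]
  have huv : ∀ e, M.valence e = 4 → unbiasedValue M e = 0 := fun e he => by
    rw [unbiasedValue, he, show 2 * Real.pi / (4 : ℕ) = Real.pi / 2 by push_cast; ring,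
      Real.cos_pi_div_two, mul_zero]
  have v1 : M.valence (M.rot d) = 4 := by rw [QuadGluing.valence_rot, h4]
  have v2 : M.valence (M.rot (M.rot d)) = 4 := by rw [QuadGluing.valence_rot, v1]
  have v3 : M.valence (M.rot (M.rot (M.rot d))) = 4 := by rw [QuadGluing.valence_rot, v2]
  have e0 := hadm.mixed_rot d
  have e1 := hadm.mixed_rot (M.rot d)
  have e2 := hadm.mixed_rot (M.rot (M.rot d))
  have e3 := hadm.mixed_rot (M.rot (M.rot (M.rot d)))
  have f1 := hframe.tangent_rot (M.rot d)
  have f2 := hframe.tangent_rot (M.rot (M.rot d))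
  rw [huv _ v1, Equiv.symm_apply_apply, zero_smul] at f1
  rw [huv _ v2, Equiv.symm_apply_apply, zero_smul] at f2
  have t2 : t (M.rot (M.rot d)) = - t d := eq_neg_of_add_eq_zero_left f1
  have t3 : t (M.rot (M.rot (M.rot d))) = - t (M.rot d) := eq_neg_of_add_eq_zero_left f2
  change m d + m _ = _ • s d + _ • t d at e0
  change m _ + m _ = _ • s _ + _ • t _ at e1
  change m _ + m _ = _ • s _ + _ • t _ at e2
  change m _ + m _ = _ • s _ + _ • t _ at e3
  rw [huv _ h4, zero_smul, zero_add, hsymm] at e0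
  rw [huv _ v1, zero_smul, zero_add, Equiv.symm_apply_apply] at e1
  rw [huv _ v2, zero_smul, zero_add, Equiv.symm_apply_apply, t2] at e2
  rw [huv _ v3, zero_smul, zero_add, Equiv.symm_apply_apply, t3] at e3
  generalize derivWithin (α d) (Set.Icc 0 1) 0 = r0 at *
  generalize derivWithin (α (M.rot d)) (Set.Icc 0 1) 0 = r1 at *
  generalize derivWithin (α (M.rot (M.rot d))) (Set.Icc 0 1) 0 = r2 at *
  generalize derivWithin (α (M.rot (M.rot (M.rot d)))) (Set.Icc 0 1) 0 = r3 at *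
  -- The alternating sum around the vertex eliminates all twists, the second derivatives have factor
  -- zero, and opposite tangents are negatives of each other.
  have key : (r0 - r2) • t d + (r3 - r1) • t (M.rot d) = 0 := by
    linear_combination (norm := module) -e0 + e1 - e2 + e3
  exact sub_eq_zero.1 (LinearIndependent.pair_iff.1 (hframe.regular d) _ _ key).1

end

/-! ### A mesh with a vertex of valence four between vertices of valence three and five -/

/-- The gluing of the sides of six quads. -/
def sixQuadsOpp (d : Fin 6 × Fin 4) : Fin 6 × Fin 4 :=
  (![![(1, 2), (5, 0), (2, 2), (3, 3)], ![(4, 3), (5, 1), (0, 0), (2, 3)],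
    ![(3, 2), (4, 2), (0, 2), (1, 3)], ![(4, 1), (5, 2), (2, 0), (0, 3)],
    ![(5, 3), (3, 0), (2, 1), (1, 0)], ![(0, 1), (1, 1), (3, 1), (4, 0)]] :
      Fin 6 → Fin 4 → Fin 6 × Fin 4) d.1 d.2

/-- The initial vertex of each dart. -/
def sixQuadsVertex (d : Fin 6 × Fin 4) : Fin 6 :=
  (![![0, 1, 2, 3], ![2, 4, 1, 0], ![0, 4, 3, 2], ![3, 5, 4, 0], ![2, 5, 3, 4], ![2, 1, 4, 5]] :
    Fin 6 → Fin 4 → Fin 6) d.1 d.2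

/-- The valence of each vertex. -/
def sixQuadsValence : Fin 6 → ℕ := ![4, 3, 5, 4, 5, 3]

theorem sixQuadsOpp_sixQuadsOpp : ∀ d, sixQuadsOpp (sixQuadsOpp d) = d := by decide

/-- Six quads with their sides glued. -/
def sixQuadsGluing : QuadGluing where
  Quad := Fin 6
  opp := Function.Involutive.toPerm sixQuadsOpp sixQuadsOpp_sixQuadsOpp
  opp_opp := sixQuadsOpp_sixQuadsOpp

theorem minimalPeriod_eq_of_forall_lt {β : Type*} {f : β → β} {x : β} {n : ℕ} (hn : 0 < n)
    (h : f^[n] x = x) (hlt : ∀ k < n, 0 < k → f^[k] x ≠ x) : Function.minimalPeriod f x = n := by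
  refine le_antisymm (Function.IsPeriodicPt.minimalPeriod_le hn h) (not_lt.1 fun hcon => ?_)
  exact hlt _ hcon (Function.IsPeriodicPt.minimalPeriod_pos hn h)
    Function.iterate_minimalPeriod

theorem sixQuads_valence (d : Fin 6 × Fin 4) :
    sixQuadsGluing.valence d = sixQuadsValence (sixQuadsVertex d) := by
  have h1 : ∀ d : Fin 6 × Fin 4, 0 < sixQuadsValence (sixQuadsVertex d) := by decide
  have h2 : ∀ d : Fin 6 × Fin 4, (fun d : Fin 6 × Fin 4 => sixQuadsOpp (d.1, d.2 - 1))^[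
      sixQuadsValence (sixQuadsVertex d)] d = d := by decide
  have h3 : ∀ d : Fin 6 × Fin 4, ∀ k < sixQuadsValence (sixQuadsVertex d), 0 < k →
      (fun d : Fin 6 × Fin 4 => sixQuadsOpp (d.1, d.2 - 1))^[k] d ≠ d := by decide
  exact minimalPeriod_eq_of_forall_lt (h1 d) (h2 d) (h3 d)

theorem sixQuads_vertex_eq {d e : Fin 6 × Fin 4} (h : sixQuadsGluing.SameVertex d e) :
    sixQuadsVertex d = sixQuadsVertex e := by
  have hrot : ∀ d : Fin 6 × Fin 4, sixQuadsVertex (sixQuadsOpp (d.1, d.2 - 1))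
      = sixQuadsVertex d := by decide
  have := sixQuadsGluing.finite_quad
  obtain ⟨n, -, rfl⟩ := Equiv.Perm.SameCycle.exists_pow_eq' h
  clear h
  induction n with
  | zero => rfl
  | succ n ih =>
    rw [pow_succ']
    exact ih.trans (hrot _).symm

/-- A closed mesh of six quads. -/
def sixQuads : QuadMesh where
  toQuadGluing := sixQuadsGluing
  three_le_valence d := by
    have h : ∀ d : Fin 6 × Fin 4, 3 ≤ sixQuadsValence (sixQuadsVertex d) := by decide
    exact (h d).trans_eq (sixQuads_valence d).symm
  loopless d h := by
    have hne : ∀ d : Fin 6 × Fin 4, sixQuadsVertex d ≠ sixQuadsVertex (sixQuadsOpp d) := by decide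
    exact hne d (sixQuads_vertex_eq h)

/-! ### The lower bound -/

/-- Only one edge would not suffice: a single double knot leaves the sign condition on `α'(0) α(1)`.
Two opposite edges at a vertex of valence four share `α'(0)` but have `α(1)` of opposite signs. -/
theorem exists_two_double {K : Multiset ℝ} (hK : IsKnotMultiset K) (hcard : K.card ≤ 4)
    (hS : Suffices K) : ∃ σ τ : ℝ, σ < τ ∧ K.count σ = 2 ∧ K.count τ = 2 := by
  obtain ⟨α, hα⟩ := hS sixQuads
  have hM := sixQuads.three_le_valence
  -- Opposite darts at a vertex of valence four, towards valence three and valence five, both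
  -- running along a bottom side that is glued to a top side.
  set d : sixQuads.Dart := ((0 : Fin 6), (0 : Fin 4)) with hd
  set e : sixQuads.Dart := ((2 : Fin 6), (0 : Fin 4)) with he
  have hde : sixQuads.rot (sixQuads.rot d) = e := rfl
  have hod : sixQuads.opp d = ((1 : Fin 6), (2 : Fin 4)) := rfl
  have hoe : sixQuads.opp e = ((3 : Fin 6), (2 : Fin 4)) := rfl
  have vd : sixQuads.valence d = 4 := sixQuads_valence d
  have ve : sixQuads.valence e = 4 := sixQuads_valence e
  have vod : sixQuads.valence (sixQuads.opp d) = 3 := sixQuads_valence _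
  have voe : sixQuads.valence (sixQuads.opp e) = 5 := sixQuads_valence _
  have hsd := edgeSituation_of_succeeds hK hM (sixQuads.loopless d) hα hd hod
  have hse := edgeSituation_of_succeeds hK hM (sixQuads.loopless e) hα he hoe
  have hslope := slope_eq_of_valence_four hM hα vd
  rw [hde] at hslope
  have hzero : ∀ x, sixQuads.valence x = 4 → α x 0 = 0 := fun x hx => by
    rw [hα.unbiased.at_vertex, unbiasedValue, hx,
      show 2 * Real.pi / (4 : ℕ) = Real.pi / 2 by push_cast; ring, Real.cos_pi_div_two, mul_zero]
  have hone : ∀ x, α x 1 = - unbiasedValue sixQuads.toQuadGluing (sixQuads.opp x) := fun x => by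
    rw [← hα.unbiased.at_vertex, hα.unbiased.at_opp x 0 ⟨le_rfl, zero_le_one⟩]; simp
  have hd1 : 0 < α d 1 := by
    rw [hone, unbiasedValue, vod]
    have : Real.cos (2 * Real.pi / (3 : ℕ)) < 0 :=
      Real.cos_neg_of_pi_div_two_lt_of_lt (by push_cast; linarith [Real.pi_pos])
        (by push_cast; linarith [Real.pi_pos])
    linarith
  have he1 : α e 1 < 0 := by
    rw [hone, unbiasedValue, voe]
    have : 0 < Real.cos (2 * Real.pi / (5 : ℕ)) :=
      Real.cos_pos_of_mem_Ioo ⟨by push_cast; linarith [Real.pi_pos],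
        by push_cast; linarith [Real.pi_pos]⟩
    linarith
  obtain ⟨τ, hτ⟩ : ∃ τ, K.count τ = 2 := by
    by_contra hcon
    push Not at hcon
    exact hsd.false_of_no_double (hzero d vd) hd1.ne' fun t => by
      have h1 := hK.count_le t
      have h2 := hcon t
      omega
  obtain ⟨σ, hστ, hσ⟩ : ∃ σ, σ ≠ τ ∧ K.count σ = 2 := by
    by_contra hcon
    push Not at hcon
    have hle : ∀ t, t ≠ τ → K.count t ≤ 1 := fun t ht => by
      have h1 := hK.count_le t
      have h2 := hcon t ht
      omega
    have h1 := hsd.slope_mul_neg_of_one_double (hzero d vd) hd1.ne' hτ hle hcard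
    have h2 := hse.slope_mul_neg_of_one_double (hzero e ve) he1.ne hτ hle hcard
    rw [hslope] at h1
    nlinarith
  rcases hστ.lt_or_gt with h | h
  · exact ⟨σ, τ, h, hσ, hτ⟩
  · exact ⟨τ, σ, h, hτ, hσ⟩

theorem knots_of_suffices {K : Multiset ℝ} (hK : IsKnotMultiset K) (hS : Suffices K) :
    twoDoubleKnots.card ≤ K.card ∧
      (K.card = twoDoubleKnots.card → ∃ σ τ : ℝ, σ < τ ∧ K = {σ, σ, τ, τ}) := by
  have h4 : twoDoubleKnots.card = 4 := rfl
  -- The inequality covers both claims: with fewer than four knots the conclusion itself is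
  -- contradictory.
  have key : K.card ≤ 4 → ∃ σ τ : ℝ, σ < τ ∧ K = {σ, σ, τ, τ} := by
    intro hcard
    obtain ⟨σ, τ, hστ, hσ, hτ⟩ := exists_two_double hK hcard hS
    refine ⟨σ, τ, hστ, (Multiset.eq_of_le_of_card_le (Multiset.le_iff_count.2 fun t => ?_)
      (by simpa using hcard)).symm⟩
    simp only [Multiset.insert_eq_cons, Multiset.count_cons, Multiset.count_singleton]
    split_ifs <;> subst_vars <;> first | omega | exact absurd hστ (lt_irrefl _)
  rw [h4]
  refine ⟨?_, fun h => key h.le⟩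
  by_contra hcon
  obtain ⟨σ, τ, -, rfl⟩ := key (by omega)
  simp at hcon

end SharpKnots

end

theorem mainTheorem2 :
    -- `3 × 3` arrays of `C¹`-connected bicubic Bézier patches are the bicubic splines
    -- with exactly two internal knots, both double
    (∀ p : ℝ → ℝ → E3, IsC1BezierArray p ↔
      ∃ s : ℝ → ℝ → E3, IsBicubicSpline twoDoubleKnots s ∧
        ∀ u ∈ Set.Icc (0 : ℝ) 1, ∀ v ∈ Set.Icc (0 : ℝ) 1, p u v = s u v) ∧
    -- with these knots there is a construction for all quad meshes, whose functions `α`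
    -- depend only on the two valences, are linear on the end segments and quadratic between
    (∃ a : ℕ → ℕ → ℝ → ℝ,
      (∀ m n : ℕ, 3 ≤ m → 3 ≤ n → ∃ p₀ p₁ p₂ : ℝ[X], HasSegments (a m n) p₀ p₁ p₂ ∧
        p₀.natDegree ≤ 1 ∧ p₁.natDegree ≤ 2 ∧ p₂.natDegree ≤ 1 ∧
        (m ≠ n → p₁.natDegree = 2)) ∧
      ∀ M : QuadMesh, Succeeds twoDoubleKnots M.toQuadGluing
        (fun d => a (M.valence d) (M.valence (M.opp d)))) ∧
    -- no construction uses fewer knots, and one with as few knots has two double knots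
    (∀ K : Multiset ℝ, IsKnotMultiset K → Suffices K →
      twoDoubleKnots.card ≤ K.card ∧
      (K.card = twoDoubleKnots.card → ∃ σ τ : ℝ, σ < τ ∧ K = {σ, σ, τ, τ})) := by
  exact ⟨isC1BezierArray_iff,
    ⟨edgeScalar, fun m n hm hn => edgeScalar_segments hm hn, succeeds_twoDoubleKnots⟩,
    fun K hK hS => knots_of_suffices hK hS⟩
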